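/- **Setting and notation.** Points of $\mathbb R^3$ are written $(x,y,z)$. "Distribution on $\mathbb R^2\times]-\pi,\pi[$, $2\pi$-periodic in the third variable" means a (complex-valued) tempered distribution on $\mathbb R^3$ that is invariant under translation by $(0,0,2\pi)$. Its Fourier coefficients are $u_n=\frac1{2\pi}\int_{-\pi}^{\pi}u(\cdot,\cdot,z)e^{-inz}\,dz\in\mathcal S'(\mathbb R^2)$, $n\in\mathbb Z$. Fix $\varphi\in\mathcal S(\mathbb R^2)$ supported in $\{\frac34\le|\xi|\le\frac83\}$ with $\sum_{q\in\mathbb Z}\varphi(2^{-q}\xi)=1$ for $\xi\ne0$, and let $\dot\Delta_q=\varphi(2^{-q}D_h)$, $D_h=-i(\partial_x,\partial_y)$, act in the horizontal variables $(x,y)$; let $\dot S_0u=\sum_{q\le-1}\dot\Delta_qu$ (convergence in the sense of tempered distributions). Put $$\|w\|_{\dot B^0_{\infty,1}(\mathbb R^2)}=\sum_{q\in\mathbb Z}\|\dot\Delta_qw\|_{L^\infty(\mathbb R^2)},\qquad \|u\|_{\mathscr{\dot B}^0_{\infty,1}}=\sum_{n\in\mathbb Z}\|u_n\|_{\dot B^0_{\infty,1}(\mathbb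 R^2)} .$$ All norms take values in $[0,\infty]$: a Lebesgue norm of a distribution is that of the function representing it, and $\infty$ if there is none (likewise $\|\dot S_0u\|=\infty$ if the series does not converge). The norm of a finite family of distributions is the sum of the norms of its entries, $\nabla_h=(\partial_x,\partial_y)$ and $(x,y)u=(xu,yu)$. **Lemma.** There is a constant $C<\infty$, depending only on $\varphi$, such that for every divergence free vector field $v=(v^1,v^2,v^3)$ (with tempered distributions as components) that is $2\pi$-periodic in the third variable, with $\Omega=\operatorname{curl}v$, the following hold: $$\|\nabla_h(xv)\|_{\mathscr{\dot B}^0_{\infty,1}}+\|\nabla_h(yv)\|_{\mathscr{\dot B}^0_{\infty,1}}\le C\Bigl(\|v\|_{L^2(\mathbb R^2\times]-\pi,\pi[)}+\|(x,y)\Omega\|_{\mathscr{\dot B}^0_{\infty,1}}+\|\Omega\|_{\mathscr{\dot B}^0_{\infty,1}}\Bigr);$$ for every integer $j\ge0$, $$\|\dot\Delta_j\nabla_h((x,y)v)\|_{L^\infty(\mathbb R^2\times]-\pi,\pi[)}\le C\,2^{j/2}\Bigl(\|\dot\Delta_j((x,y)\Omega)\|_{L^\infty(\mathbb R^2\times]-\pi,\pi[)}+\|\dot\Delta_j\Omega\|_{L^2(\mathbb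 R^2\times]-\pi,\pi[)}\Bigr);$$ and $$\|\dot S_0((x,y)v)\|_{L^\infty(\mathbb R^2\times]-\pi,\pi[)}\le C\Bigl(\|(x,y)v\|_{L^2(\mathbb R^2\times]-\pi,\pi[)}+\|v\|_{L^2(\mathbb R^2\times]-\pi,\pi[)}+\|(x,y)\Omega\|_{L^2(\mathbb R^2\times]-\pi,\pi[)}\Bigr).$$ -/

import Mathlib

open scoped SchwartzMap LineDeriv ENNReal NNReal ContDiff
open MeasureTheory

noncomputable section

namespace PeriodicBesov

/-! ### The spaces `ℝ²` and `ℝ³`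

Points of `ℝ³` are `(x, y, z)` with `x = p 0`, `y = p 1`, `z = p 2`, and `(x, y)` are the
horizontal variables. A distribution on `ℝ² × ]-π, π[` that is `2π`-periodic in the third
variable is a tempered distribution on `ℝ³` that is invariant under the translation by
`(0, 0, 2π)`. -/

/-- The horizontal plane. -/
abbrev R2 := EuclideanSpace ℝ (Fin 2)

/-- The physical space. -/
abbrev R3 := EuclideanSpace ℝ (Fin 3)

/-- The horizontal projection `(x, y, z) ↦ (x, y)`. -/
def horiz : R3 →L[ℝ] R2 :=
  LinearMap.toContinuousLinearMap
    { toFun := fun p => !₂[p 0, p 1]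
      map_add' := fun p q => by ext i; fin_cases i <;> simp
      map_smul' := fun c p => by ext i; fin_cases i <;> simp }

/-- The vertical coordinate `(x, y, z) ↦ z`. -/
def vert : R3 →L[ℝ] ℝ := EuclideanSpace.proj (2 : Fin 3)

@[simp] lemma horiz_apply_zero (p : R3) : horiz p 0 = p 0 := by simp [horiz]

@[simp] lemma horiz_apply_one (p : R3) : horiz p 1 = p 1 := by simp [horiz]

@[simp] lemma vert_apply (p : R3) : vert p = p 2 := rfl

/-- One period cell `ℝ² × ]-π, π[`. -/
def strip : Set R3 := {p | p 2 ∈ Set.Ioo (-Real.pi) Real.pi}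

/-! ### Elementary operations on tempered distributions on `ℝ³` -/

/-- `2π`-periodicity in the third variable. -/
def IsPeriodic (u : 𝓢'(R3, ℂ)) : Prop :=
  ∀ ψ : 𝓢(R3, ℂ),
    u (ψ.compSubConstCLM ℂ (EuclideanSpace.single (2 : Fin 3) (2 * Real.pi))) = u ψ

/-- The distributional partial derivative `∂ᵢ u`. -/
def pd (i : Fin 3) (u : 𝓢'(R3, ℂ)) : 𝓢'(R3, ℂ) :=
  ∂_{(EuclideanSpace.single i (1 : ℝ) : R3)} u

/-- Multiplication by the coordinate function `p ↦ p a`. -/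
def coordMul (a : Fin 3) (u : 𝓢'(R3, ℂ)) : 𝓢'(R3, ℂ) :=
  TemperedDistribution.smulLeftCLM ℂ (fun p : R3 => ((p a : ℝ) : ℂ)) u

/-- The multiplier in `coordMul` is admissible, so `coordMul` is the actual product. -/
lemma coord_hasTemperateGrowth (a : Fin 3) :
    (fun p : R3 => ((p a : ℝ) : ℂ)).HasTemperateGrowth :=
  (Complex.ofRealCLM ∘L
    (EuclideanSpace.proj a : R3 →L[ℝ] ℝ)).hasTemperateGrowth

/-- The divergence of a vector field. -/
def divergence (v : Fin 3 → 𝓢'(R3, ℂ)) : 𝓢'(R3, ℂ) :=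
  pd 0 (v 0) + pd 1 (v 1) + pd 2 (v 2)

/-- The curl of a vector field. -/
def curl (v : Fin 3 → 𝓢'(R3, ℂ)) : Fin 3 → 𝓢'(R3, ℂ) :=
  ![pd 1 (v 2) - pd 2 (v 1), pd 2 (v 0) - pd 0 (v 2), pd 0 (v 1) - pd 1 (v 0)]

/-! ### Lebesgue norms of distributions -/

/-- The tempered distribution `u` is the integration against the function `f`. -/
def IsRepresentedBy {E : Type*} [NormedAddCommGroup E] [NormedSpace ℝ E] [MeasureSpace E]
    (u : 𝓢'(E, ℂ)) (f : E → ℂ) : Prop :=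
  AEStronglyMeasurable f volume ∧
    ∀ ψ : 𝓢(E, ℂ), Integrable (fun p => ψ p * f p) volume ∧ u ψ = ∫ p, ψ p * f p

/-- The norm `‖u‖_{L^p(s)}` of a tempered distribution `u`: it is the `L^p(s)` norm of the
function (unique up to null sets) that represents `u`, and `∞` if there is no such function. -/
def distNorm {E : Type*} [NormedAddCommGroup E] [NormedSpace ℝ E] [MeasureSpace E]
    (p : ℝ≥0∞) (s : Set E) (u : 𝓢'(E, ℂ)) : ℝ≥0∞ :=
  ⨅ (f : E → ℂ) (_ : IsRepresentedBy u f), eLpNorm f p (volume.restrict s)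

/-! ### Littlewood-Paley theory in the horizontal variables -/

/-- `φ ∈ 𝓢(ℝ²)` is supported in the annulus `3/4 ≤ |ξ| ≤ 8/3` and
`∑_{q ∈ ℤ} φ(2^{-q} ξ) = 1` for all `ξ ≠ 0`. -/
def IsDyadicPartition (φ : 𝓢(R2, ℂ)) : Prop :=
  (∀ ξ : R2, φ ξ ≠ 0 → 3 / 4 ≤ ‖ξ‖ ∧ ‖ξ‖ ≤ 8 / 3) ∧
    ∀ ξ : R2, ξ ≠ 0 → HasSum (fun q : ℤ => φ ((2 : ℝ) ^ (-q) • ξ)) 1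

/-- The homogeneous dyadic block `Δ_q = φ(2^{-q} D)` on `ℝ²`. Here `D = -i∇`; the Fourier
transform of the library has the kernel `exp(-2πi⟨x, ξ⟩)`, hence the factor `2π`. -/
def block2 (φ : 𝓢(R2, ℂ)) (q : ℤ) (u : 𝓢'(R2, ℂ)) : 𝓢'(R2, ℂ) :=
  TemperedDistribution.fourierMultiplierCLM ℂ
    (fun ξ : R2 => φ (((2 : ℝ) ^ (-q) * (2 * Real.pi)) • ξ)) u

/-- The homogeneous dyadic block `Δ_q = φ(2^{-q} D_h)`, with `D_h = -i∇_h`, acting in the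
horizontal variables of a distribution on `ℝ³`. -/
def block3 (φ : 𝓢(R2, ℂ)) (q : ℤ) (u : 𝓢'(R3, ℂ)) : 𝓢'(R3, ℂ) :=
  TemperedDistribution.fourierMultiplierCLM ℂ
    (fun ξ : R3 => φ (((2 : ℝ) ^ (-q) * (2 * Real.pi)) • horiz ξ)) u

/-- The symbols of the dyadic blocks on `ℝ²` are admissible multipliers. -/
lemma symbol2_hasTemperateGrowth (φ : 𝓢(R2, ℂ)) (q : ℤ) :
    (fun ξ : R2 => φ (((2 : ℝ) ^ (-q) * (2 * Real.pi)) • ξ)).HasTemperateGrowth :=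
  φ.hasTemperateGrowth.comp
    ((((2 : ℝ) ^ (-q) * (2 * Real.pi)) • ContinuousLinearMap.id ℝ R2).hasTemperateGrowth)

/-- The symbols of the dyadic blocks on `ℝ³` are admissible multipliers. -/
lemma symbol3_hasTemperateGrowth (φ : 𝓢(R2, ℂ)) (q : ℤ) :
    (fun ξ : R3 => φ (((2 : ℝ) ^ (-q) * (2 * Real.pi)) • horiz ξ)).HasTemperateGrowth :=
  φ.hasTemperateGrowth.comp
    ((((2 : ℝ) ^ (-q) * (2 * Real.pi)) • horiz).hasTemperateGrowth)

/-- The norm `‖S_0 u‖_{L^p(ℝ² × ]-π, π[)}` of the low frequency part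
`S_0 u = ∑_{q ≤ -1} Δ_q u`, where the series has to converge in the space of tempered
distributions; it is `∞` if it does not converge. -/
def lowFreqNorm (φ : 𝓢(R2, ℂ)) (p : ℝ≥0∞) (u : 𝓢'(R3, ℂ)) : ℝ≥0∞ :=
  ⨅ (w : 𝓢'(R3, ℂ)) (_ : HasSum (fun q : Set.Iic (-1 : ℤ) => block3 φ q u) w),
    distNorm p strip w

/-! ### Fourier coefficients in the vertical variable -/

/-- A smooth bump function with support in `[-2π, 2π]` whose translates by the elements of
`2πℤ` add up to `1`. -/
def cutoff (z : ℝ) : ℝ :=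
  Real.smoothTransition (1 + z / (2 * Real.pi)) * Real.smoothTransition (1 - z / (2 * Real.pi))

lemma cutoff_contDiff : ContDiff ℝ ∞ cutoff := by
  unfold cutoff
  exact (Real.smoothTransition.contDiff.comp (by fun_prop)).mul
    (Real.smoothTransition.contDiff.comp (by fun_prop))

lemma cutoff_eq_zero {z : ℝ} (hz : 2 * Real.pi ≤ |z|) : cutoff z = 0 := by
  have hpi : 0 < 2 * Real.pi := by positivity
  unfold cutoff
  rcases le_abs.1 hz with h | h
  · rw [Real.smoothTransition.zero_of_nonpos (x := 1 - z / (2 * Real.pi)), mul_zero]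
    rw [sub_nonpos, one_le_div hpi]; exact h
  · rw [Real.smoothTransition.zero_of_nonpos (x := 1 + z / (2 * Real.pi)), zero_mul]
    have : 1 ≤ (-z) / (2 * Real.pi) := by rw [one_le_div hpi]; exact h
    rw [neg_div] at this; linarith

/-- The partition of unity property; by `cutoff_eq_zero` only two translates contribute. -/
lemma cutoff_add_cutoff {z : ℝ} (h0 : 0 ≤ z) (h1 : z ≤ 2 * Real.pi) :
    cutoff z + cutoff (z - 2 * Real.pi) = 1 := by
  have hpi : 0 < 2 * Real.pi := by positivity
  have hz : 0 ≤ z / (2 * Real.pi) := by positivity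
  have hz1 : z / (2 * Real.pi) ≤ 1 := by rw [div_le_one hpi]; exact h1
  unfold cutoff
  have e : (z - 2 * Real.pi) / (2 * Real.pi) = z / (2 * Real.pi) - 1 := by
    field_simp
  rw [e]
  set t := z / (2 * Real.pi)
  rw [Real.smoothTransition.one_of_one_le (x := 1 + t) (by linarith),
    Real.smoothTransition.one_of_one_le (x := 1 - (t - 1)) (by linarith)]
  have e2 : 1 + (t - 1) = t := by ring
  rw [e2, one_mul, mul_one]
  unfold Real.smoothTransition
  have hd := Real.smoothTransition.pos_denom t
  have e3 : 1 - (1 - t) = t := by ring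
  rw [e3, add_comm (expNegInvGlue (1 - t)), ← add_div, add_comm (expNegInvGlue (1 - t))]
  exact div_self hd.ne'

lemma mode_hasCompactSupport (n : ℤ) : HasCompactSupport
    (fun z : ℝ => (cutoff z : ℂ) * Complex.exp (-(Complex.I * n * z))) := by
  refine HasCompactSupport.intro (isCompact_Icc (a := -(2 * Real.pi)) (b := 2 * Real.pi)) ?_
  intro z hz
  have : 2 * Real.pi ≤ |z| := by
    by_contra! h
    exact hz ⟨(abs_lt.1 h).1.le, (abs_lt.1 h).2.le⟩
  simp [cutoff_eq_zero this]

lemma mode_contDiff (n : ℤ) : ContDiff ℝ ∞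
    (fun z : ℝ => (cutoff z : ℂ) * Complex.exp (-(Complex.I * n * z))) := by
  have h1 : ContDiff ℝ ∞ (fun z : ℝ => (z : ℂ)) := Complex.ofRealCLM.contDiff
  exact (h1.comp cutoff_contDiff).mul (Complex.contDiff_exp.comp (contDiff_const.mul h1).neg)

/-- The test function `z ↦ cutoff z * exp(-inz)`. -/
def mode (n : ℤ) : 𝓢(ℝ, ℂ) := (mode_hasCompactSupport n).toSchwartzMap (mode_contDiff n)

lemma comp_bound {D E : Type*} [NormedAddCommGroup D] [NormedSpace ℝ D] [NormedAddCommGroup E]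
    [NormedSpace ℝ E] (L : D →L[ℝ] E) (f : 𝓢(E, ℂ)) (k n i : ℕ) (hi : i ≤ n) (x : D) :
    (1 + ‖L x‖) ^ k * ‖iteratedFDeriv ℝ i (fun y => f (L y)) x‖ ≤
      ‖L‖ ^ i * (2 ^ k * (Finset.Iic (k, n)).sup (schwartzSeminormFamily ℂ E ℂ) f) := by
  have h1 := SchwartzMap.one_add_le_sup_seminorm_apply (𝕜 := ℂ) (m := (k, n)) (le_refl k) hi f (L x)
  have h2 : iteratedFDeriv ℝ i (fun y => f (L y)) x
      = (iteratedFDeriv ℝ i f (L x)).compContinuousLinearMap fun _ => L :=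
    L.iteratedFDeriv_comp_right (f := f) (f.smooth ⊤) x (i := i) (mod_cast le_top)
  have h3 : ‖iteratedFDeriv ℝ i (fun y => f (L y)) x‖
      ≤ ‖iteratedFDeriv ℝ i f (L x)‖ * ‖L‖ ^ i := by
    rw [h2]
    refine (ContinuousMultilinearMap.norm_compContinuousLinearMap_le _ _).trans ?_
    simp
  calc (1 + ‖L x‖) ^ k * ‖iteratedFDeriv ℝ i (fun y => f (L y)) x‖
      ≤ (1 + ‖L x‖) ^ k * (‖iteratedFDeriv ℝ i f (L x)‖ * ‖L‖ ^ i) := by gcongr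
    _ = ‖L‖ ^ i * ((1 + ‖L x‖) ^ k * ‖iteratedFDeriv ℝ i f (L x)‖) := by ring
    _ ≤ _ := mul_le_mul_of_nonneg_left h1 (by positivity)

lemma norm_le_horiz_vert (p : R3) : ‖p‖ ≤ (1 + ‖horiz p‖) * (1 + ‖vert p‖) := by
  have h : ‖p‖ ^ 2 = ‖horiz p‖ ^ 2 + ‖vert p‖ ^ 2 := by
    rw [EuclideanSpace.norm_sq_eq, EuclideanSpace.norm_sq_eq, Fin.sum_univ_three,
      Fin.sum_univ_two]
    simp
  nlinarith [norm_nonneg p, norm_nonneg (horiz p), norm_nonneg (vert p),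
    mul_nonneg (norm_nonneg (horiz p)) (norm_nonneg (vert p))]

/-- For a fixed test function `η` of `z`, the continuous linear map that sends the test function
`ψ` on `ℝ²` to the test function `(x, y, z) ↦ ψ(x, y) η(z)` on `ℝ³`. -/
def tensor (η : 𝓢(ℝ, ℂ)) : 𝓢(R2, ℂ) →L[ℂ] 𝓢(R3, ℂ) :=
  SchwartzMap.mkCLM (fun ψ p => ψ (horiz p) * η (vert p))
    (fun ψ₁ ψ₂ p => by simp [add_mul]) (fun c ψ p => by simp [mul_assoc])
    (fun ψ => ((ψ.smooth ⊤).comp horiz.contDiff).mul ((η.smooth ⊤).comp vert.contDiff)) <| by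
  rintro ⟨k, n⟩
  refine ⟨Finset.Iic (k, n), ∑ i ∈ Finset.range (n + 1), (n.choose i : ℝ) *
    ((‖horiz‖ ^ i * 2 ^ k) * (‖vert‖ ^ (n - i) * (2 ^ k *
      (Finset.Iic (k, n)).sup (schwartzSeminormFamily ℂ ℝ ℂ) η))), by positivity, ?_⟩
  intro ψ p
  have hprod := norm_iteratedFDeriv_mul_le (𝕜 := ℝ) (N := ∞) (n := n)
    (f := fun p => ψ (horiz p)) (g := fun p => η (vert p))
    ((ψ.smooth ⊤).comp horiz.contDiff) ((η.smooth ⊤).comp vert.contDiff) p (mod_cast le_top)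
  have hp : ‖p‖ ^ k ≤ (1 + ‖horiz p‖) ^ k * (1 + ‖vert p‖) ^ k := by
    rw [← mul_pow]
    exact pow_le_pow_left₀ (norm_nonneg _) (norm_le_horiz_vert p) k
  refine (mul_le_mul hp hprod (norm_nonneg _) (by positivity)).trans ?_
  rw [Finset.mul_sum, Finset.sum_mul]
  refine Finset.sum_le_sum fun i hi => ?_
  have hin : i ≤ n := by simpa [Nat.lt_succ_iff] using hi
  have h1 := comp_bound horiz ψ k n i hin p
  have h2 := comp_bound vert η k n (n - i) (Nat.sub_le _ _) p
  have h3 := mul_le_mul h1 h2 (by positivity) (by positivity)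
  calc _ = (n.choose i : ℝ) *
        (((1 + ‖horiz p‖) ^ k * ‖iteratedFDeriv ℝ i (fun y => ψ (horiz y)) p‖) *
          ((1 + ‖vert p‖) ^ k * ‖iteratedFDeriv ℝ (n - i) (fun y => η (vert y)) p‖)) := by ring
    _ ≤ _ := mul_le_mul_of_nonneg_left h3 (by positivity)
    _ = _ := by ring

@[simp] lemma tensor_apply (η : 𝓢(ℝ, ℂ)) (ψ : 𝓢(R2, ℂ)) (p : R3) :
    tensor η ψ p = ψ (horiz p) * η (vert p) := rfl

@[simp] lemma mode_apply (n : ℤ) (z : ℝ) :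
    mode n z = (cutoff z : ℂ) * Complex.exp (-(Complex.I * n * z)) := rfl

/-- The `n`-th Fourier coefficient `u_n = (2π)⁻¹ ∫_{-π}^{π} u(·, ·, z) exp(-inz) dz` of a
distribution that is `2π`-periodic in `z`. Integration over one period is testing against a
smooth function of `z` whose `2πℤ`-translates add up to `1`. -/
def fourierCoeff (n : ℤ) (u : 𝓢'(R3, ℂ)) : 𝓢'(R2, ℂ) :=
  ((2 * Real.pi : ℂ)⁻¹) • PointwiseConvergenceCLM.precomp ℂ (tensor (mode n)) u

lemma fourierCoeff_apply (n : ℤ) (u : 𝓢'(R3, ℂ)) (ψ : 𝓢(R2, ℂ)) :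
    fourierCoeff n u ψ = (2 * Real.pi : ℂ)⁻¹ * u (tensor (mode n) ψ) := rfl

/-! ### The Besov norms -/

/-- The norm of the homogeneous Besov space `Ḃ⁰_{∞,1}(ℝ²)`. -/
def besovNorm2 (φ : 𝓢(R2, ℂ)) (u : 𝓢'(R2, ℂ)) : ℝ≥0∞ :=
  ∑' q : ℤ, distNorm ∞ Set.univ (block2 φ q u)

/-- The norm `∑_{n ∈ ℤ} ‖u_n‖_{Ḃ⁰_{∞,1}(ℝ²)}` of a distribution that is `2π`-periodic in `z`. -/
def besovNorm (φ : 𝓢(R2, ℂ)) (u : 𝓢'(R3, ℂ)) : ℝ≥0∞ :=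
  ∑' n : ℤ, besovNorm2 φ (fourierCoeff n u)

/-- The two horizontal indices among the three coordinate indices. -/
abbrev hIdx (a : Fin 2) : Fin 3 := a.castSucc

end PeriodicBesov

end

open scoped SchwartzMap LineDeriv ENNReal NNReal ContDiff
open MeasureTheory

noncomputable section

namespace PeriodicBesov

/-! Since `div v = 0`, `-Δ vᵢ = ∑ₖ ∂ₖ(∂ᵢ vₖ - ∂ₖ vᵢ)`, a divergence of entries `0`, `±Ωⱼ`
(`neg_laplacian_eq`). Moving a weight `x_a` inside gives `-Δ(x_a vᵢ) = ∑ₖ ∂ₖ Gₖ`, where each `Gₖ`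
consists of an entry of `x_a Ω` up to sign and of components of `-v` (`neg_laplacian_coordMul_eq`).
Everything then reduces to estimates for a periodic `w` with `-Δ w = ∑ₖ ∂ₖ Gₖ`.

A dyadic block confines the horizontal frequency to an annulus away from `0`, where `Δ` can be
inverted: `Δ_q ∂_b w` and `Δ_q w` are multipliers of order `0` and `-1` applied to the `Δ_q Gₖ`
(`mult_elliptic`). In the rescaled frequencies `(η, τ)`, the symbol `|η|² + τ²` is replaced by
`ρ(η)² + τ²`, with `ρ = exp l` smooth and positive on the whole plane and equal to `|η|` on the
annulus. The symbols `g(η) τ^ε / (ρ² + τ²)`, `ε ≤ 1`, have explicit kernels: the inverse transform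
in the vertical variable produces `exp(-2π ρ(η) |z|)`, with a sign if `ε = 1`, and the inverse
transform in `η` is that of a Schwartz function whose seminorms decay in `z`. With horizontal scale
`r` and vertical scale `s` the `L¹` norms of the kernels stay bounded, and for `s ≤ 2π` their
vertically weighted `L²` norms are `O((r² s)^{-1/2})` (`exists_kernel`). The first bound gives `L^∞
→ L^∞`. The second gives `L²(strip) → L^∞` on periodic functions, by Cauchy-Schwarz with the weight
`1/(1 + z²)`, whose periodization is bounded (`exists_lintegral_pairing_le`).

Besov estimate: on each vertical Fourier coefficient, order-zero bounds control `∇_h(x_a v)` by `x_a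
Ω` and `v` in the Besov norm (`exists_besovNorm_pd_bound`). The Besov norm of `v` is controlled by
`Ω`, except for the blocks `q < 0` of the coefficient `n = 0`; there Bernstein's inequality gives
`2^q ‖v‖_{L²}`, which is summable (`exists_besovNorm_bound`).

Block estimate: the order-zero bound again leaves `Δ_j v`, and `‖Δ_j v‖_∞ ≤ C 2^{j/2} ‖Δ_j Ω‖_{L²}`
(`exists_block3_bound`).

Low frequencies: only `1 - ∂_z²` is inverted, and `(1 - ∂_z²) w = w + Δ_h w + ∑ₖ ∂ₖ Gₖ`. The kernels
have horizontal scale `2^{-q}` and vertical scale `1`, so that `L² → L^∞` costs `2^q`, summable over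
`q ≤ -1` (`exists_lowFreqNorm_bound`). -/

open FourierTransform

/-! ### Distributions represented by functions, and kernel bounds in `L^∞` -/

section Representation

variable {E : Type*} [NormedAddCommGroup E] [InnerProductSpace ℝ E] [FiniteDimensional ℝ E]
  [MeasurableSpace E] [BorelSpace E]

/-- The Fourier multiplier with symbol `m`. -/
abbrev mult (m : E → ℂ) : 𝓢'(E, ℂ) →L[ℂ] 𝓢'(E, ℂ) :=
  TemperedDistribution.fourierMultiplierCLM ℂ m

/-- The transpose of a Fourier multiplier whose symbol is the Fourier transform of an integrable
kernel acts on test functions as a correlation with the kernel. -/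
lemma fourier_smulLeft_fourierInv_apply {K : E → ℂ} (hK : Integrable K)
    (hm : (𝓕 K : E → ℂ).HasTemperateGrowth) (ψ : 𝓢(E, ℂ)) (p : E) :
    𝓕 (SchwartzMap.smulLeftCLM ℂ (𝓕 K : E → ℂ) (𝓕⁻ ψ)) p = ∫ y, K (y - p) * ψ y := by
  rw [SchwartzMap.fourier_coe, Real.fourier_eq]
  have h1 : ∀ ξ : E, 𝐞 (-inner ℝ ξ p) • SchwartzMap.smulLeftCLM ℂ (𝓕 K : E → ℂ) (𝓕⁻ ψ) ξ
      = ∫ y, K y * (𝐞 (-inner ℝ ξ (p + y)) • (𝓕⁻ ψ) ξ) := by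
    intro ξ
    rw [SchwartzMap.smulLeftCLM_apply_apply hm, Real.fourier_eq, smul_eq_mul,
      ← integral_mul_const, Circle.smul_def, smul_eq_mul, ← integral_const_mul]
    refine integral_congr_ae (Filter.Eventually.of_forall fun y => ?_)
    simp only [Circle.smul_def, smul_eq_mul, inner_add_right, neg_add, AddChar.map_add_eq_mul,
      Circle.coe_mul, real_inner_comm]
    ring
  simp_rw [h1]
  have hint : Integrable (Function.uncurry fun (ξ y : E) =>
      K y * (𝐞 (-inner ℝ ξ (p + y)) • (𝓕⁻ ψ) ξ)) (volume.prod volume) := by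
    have h2 : Integrable (fun z : E × E => (𝓕⁻ ψ) z.1 * K z.2) (volume.prod volume) :=
      (𝓕⁻ ψ).integrable.mul_prod hK
    refine (h2.bdd_mul (c := 1)
      (f := fun z : E × E => ((𝐞 (-inner ℝ z.1 (p + z.2)) : Circle) : ℂ)) ?_ ?_).congr ?_
    · refine Continuous.aestronglyMeasurable ?_
      exact continuous_subtype_val.comp (Real.continuous_fourierChar.comp (by fun_prop))
    · exact Filter.Eventually.of_forall fun z => (Circle.norm_coe _).le
    · refine Filter.Eventually.of_forall fun z => ?_
      simp only [Function.uncurry, Circle.smul_def, smul_eq_mul]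
      ring
  rw [integral_integral_swap hint]
  have h3 : ∀ y : E, ∫ ξ, K y * (𝐞 (-inner ℝ ξ (p + y)) • (𝓕⁻ ψ) ξ) = K y * ψ (p + y) := by
    intro y
    rw [integral_const_mul]
    congr 1
    have : 𝓕 (𝓕⁻ ψ) (p + y) = ψ (p + y) := by rw [fourier_fourierInv_eq]
    rw [← this, SchwartzMap.fourier_coe (𝓕⁻ ψ), Real.fourier_eq]
  simp_rw [h3]
  rw [← integral_sub_right_eq_self _ p]
  simp

/-- A tempered distribution that is given by an integral kernel is represented by a bounded
function as soon as the kernel is bounded in the appropriate sense. -/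
lemma exists_representation_of_kernel {X : Type*} [MeasurableSpace X] {μ : Measure X} [SFinite μ]
    (U : 𝓢'(E, ℂ)) {f : X → ℂ} {κ : X → E → ℂ} (hf : AEStronglyMeasurable f μ)
    (hκ : AEStronglyMeasurable (Function.uncurry κ) (μ.prod volume))
    (hU : ∀ ψ : 𝓢(E, ℂ), U ψ = ∫ p, f p * (∫ y, κ p y * ψ y) ∂μ) {B : ℝ≥0∞} (hB : B ≠ ⊤)
    (hbound : ∀ y, ∫⁻ p, ‖f p‖ₑ * ‖κ p y‖ₑ ∂μ ≤ B) :
    ∃ g, IsRepresentedBy U g ∧ ∀ y, ‖g y‖ₑ ≤ B := by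
  have hmeas : AEStronglyMeasurable (Function.uncurry fun (p : X) (y : E) => f p * κ p y)
      (μ.prod volume) := hf.comp_fst.mul hκ
  have hgm : AEStronglyMeasurable (fun y => ∫ p, f p * κ p y ∂μ) (volume : Measure E) :=
    (hmeas.prod_swap).integral_prod_right'
  have hgb : ∀ y, ‖∫ p, f p * κ p y ∂μ‖ₑ ≤ B := fun y =>
    (enorm_integral_le_lintegral_enorm _).trans (by simpa [enorm_mul] using hbound y)
  refine ⟨fun y => ∫ p, f p * κ p y ∂μ, ⟨hgm, fun ψ => ⟨?_, ?_⟩⟩, hgb⟩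
  · refine ψ.integrable.mul_bdd (c := B.toReal) hgm (Filter.Eventually.of_forall fun y => ?_)
    have := ENNReal.toReal_mono hB (hgb y)
    simpa using this
  · rw [hU]
    -- Integrating in `p` first, `hbound` leaves `B ‖ψ y‖`, so absolute integrability follows from
    -- `ψ ∈ L¹` alone and needs no integrability of `f`.
    have hint : Integrable (Function.uncurry fun (p : X) (y : E) => f p * (κ p y * ψ y))
        (μ.prod volume) := by
      refine ⟨hf.comp_fst.mul (hκ.mul ψ.continuous.aestronglyMeasurable.comp_snd), ?_⟩
      have hmeas2 : AEMeasurable (Function.uncurry fun (p : X) (y : E) =>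
          ‖f p‖ₑ * ‖κ p y‖ₑ * ‖ψ y‖ₑ) (μ.prod volume) :=
        (hf.comp_fst.enorm.mul hκ.enorm).mul ψ.continuous.aestronglyMeasurable.comp_snd.enorm
      have h1 : ∫⁻ z : X × E, ‖Function.uncurry (fun (p : X) (y : E) => f p * (κ p y * ψ y)) z‖ₑ
          ∂(μ.prod volume) = ∫⁻ y, ∫⁻ p, ‖f p‖ₑ * ‖κ p y‖ₑ * ‖ψ y‖ₑ ∂μ := by
        refine Eq.trans ?_ (lintegral_prod_symm (Function.uncurry fun (p : X) (y : E) =>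
          ‖f p‖ₑ * ‖κ p y‖ₑ * ‖ψ y‖ₑ) hmeas2)
        refine lintegral_congr fun z => ?_
        simp [Function.uncurry, enorm_mul, mul_assoc]
      rw [HasFiniteIntegral, h1]
      calc ∫⁻ y, ∫⁻ p, ‖f p‖ₑ * ‖κ p y‖ₑ * ‖ψ y‖ₑ ∂μ
          ≤ ∫⁻ y, B * ‖ψ y‖ₑ := by
            refine lintegral_mono fun y => ?_
            dsimp only
            rw [lintegral_mul_const' _ _ enorm_ne_top]
            gcongr
            exact hbound y
        _ = B * ∫⁻ y, ‖ψ y‖ₑ := lintegral_const_mul' _ _ hB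
        _ < ⊤ := ENNReal.mul_lt_top hB.lt_top ψ.integrable.2
    have h2 : ∀ p, f p * ∫ y, κ p y * ψ y = ∫ y, f p * (κ p y * ψ y) := fun p =>
      (integral_const_mul _ _).symm
    simp_rw [h2]
    rw [integral_integral_swap hint]
    refine integral_congr_ae (Filter.Eventually.of_forall fun y => ?_)
    simp only
    rw [← integral_const_mul]
    refine integral_congr_ae (Filter.Eventually.of_forall fun p => ?_)
    simp only
    ring

lemma eLpNorm_top_le_of_forall_enorm_le {X : Type*} [MeasurableSpace X] {μ : Measure X}
    {g : X → ℂ} {B : ℝ≥0∞} (h : ∀ y, ‖g y‖ₑ ≤ B) : eLpNorm g ∞ μ ≤ B := by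
  rw [eLpNorm_exponent_top]
  exact eLpNormEssSup_le_of_ae_enorm_bound (Filter.Eventually.of_forall h)

lemma distNorm_le_of_isRepresentedBy {u : 𝓢'(E, ℂ)} {f : E → ℂ} (h : IsRepresentedBy u f)
    (p : ℝ≥0∞) (s : Set E) : distNorm p s u ≤ eLpNorm f p (volume.restrict s) :=
  iInf₂_le f h

lemma le_distNorm {u : 𝓢'(E, ℂ)} {p : ℝ≥0∞} {s : Set E} {B : ℝ≥0∞}
    (h : ∀ f, IsRepresentedBy u f → B ≤ eLpNorm f p (volume.restrict s)) : B ≤ distNorm p s u :=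
  le_iInf₂ h

lemma distNorm_top_le_of_kernel {X : Type*} [MeasurableSpace X] {μ : Measure X} [SFinite μ]
    (U : 𝓢'(E, ℂ)) {f : X → ℂ} {κ : X → E → ℂ} (hf : AEStronglyMeasurable f μ)
    (hκ : AEStronglyMeasurable (Function.uncurry κ) (μ.prod volume))
    (hU : ∀ ψ : 𝓢(E, ℂ), U ψ = ∫ p, f p * (∫ y, κ p y * ψ y) ∂μ) {B : ℝ≥0∞}
    (hbound : ∀ y, ∫⁻ p, ‖f p‖ₑ * ‖κ p y‖ₑ ∂μ ≤ B) (s : Set E) : distNorm ∞ s U ≤ B := by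
  rcases eq_or_ne B ⊤ with rfl | hB
  · exact le_top
  obtain ⟨g, hg, hgB⟩ := exists_representation_of_kernel U hf hκ hU hB hbound
  exact (distNorm_le_of_isRepresentedBy hg _ _).trans (eLpNorm_top_le_of_forall_enorm_le hgB)

lemma distNorm_top_mult_le {K : E → ℂ} (hK : Integrable K)
    (hm : (𝓕 K : E → ℂ).HasTemperateGrowth) {W : 𝓢'(E, ℂ)} {f : E → ℂ}
    (hf : IsRepresentedBy W f) {B : ℝ≥0∞} (hbound : ∀ y, ∫⁻ p, ‖f p‖ₑ * ‖K (y - p)‖ₑ ≤ B)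
    (s : Set E) : distNorm ∞ s (mult (𝓕 K) W) ≤ B := by
  refine distNorm_top_le_of_kernel (μ := volume) (f := f) (κ := fun p y => K (y - p)) _ hf.1 ?_ ?_
    hbound s
  · exact hK.1.comp_quasiMeasurePreserving
      ((quasiMeasurePreserving_sub_of_right_invariant (volume : Measure E) volume).comp
        Measure.measurePreserving_swap.quasiMeasurePreserving)
  · intro ψ
    rw [TemperedDistribution.fourierMultiplierCLM_apply_apply, (hf.2 _).2]
    simp_rw [fourier_smulLeft_fourierInv_apply hK hm, mul_comm]

lemma distNorm_mono_set {u : 𝓢'(E, ℂ)} {p : ℝ≥0∞} {s t : Set E} (h : s ⊆ t) :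
    distNorm p s u ≤ distNorm p t u :=
  iInf₂_mono fun _ _ => eLpNorm_mono_measure _ (Measure.restrict_mono h le_rfl)

/-- Young's inequality for `L¹` against `L^∞`. The condition `A ≠ 0` matters when `W` has no
representing function: the right-hand side must then be `∞`, whereas `0 * ∞ = 0`. It also allows `A`
to be divided out before the infimum in `distNorm` is opened. -/
lemma distNorm_top_mult_le_mul {K : E → ℂ} (hK : Integrable K)
    (hm : (𝓕 K : E → ℂ).HasTemperateGrowth) {A : ℝ≥0} (hA : A ≠ 0) (hKA : ∫⁻ y, ‖K y‖ₑ ≤ A)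
    (W : 𝓢'(E, ℂ)) (s : Set E) :
    distNorm ∞ s (mult (𝓕 K) W) ≤ A * distNorm ∞ Set.univ W := by
  have hA' : (A : ℝ≥0∞) ≠ 0 := by simpa using hA
  rw [← ENNReal.div_le_iff' hA' ENNReal.coe_ne_top]
  refine le_distNorm fun f hf => ?_
  rw [ENNReal.div_le_iff' hA' ENNReal.coe_ne_top, Measure.restrict_univ]
  refine distNorm_top_mult_le hK hm hf (fun y => ?_) s
  calc ∫⁻ p, ‖f p‖ₑ * ‖K (y - p)‖ₑ ≤ ∫⁻ p, eLpNorm f ∞ volume * ‖K (y - p)‖ₑ := by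
        refine lintegral_mono_ae ?_
        filter_upwards [ae_le_eLpNormEssSup (f := f) (μ := volume)] with p hp
        rw [eLpNorm_exponent_top]
        gcongr
    _ = eLpNorm f ∞ volume * ∫⁻ p, ‖K (y - p)‖ₑ := by
        rw [lintegral_const_mul'']
        exact (hK.1.comp_quasiMeasurePreserving
          (quasiMeasurePreserving_sub_left_of_right_invariant volume y)).enorm
    _ = eLpNorm f ∞ volume * ∫⁻ p, ‖K p‖ₑ := by
        rw [lintegral_sub_left_eq_self (fun p => ‖K p‖ₑ) y]
    _ ≤ _ := by rw [mul_comm]; gcongr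

/-- A representing function is locally integrable. -/
lemma IsRepresentedBy.locallyIntegrable {u : 𝓢'(E, ℂ)} {f : E → ℂ} (h : IsRepresentedBy u f) :
    LocallyIntegrable f := by
  rw [locallyIntegrable_iff]
  intro k hk
  obtain ⟨R, hR⟩ := hk.isBounded.subset_closedBall (0 : E)
  -- The bump is `1` on a ball containing `k`, so its product with `f`, integrable by hypothesis,
  -- agrees with `f` on `k`.
  let b : ContDiffBump (0 : E) := ⟨|R| + 1, |R| + 2, by positivity, by linarith⟩
  have hb1 : HasCompactSupport fun x => (b x : ℂ) :=
    b.hasCompactSupport.comp_left (g := Complex.ofReal) Complex.ofReal_zero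
  have hb2 : ContDiff ℝ ∞ fun x => (b x : ℂ) := Complex.ofRealCLM.contDiff.comp b.contDiff
  have := (h.2 (hb1.toSchwartzMap hb2)).1.integrableOn (s := k)
  refine this.congr_fun_ae ?_
  filter_upwards [ae_restrict_mem hk.measurableSet] with x hx
  have hx1 : x ∈ Metric.closedBall (0 : E) (|R| + 1) := by
    have := hR hx
    rw [Metric.mem_closedBall] at this ⊢
    linarith [le_abs_self R]
  have : b x = 1 := b.one_of_mem_closedBall hx1
  simp [this]

lemma IsRepresentedBy.ae_eq {u : 𝓢'(E, ℂ)} {f g : E → ℂ} (hf : IsRepresentedBy u f)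
    (hg : IsRepresentedBy u g) : f =ᵐ[volume] g := by
  refine ae_eq_of_integral_contDiff_smul_eq hf.locallyIntegrable hg.locallyIntegrable ?_
  intro ψ hψ hψc
  have h1 : HasCompactSupport fun x => (ψ x : ℂ) :=
    hψc.comp_left (g := Complex.ofReal) Complex.ofReal_zero
  have h2 : ContDiff ℝ ∞ fun x => (ψ x : ℂ) := Complex.ofRealCLM.contDiff.comp hψ
  have e1 := (hf.2 (h1.toSchwartzMap h2)).2
  rw [(hg.2 (h1.toSchwartzMap h2)).2] at e1
  simpa [Complex.real_smul] using e1.symm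

lemma IsRepresentedBy.add {u v : 𝓢'(E, ℂ)} {f g : E → ℂ} (hf : IsRepresentedBy u f)
    (hg : IsRepresentedBy v g) : IsRepresentedBy (u + v) (f + g) := by
  refine ⟨hf.1.add hg.1, fun ψ => ?_⟩
  have hi := (hf.2 ψ).1.add (hg.2 ψ).1
  refine ⟨hi.congr (Filter.Eventually.of_forall fun p => by simp [mul_add]), ?_⟩
  have h1 : (u + v) ψ = u ψ + v ψ := rfl
  rw [h1, (hf.2 ψ).2, (hg.2 ψ).2, ← integral_add (hf.2 ψ).1 (hg.2 ψ).1]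
  simp [mul_add]

lemma IsRepresentedBy.const_smul {u : 𝓢'(E, ℂ)} {f : E → ℂ} (c : ℂ)
    (hf : IsRepresentedBy u f) : IsRepresentedBy (c • u) (c • f) := by
  refine ⟨hf.1.const_smul c, fun ψ => ?_⟩
  have hi := (hf.2 ψ).1.const_mul c
  refine ⟨hi.congr (Filter.Eventually.of_forall fun p => by simp; ring), ?_⟩
  have h1 : (c • u) ψ = c * u ψ := rfl
  rw [h1, (hf.2 ψ).2, ← integral_const_mul]
  refine integral_congr_ae (Filter.Eventually.of_forall fun p => ?_)
  simp only [Pi.smul_apply, smul_eq_mul]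
  ring

lemma distNorm_add_le (u v : 𝓢'(E, ℂ)) {p : ℝ≥0∞} (hp : 1 ≤ p) (s : Set E) :
    distNorm p s (u + v) ≤ distNorm p s u + distNorm p s v := by
  have h0 : ∀ f g, IsRepresentedBy u f → IsRepresentedBy v g → distNorm p s (u + v) ≤
      eLpNorm f p (volume.restrict s) + eLpNorm g p (volume.restrict s) := fun f g hf hg =>
    (distNorm_le_of_isRepresentedBy (hf.add hg) p s).trans
      (eLpNorm_add_le hf.1.restrict hg.1.restrict hp)
  unfold distNorm
  simp only [ENNReal.iInf_add, ENNReal.add_iInf]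
  exact le_iInf fun g => le_iInf fun hg => le_iInf fun f => le_iInf fun hf => h0 f g hf hg

lemma distNorm_smul_le {c : ℂ} (hc : c ≠ 0) (u : 𝓢'(E, ℂ)) {p : ℝ≥0∞} (s : Set E) :
    distNorm p s (c • u) ≤ ‖c‖ₑ * distNorm p s u := by
  have hc' : ‖c‖ₑ ≠ 0 := by simpa using hc
  rw [← ENNReal.div_le_iff' hc' enorm_ne_top]
  refine le_distNorm fun f hf => ?_
  rw [ENNReal.div_le_iff' hc' enorm_ne_top, ← eLpNorm_const_smul]
  exact distNorm_le_of_isRepresentedBy (hf.const_smul c) p s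

lemma distNorm_neg_le (u : 𝓢'(E, ℂ)) {p : ℝ≥0∞} (s : Set E) :
    distNorm p s (-u) ≤ distNorm p s u := by
  have := distNorm_smul_le (c := -1) (by simp) u (p := p) s
  have e : (-1 : ℂ) • u = -u := by
    ext ψ
    exact neg_one_mul (u ψ)
  rwa [e, enorm_neg, enorm_one, one_mul] at this

lemma distNorm_sub_le (u v : 𝓢'(E, ℂ)) {p : ℝ≥0∞} (hp : 1 ≤ p) (s : Set E) :
    distNorm p s (u - v) ≤ distNorm p s u + distNorm p s v := by
  rw [sub_eq_add_neg]
  exact (distNorm_add_le u (-v) hp s).trans (by gcongr; exact distNorm_neg_le v s)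

end Representation

/-! ### The splitting of the space into horizontal and vertical variables -/

/-- The point with given horizontal and vertical coordinates. -/
def join (x : R2) (z : ℝ) : R3 := !₂[x 0, x 1, z]

@[simp] lemma horiz_join (x : R2) (z : ℝ) : horiz (join x z) = x := by
  ext i; fin_cases i <;> simp [join]

@[simp] lemma vert_join (x : R2) (z : ℝ) : vert (join x z) = z := by simp [join]

@[simp] lemma join_apply_two (x : R2) (z : ℝ) : join x z 2 = z := by simp [join]

@[simp] lemma join_horiz_vert (p : R3) : join (horiz p) (vert p) = p := by
  ext i; fin_cases i <;> simp [join]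

lemma inner_eq_horiz_vert (p q : R3) :
    inner ℝ p q = inner ℝ (horiz p) (horiz q) + vert p * vert q := by
  simp [PiLp.inner_apply, Fin.sum_univ_three, Fin.sum_univ_two, mul_comm]

/-- The isometry between the space and the product of the plane and the line. -/
def splitIsometry : R3 ≃ₗᵢ[ℝ] WithLp 2 (R2 × ℝ) where
  toFun p := WithLp.toLp 2 (horiz p, vert p)
  invFun w := join w.fst w.snd
  map_add' p q := by simp [← WithLp.toLp_add]
  map_smul' c p := by simp [← WithLp.toLp_smul]
  left_inv p := join_horiz_vert p
  right_inv w := by simp; rfl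
  norm_map' p := by
    have h : ‖p‖ ^ 2 = ‖horiz p‖ ^ 2 + ‖vert p‖ ^ 2 := by
      rw [EuclideanSpace.norm_sq_eq, EuclideanSpace.norm_sq_eq, Fin.sum_univ_three,
        Fin.sum_univ_two]
      simp
    rw [← sq_eq_sq₀ (norm_nonneg _) (norm_nonneg _), WithLp.prod_norm_sq_eq_of_L2, h]
    rfl

/-- The measurable equivalence between the space and the product of the plane and the line. -/
def split : R3 ≃ᵐ R2 × ℝ :=
  splitIsometry.toMeasurableEquiv.trans (MeasurableEquiv.toLp 2 (R2 × ℝ)).symm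

lemma split_apply (p : R3) : split p = (horiz p, vert p) := rfl

lemma measurePreserving_split : MeasurePreserving split volume (volume.prod volume) :=
  (WithLp.volume_preserving_ofLp R2 ℝ).comp splitIsometry.measurePreserving

lemma measurePreserving_join :
    MeasurePreserving (fun w : R2 × ℝ => join w.1 w.2) (volume.prod volume) volume :=
  measurePreserving_split.symm

lemma measurableEmbedding_join : MeasurableEmbedding (fun w : R2 × ℝ => join w.1 w.2) :=
  split.symm.measurableEmbedding

lemma lintegral_split (F : R3 → ℝ≥0∞) :
    ∫⁻ p, F p = ∫⁻ w : R2 × ℝ, F (join w.1 w.2) ∂(volume.prod volume) :=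
  (measurePreserving_join.lintegral_comp_emb measurableEmbedding_join F).symm

lemma integral_split (F : R3 → ℂ) :
    ∫ p, F p = ∫ w : R2 × ℝ, F (join w.1 w.2) ∂(volume.prod volume) :=
  (measurePreserving_join.integral_comp measurableEmbedding_join F).symm

lemma lintegral_horiz_mul_vert {A : R2 → ℝ≥0∞} {B : ℝ → ℝ≥0∞} (hA : Measurable A)
    (hB : Measurable B) :
    ∫⁻ p : R3, A (horiz p) * B (vert p) = (∫⁻ x, A x) * ∫⁻ z, B z := by
  rw [lintegral_split]
  simp only [horiz_join, vert_join]
  exact lintegral_prod_mul hA.aemeasurable hB.aemeasurable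

lemma volume_vert_eq (a : ℝ) : volume {p : R3 | p 2 = a} = 0 := by
  have : {p : R3 | p 2 = a} = split ⁻¹' (Set.univ ×ˢ {a}) := by
    ext p; simp [split_apply]
  rw [this, measurePreserving_split.measure_preimage_equiv]
  simp

/-! ### Periodic functions -/

/-- The vertical unit vector times the period. -/
abbrev period : R3 := EuclideanSpace.single (2 : Fin 3) (2 * Real.pi)

/-- The half-open period cell. -/
def cell (n : ℤ) : Set R3 := {p | p 2 ∈ Set.Ioc (-Real.pi + n • (2 * Real.pi))
  (-Real.pi + (n + 1) • (2 * Real.pi))}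

lemma measurableSet_cell (n : ℤ) : MeasurableSet (cell n) :=
  measurableSet_Ioc.preimage (vert.continuous.measurable)

lemma iUnion_cell : ⋃ n, cell n = Set.univ := by
  have h := iUnion_Ioc_add_zsmul (p := 2 * Real.pi) (by positivity) (-Real.pi)
  ext p
  have h1 : p 2 ∈ ⋃ n : ℤ, Set.Ioc (-Real.pi + n • (2 * Real.pi))
      (-Real.pi + (n + 1) • (2 * Real.pi)) := by rw [h]; trivial
  simpa [cell] using h1

lemma pairwise_disjoint_cell : Pairwise (Function.onFun Disjoint cell) := by
  intro m n hmn
  have := Set.pairwise_disjoint_Ioc_add_zsmul (-Real.pi) (2 * Real.pi) hmn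
  exact Disjoint.preimage (fun p : R3 => p 2) this

/-- The half-open cells tile the space exactly, which the translates of the open strip do not; the
difference is a null plane. -/
lemma cell_zero_ae_eq_strip : cell 0 =ᵐ[volume] strip := by
  have h0 : volume {p : R3 | p 2 = Real.pi} = 0 := volume_vert_eq _
  have h1 : ∀ᵐ p : R3, p 2 ≠ Real.pi := by
    rw [ae_iff]; simpa using h0
  filter_upwards [h1] with p hp
  apply propext
  change p 2 ∈ Set.Ioc _ _ ↔ p 2 ∈ Set.Ioo _ _
  have e1 : -Real.pi + (0 : ℤ) • (2 * Real.pi) = -Real.pi := by simp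
  have e2 : -Real.pi + ((0 : ℤ) + 1) • (2 * Real.pi) = Real.pi := by simp; ring
  rw [e1, e2]
  exact ⟨fun h => ⟨h.1, lt_of_le_of_ne h.2 hp⟩, fun h => ⟨h.1, h.2.le⟩⟩

lemma restrict_cell_zero : (volume : Measure R3).restrict (cell 0) = volume.restrict strip :=
  Measure.restrict_congr_set cell_zero_ae_eq_strip

lemma preimage_cell (n : ℤ) : (fun p : R3 => p + n • period) ⁻¹' cell n = cell 0 := by
  ext p
  simp only [cell, Set.mem_preimage, Set.mem_ofPred_eq, Set.mem_Ioc, PiLp.add_apply, PiLp.smul_apply,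
    zsmul_eq_mul]
  simp only [period, PiLp.single_apply, if_true]
  push_cast
  constructor <;> rintro ⟨h1, h2⟩ <;> constructor <;> nlinarith

lemma ae_add_zsmul_period {β : Type*} {h : R3 → β} (hper : ∀ᵐ p, h (p + period) = h p) (n : ℤ) :
    ∀ᵐ p, h (p + n • period) = h p := by
  induction n with
  | zero => simp
  | succ n ih =>
    have := (measurePreserving_add_right volume ((n : ℤ) • period)).quasiMeasurePreserving.ae hper
    filter_upwards [ih, this] with p h1 h2
    rw [add_smul, one_smul, ← add_assoc, h2, h1]
  | pred n ih =>
    have := (measurePreserving_add_right volume ((-n - 1 : ℤ) • period)).quasiMeasurePreserving.ae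
      hper
    filter_upwards [ih, this] with p h1 h2
    rw [← h1, ← h2, add_assoc, sub_smul, one_smul, sub_add_cancel]

/-- Unfolding: cut the space into cells and translate each back to the cell `0`. The periodic factor
is unchanged and the other one is periodized. -/
lemma lintegral_mul_of_periodic {h w : R3 → ℝ≥0∞} (hh : AEMeasurable h) (hw : Measurable w)
    (hper : ∀ᵐ p, h (p + period) = h p) :
    ∫⁻ p, h p * w p = ∫⁻ p in strip, h p * ∑' n : ℤ, w (p + n • period) := by
  rw [← setLIntegral_univ, ← iUnion_cell, lintegral_iUnion measurableSet_cell
    pairwise_disjoint_cell, ← restrict_cell_zero]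
  simp_rw [← ENNReal.tsum_mul_left]
  rw [lintegral_tsum]
  · refine tsum_congr fun n => ?_
    rw [← (measurePreserving_add_right volume (n • period)).setLIntegral_comp_preimage_emb
      (measurableEmbedding_addRight _), preimage_cell]
    refine lintegral_congr_ae (ae_restrict_of_ae ?_)
    filter_upwards [ae_add_zsmul_period hper n] with p hp
    rw [hp]
  · intro n
    exact (hh.mul (hw.comp (measurable_add_const _)).aemeasurable).restrict

/-- The vertical weight. -/
def weight (z : ℝ) : ℝ≥0∞ := ENNReal.ofReal (1 + z ^ 2)⁻¹

lemma measurable_weight : Measurable weight := by unfold weight; fun_prop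

lemma exists_tsum_weight_le : ∃ C : ℝ≥0, ∀ a : ℝ, ∑' n : ℤ, weight (a - n * (2 * Real.pi)) ≤ C := by
  have hs : Summable fun n : ℤ => (1 + (n : ℝ) ^ 2)⁻¹ := by
    have h1 : Summable fun n : ℤ => 1 / (n : ℝ) ^ 2 := Real.summable_one_div_int_pow.2 (by norm_num)
    refine h1.of_norm_bounded_eventually ?_
    rw [Filter.eventually_cofinite]
    refine (Set.finite_singleton (0 : ℤ)).subset fun n hn => ?_
    by_contra h0
    refine hn ?_
    have : (0 : ℝ) < (n : ℝ) ^ 2 := by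
      have : (n : ℝ) ≠ 0 := by exact_mod_cast h0
      positivity
    rw [Real.norm_of_nonneg (by positivity), one_div]
    gcongr
    linarith
  refine ⟨(∑' n : ℤ, (1 + (n : ℝ) ^ 2)⁻¹).toNNReal, fun a => ?_⟩
  have hpi := Real.pi_gt_three
  -- With `2πm` the multiple of `2π` nearest to `a`, `|a - 2πm| ≤ π`. After reindexing, the `n`-th
  -- argument has modulus at least `2π|n| - π ≥ |n|` for `n ≠ 0`, and the sum is dominated by `∑ (1
  -- + n²)⁻¹`.
  set m := round (a / (2 * Real.pi))
  have hb : |a - m * (2 * Real.pi)| ≤ Real.pi := by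
    have h1 := abs_sub_round (a / (2 * Real.pi))
    have h2 : a - m * (2 * Real.pi) = (a / (2 * Real.pi) - m) * (2 * Real.pi) := by
      field_simp
    rw [h2, abs_mul, abs_of_pos (by positivity : (0 : ℝ) < 2 * Real.pi)]
    nlinarith
  rw [← (Equiv.addRight m).tsum_eq]
  change _ ≤ ENNReal.ofReal _
  rw [ENNReal.ofReal_tsum_of_nonneg (fun n => by positivity) hs]
  refine ENNReal.tsum_le_tsum fun n => ENNReal.ofReal_le_ofReal ?_
  refine inv_anti₀ (by positivity) (add_le_add le_rfl ?_)
  have e0 : ((Equiv.addRight m n : ℤ) : ℝ) = n + m := by simp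
  rw [sq_le_sq, e0]
  rcases eq_or_ne n 0 with rfl | hn
  · simp
  have hn1 : (1 : ℝ) ≤ |(n : ℝ)| := by exact_mod_cast Int.one_le_abs hn
  have e : a - (n + m) * (2 * Real.pi) = (a - m * (2 * Real.pi)) - n * (2 * Real.pi) := by ring
  rw [e]
  have h3 := abs_sub_abs_le_abs_sub (n * (2 * Real.pi)) (a - m * (2 * Real.pi))
  rw [abs_sub_comm (n * (2 * Real.pi))] at h3
  rw [abs_mul, abs_of_pos (by positivity : (0 : ℝ) < 2 * Real.pi)] at h3
  nlinarith

/-- The square integral of a periodic function against a decaying vertical weight is controlled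
by the square integral over one period. -/
lemma exists_lintegral_sq_mul_weight_le : ∃ C : ℝ≥0, ∀ f : R3 → ℂ, AEStronglyMeasurable f volume →
    (∀ᵐ p, f (p + period) = f p) → ∀ y : R3, ∫⁻ p, ‖f p‖ₑ ^ 2 * weight (vert (y - p)) ≤
      C * ∫⁻ p in strip, ‖f p‖ₑ ^ 2 := by
  obtain ⟨C, hC⟩ := exists_tsum_weight_le
  refine ⟨C, fun f hf hper y => ?_⟩
  have hm : Measurable fun p : R3 => weight (vert (y - p)) :=
    measurable_weight.comp (vert.continuous.measurable.comp (measurable_const.sub measurable_id))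
  rw [lintegral_mul_of_periodic (hf.enorm.pow_const 2) hm
    (by filter_upwards [hper] with p hp; rw [hp]), ← lintegral_const_mul' _ _ ENNReal.coe_ne_top]
  refine lintegral_mono fun p => ?_
  dsimp only
  rw [mul_comm]
  gcongr
  refine le_trans (le_of_eq (tsum_congr fun n => ?_)) (hC (y 2 - p 2))
  congr 1
  simp [period]
  ring

/-- The truncated difference `‖f‖ - M` is periodic and vanishes a.e. on the strip, so its integral
over the whole space unfolds to `0`. -/
lemma eLpNorm_top_le_strip {f : R3 → ℂ} (hf : AEStronglyMeasurable f volume)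
    (hper : ∀ᵐ p, f (p + period) = f p) :
    eLpNorm f ∞ volume ≤ eLpNorm f ∞ (volume.restrict strip) := by
  set M := eLpNorm f ∞ (volume.restrict strip) with hM
  have h0 : ∫⁻ p, (‖f p‖ₑ - M) * 1 = 0 := by
    rw [lintegral_mul_of_periodic (w := fun _ => 1) (hf.enorm.sub_const M) measurable_const
      (by filter_upwards [hper] with p hp; rw [hp])]
    refine lintegral_eq_zero_of_ae_eq_zero ?_
    filter_upwards [ae_le_eLpNormEssSup (f := f) (μ := volume.restrict strip)] with p hp
    rw [eLpNorm_exponent_top] at hM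
    rw [hM, tsub_eq_zero_of_le hp]
    simp
  simp only [mul_one] at h0
  rw [lintegral_eq_zero_iff' (hf.enorm.sub_const M)] at h0
  rw [eLpNorm_exponent_top]
  refine eLpNormEssSup_le_of_ae_enorm_bound ?_
  filter_upwards [h0] with p hp
  exact tsub_eq_zero_iff_le.1 hp

/-! ### Periodic distributions -/

/-- The translate of a representing function represents the translated distribution, which is `u`
itself; uniqueness of the representing function concludes. -/
lemma IsPeriodic.ae_add_period {u : 𝓢'(R3, ℂ)} (hu : IsPeriodic u) {f : R3 → ℂ}
    (hf : IsRepresentedBy u f) : ∀ᵐ p, f (p + period) = f p := by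
  have h : IsRepresentedBy u fun p => f (p + period) := by
    refine ⟨hf.1.comp_measurePreserving (measurePreserving_add_right volume period), fun ψ => ?_⟩
    have h1 := hf.2 (ψ.compSubConstCLM ℂ period)
    rw [hu ψ] at h1
    refine ⟨?_, ?_⟩
    · have := h1.1.comp_add_right period
      simpa using this
    · rw [h1.2, ← integral_add_right_eq_self _ period]
      simp
  exact h.ae_eq hf

lemma IsPeriodic.distNorm_top_univ_le {u : 𝓢'(R3, ℂ)} (hu : IsPeriodic u) :
    distNorm ∞ Set.univ u ≤ distNorm ∞ strip u := by
  refine le_distNorm fun f hf => (distNorm_le_of_isRepresentedBy hf _ _).trans ?_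
  rw [Measure.restrict_univ]
  exact eLpNorm_top_le_strip hf.1 (hu.ae_add_period hf)

lemma IsPeriodic.sub {u v : 𝓢'(R3, ℂ)} (hu : IsPeriodic u) (hv : IsPeriodic v) :
    IsPeriodic (u - v) := fun ψ => congrArg₂ (· - ·) (hu ψ) (hv ψ)

lemma IsPeriodic.pd {u : 𝓢'(R3, ℂ)} (hu : IsPeriodic u) (i : Fin 3) : IsPeriodic (pd i u) := by
  intro ψ
  have h : -∂_{(EuclideanSpace.single i (1 : ℝ) : R3)} (ψ.compSubConstCLM ℂ period)
      = (-∂_{(EuclideanSpace.single i (1 : ℝ) : R3)} ψ).compSubConstCLM ℂ period := by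
    ext p
    have e : fderiv ℝ (fun q : R3 => ψ (q - period)) p = fderiv ℝ ψ (p - period) :=
      fderiv_comp_sub _
    have e1 : ⇑(ψ.compSubConstCLM ℂ period) = fun q : R3 => ψ (q - period) := by
      ext q; simp
    rw [SchwartzMap.compSubConstCLM_apply, neg_apply, neg_apply,
      SchwartzMap.lineDerivOp_apply_eq_fderiv, SchwartzMap.lineDerivOp_apply_eq_fderiv, e1, e]
  simp only [PeriodicBesov.pd, TemperedDistribution.lineDerivOp_apply_apply]
  rw [h, hu]

lemma IsPeriodic.coordMul {u : 𝓢'(R3, ℂ)} (hu : IsPeriodic u) (a : Fin 2) :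
    IsPeriodic (coordMul (hIdx a) u) := by
  intro ψ
  have h : SchwartzMap.smulLeftCLM ℂ (fun p : R3 => ((p (hIdx a) : ℝ) : ℂ))
        (ψ.compSubConstCLM ℂ period)
      = (SchwartzMap.smulLeftCLM ℂ (fun p : R3 => ((p (hIdx a) : ℝ) : ℂ)) ψ).compSubConstCLM ℂ
        period := by
    ext p
    have e : (p - period) (hIdx a) = p (hIdx a) := by
      fin_cases a <;> simp [period]
    rw [SchwartzMap.compSubConstCLM_apply,
      SchwartzMap.smulLeftCLM_apply_apply (coord_hasTemperateGrowth _),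
      SchwartzMap.smulLeftCLM_apply_apply (coord_hasTemperateGrowth _),
      SchwartzMap.compSubConstCLM_apply, e]
  simp only [PeriodicBesov.coordMul, TemperedDistribution.smulLeftCLM_apply_apply]
  rw [h, hu]

/-- Under the inverse Fourier transform a translation becomes multiplication by a character, which
commutes with multiplication by `m`. -/
lemma IsPeriodic.mult {u : 𝓢'(R3, ℂ)} (hu : IsPeriodic u) {m : R3 → ℂ}
    (hm : m.HasTemperateGrowth) : IsPeriodic (mult m u) := by
  intro ψ
  have h1 : ∀ ξ, 𝓕⁻ (ψ.compSubConstCLM ℂ period) ξ = 𝐞 (inner ℝ period ξ) • 𝓕⁻ ψ ξ := by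
    intro ξ
    rw [SchwartzMap.fourierInv_coe, SchwartzMap.fourierInv_coe, Real.fourierInv_eq,
      Real.fourierInv_eq, ← integral_add_right_eq_self _ period, Circle.smul_def,
      ← integral_smul]
    refine integral_congr_ae (Filter.Eventually.of_forall fun p => ?_)
    simp only [SchwartzMap.compSubConstCLM_apply, add_sub_cancel_right, inner_add_left,
      AddChar.map_add_eq_mul, Circle.smul_def, Circle.coe_mul, smul_eq_mul]
    ring
  have h : 𝓕 (SchwartzMap.smulLeftCLM ℂ m (𝓕⁻ (ψ.compSubConstCLM ℂ period)))
      = (𝓕 (SchwartzMap.smulLeftCLM ℂ m (𝓕⁻ ψ))).compSubConstCLM ℂ period := by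
    ext p
    rw [SchwartzMap.compSubConstCLM_apply, SchwartzMap.fourier_coe, SchwartzMap.fourier_coe,
      Real.fourier_eq, Real.fourier_eq]
    refine integral_congr_ae (Filter.Eventually.of_forall fun ξ => ?_)
    have e : -inner ℝ ξ (p - period) = -inner ℝ ξ p + inner ℝ period ξ := by
      rw [inner_sub_right, real_inner_comm ξ period]; ring
    simp only [SchwartzMap.smulLeftCLM_apply_apply hm, h1, e, AddChar.map_add_eq_mul,
      Circle.smul_def, Circle.coe_mul, smul_eq_mul]
    ring
  simp only [TemperedDistribution.fourierMultiplierCLM_apply_apply]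
  rw [h, hu]

/-! ### Decaying exponentials as Schwartz functions -/

/-- A smooth function that agrees with `exp (-r)` for `0 ≤ r` and vanishes for `r ≤ -1`. -/
def expCut (r : ℝ) : ℝ := Real.smoothTransition (r + 1) * Real.exp (-r)

lemma expCut_contDiff : ContDiff ℝ ∞ expCut := by
  unfold expCut
  exact (Real.smoothTransition.contDiff.comp (by fun_prop)).mul (by fun_prop)

lemma expCut_of_nonneg {r : ℝ} (hr : 0 ≤ r) : expCut r = Real.exp (-r) := by
  rw [expCut, Real.smoothTransition.one_of_one_le (by linarith), one_mul]

lemma exists_pow_mul_iteratedDeriv_expCut_le (k n : ℕ) :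
    ∃ C, ∀ r, |r| ^ k * |iteratedDeriv n expCut r| ≤ C := by
  have hc : Continuous fun r : ℝ => |r| ^ k * |iteratedDeriv n expCut r| := by
    have := expCut_contDiff.continuous_iteratedDeriv n (mod_cast le_top)
    fun_prop
  obtain ⟨C, hC⟩ := (isCompact_Icc (a := (-1 : ℝ)) (b := 0)).exists_bound_of_continuousOn
    hc.continuousOn
  -- `C` covers the transition region `[-1, 0]`. For `r > 0` every derivative is `± exp (-r)` and `r
  -- ^ k / k! ≤ exp r` gives `k!`; for `r < -1` everything vanishes.
  refine ⟨max C k.factorial, fun r => ?_⟩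
  rcases lt_or_ge 0 r with hr | hr
  · refine le_max_of_le_right ?_
    have h1 : expCut =ᶠ[nhds r] fun s => Real.exp (-1 * s) := by
      filter_upwards [lt_mem_nhds hr] with s hs
      rw [expCut_of_nonneg hs.le, neg_one_mul]
    rw [h1.iteratedDeriv_eq, iteratedDeriv_exp_const_mul, abs_mul, abs_pow, abs_neg, abs_one,
      one_pow, one_mul, Real.abs_exp, abs_of_pos hr, neg_one_mul, Real.exp_neg,
      mul_inv_le_iff₀ (Real.exp_pos _)]
    have := Real.pow_div_factorial_le_exp r hr.le k
    rw [div_le_iff₀ (by positivity)] at this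
    linarith
  · rcases lt_or_ge r (-1) with hr1 | hr1
    · have h1 : expCut =ᶠ[nhds r] fun _ => (0 : ℝ) := by
        filter_upwards [gt_mem_nhds hr1] with s hs
        rw [expCut, Real.smoothTransition.zero_of_nonpos (by linarith), zero_mul]
      rw [h1.iteratedDeriv_eq]
      refine le_max_of_le_right ?_
      simp
    · refine le_max_of_le_left ((le_abs_self _).trans (hC r ⟨hr1, hr⟩))

/-- The Schwartz function `expCut`. -/
def expSchwartz : 𝓢(ℝ, ℂ) where
  toFun r := (expCut r : ℂ)
  smooth' := Complex.ofRealCLM.contDiff.comp expCut_contDiff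
  decay' k n := by
    obtain ⟨C, hC⟩ := exists_pow_mul_iteratedDeriv_expCut_le k n
    refine ⟨C, fun r => ?_⟩
    have h := Complex.ofRealLI.norm_iteratedFDeriv_comp_left (f := expCut) (x := r) (i := n)
      (n := ∞) expCut_contDiff.contDiffAt (mod_cast le_top)
    have h2 : (Complex.ofRealLI ∘ expCut) = fun r => (expCut r : ℂ) := rfl
    rw [h2] at h
    rw [h, norm_iteratedFDeriv_eq_norm_iteratedDeriv]
    exact hC r

lemma expSchwartz_apply_of_nonneg {r : ℝ} (hr : 0 ≤ r) :
    expSchwartz r = Complex.exp (-r) := by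
  change (expCut r : ℂ) = _
  rw [expCut_of_nonneg hr]
  simp

/-! ### Horizontal slices -/

/-- The embedding of the plane. -/
def joinL : R2 →L[ℝ] R3 :=
  LinearMap.toContinuousLinearMap
    { toFun := fun x => join x 0
      map_add' := fun p q => by ext i; fin_cases i <;> simp [join]
      map_smul' := fun c p => by ext i; fin_cases i <;> simp [join] }

lemma join_eq (x : R2) (z : ℝ) : join x z = joinL x + z • EuclideanSpace.single (2 : Fin 3) (1 : ℝ) := by
  ext i; fin_cases i <;> simp [join, joinL]

lemma norm_sq_join (x : R2) (z : ℝ) : ‖join x z‖ ^ 2 = ‖x‖ ^ 2 + z ^ 2 := by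
  rw [EuclideanSpace.norm_sq_eq, EuclideanSpace.norm_sq_eq, Fin.sum_univ_three,
    Fin.sum_univ_two]
  simp [join]

lemma norm_le_norm_join (x : R2) (z : ℝ) : ‖x‖ ≤ ‖join x z‖ := by
  have := norm_sq_join x z
  exact abs_le_of_sq_le_sq' (by nlinarith [sq_nonneg z]) (norm_nonneg _) |>.2

lemma abs_le_norm_join (x : R2) (z : ℝ) : |z| ≤ ‖join x z‖ := by
  have := norm_sq_join x z
  exact abs_le_of_sq_le_sq (by nlinarith [sq_nonneg ‖x‖]) (norm_nonneg _)

lemma norm_join_le (x : R2) (z : ℝ) : ‖join x z‖ ≤ ‖x‖ + |z| := by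
  have := norm_sq_join x z
  refine abs_le_of_sq_le_sq' ?_ (by positivity) |>.2
  nlinarith [mul_nonneg (norm_nonneg x) (abs_nonneg z), sq_abs z]

/-- Derivatives of a slice are restrictions of derivatives of `F`, and `1 + ‖join x z‖` dominates
both `1 + |z|` and `‖x‖`; four extra powers of decay of `F` pay for the factor in `z`. -/
lemma exists_slice (F : 𝓢(R3, ℂ)) : ∃ S : ℝ → 𝓢(R2, ℂ), (∀ z x, S z x = F (join x z)) ∧
    ∀ k n : ℕ, ∃ C, ∀ z, (1 + |z|) ^ 4 * SchwartzMap.seminorm ℂ k n (S z) ≤ C := by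
  have hsmooth : ∀ z, ContDiff ℝ ∞ fun x => F (join x z) := by
    intro z
    simp_rw [join_eq]
    exact (F.smooth ⊤).comp (joinL.contDiff.add contDiff_const)
  have hbound : ∀ k n : ℕ, ∃ C, 0 ≤ C ∧ ∀ z x, (1 + |z|) ^ 4 *
      (‖x‖ ^ k * ‖iteratedFDeriv ℝ n (fun x => F (join x z)) x‖) ≤ C := by
    intro k n
    refine ⟨‖joinL‖ ^ n * (2 ^ (k + 4) * (Finset.Iic (k + 4, n)).sup
      (schwartzSeminormFamily ℂ R3 ℂ) F), by positivity, fun z x => ?_⟩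
    have h1 := SchwartzMap.one_add_le_sup_seminorm_apply (𝕜 := ℂ) (m := (k + 4, n)) (le_refl (k + 4))
      (le_refl n) F (join x z)
    have h2 : iteratedFDeriv ℝ n (fun x => F (join x z)) x
        = (iteratedFDeriv ℝ n F (join x z)).compContinuousLinearMap fun _ => joinL := by
      have e : (fun x => F (join x z)) =
          (fun p => F (p + z • EuclideanSpace.single (2 : Fin 3) (1 : ℝ))) ∘ joinL := by
        ext x; simp [join_eq]
      have hd : ContDiff ℝ ∞ fun p => F (p + z • EuclideanSpace.single (2 : Fin 3) (1 : ℝ)) :=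
        (F.smooth ⊤).comp (contDiff_id.add contDiff_const)
      rw [e, joinL.iteratedFDeriv_comp_right hd x (mod_cast le_top),
        iteratedFDeriv_comp_add_right, join_eq]
    have h3 : ‖iteratedFDeriv ℝ n (fun x => F (join x z)) x‖
        ≤ ‖iteratedFDeriv ℝ n F (join x z)‖ * ‖joinL‖ ^ n := by
      rw [h2]
      refine (ContinuousMultilinearMap.norm_compContinuousLinearMap_le _ _).trans ?_
      simp
    have h4 : (1 + |z|) ^ 4 * ‖x‖ ^ k ≤ (1 + ‖join x z‖) ^ (k + 4) := by
      rw [pow_add, mul_comm]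
      gcongr
      · linarith [norm_le_norm_join x z]
      · exact abs_le_norm_join x z
    calc _ = ((1 + |z|) ^ 4 * ‖x‖ ^ k) * ‖iteratedFDeriv ℝ n (fun x => F (join x z)) x‖ := by ring
      _ ≤ (1 + ‖join x z‖) ^ (k + 4) * (‖iteratedFDeriv ℝ n F (join x z)‖ * ‖joinL‖ ^ n) := by gcongr
      _ = ‖joinL‖ ^ n * ((1 + ‖join x z‖) ^ (k + 4) * ‖iteratedFDeriv ℝ n F (join x z)‖) := by ring
      _ ≤ _ := mul_le_mul_of_nonneg_left h1 (by positivity)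
  refine ⟨fun z => ⟨fun x => F (join x z), hsmooth z, fun k n => ?_⟩, fun z x => rfl, fun k n => ?_⟩
  · obtain ⟨C, -, hC⟩ := hbound k n
    refine ⟨C, fun x => le_trans ?_ (hC z x)⟩
    refine le_mul_of_one_le_left (by positivity) (one_le_pow₀ ?_)
    linarith [abs_nonneg z]
  · obtain ⟨C, hC0, hC⟩ := hbound k n
    refine ⟨C, fun z => ?_⟩
    rw [← le_div_iff₀' (by positivity)]
    refine SchwartzMap.seminorm_le_bound ℂ k n _ (by positivity) fun x => ?_
    rw [le_div_iff₀' (by positivity)]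
    exact hC z x

/-- The exponential of a compactly supported smooth function has temperate growth. -/
lemma hasTemperateGrowth_exp {l : R2 → ℝ} (hl : ContDiff ℝ ∞ l) (hl' : HasCompactSupport l) :
    (fun η => Real.exp (l η)).HasTemperateGrowth := by
  have h1 : (fun η => Real.exp (l η) - 1).HasTemperateGrowth := by
    refine HasCompactSupport.hasTemperateGrowth ?_ (by fun_prop)
    exact hl'.comp_left (g := fun t => Real.exp t - 1) (by simp)
  have h2 := h1.add (Function.HasTemperateGrowth.const 1)
  have e : ((fun η => Real.exp (l η) - 1) + fun _ => 1) = fun η => Real.exp (l η) := by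
    ext η; simp
  rwa [e] at h2

/-- The function `exp (-2π ρ(η) |z|)` is not smooth at `z = 0`. Replacing the exponential by
`expSchwartz` gives slices of a genuine Schwartz function on the space, with the right values for `z
≥ 0`; the kernels below evaluate `S` only at absolute values. -/
lemma exists_exp_slice (g : 𝓢(R2, ℂ)) {l : R2 → ℝ} (hl : ContDiff ℝ ∞ l)
    (hl' : HasCompactSupport l) : ∃ S : ℝ → 𝓢(R2, ℂ),
      (∀ z, 0 ≤ z → ∀ η, S z η = g η * Complex.exp (-(2 * Real.pi * Real.exp (l η) * z : ℝ))) ∧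
      (Continuous fun w : R2 × ℝ => S w.2 w.1) ∧
    ∀ k n : ℕ, ∃ C, ∀ z, (1 + |z|) ^ 4 * SchwartzMap.seminorm ℂ k n (S z) ≤ C := by
  have hρ := hasTemperateGrowth_exp hl hl'
  -- The change of variables `(η, z) ↦ (η, 2π ρ(η) z)` with `ρ = exp l`.
  let G : R3 → R3 := fun p => joinL (horiz p) +
    (2 * Real.pi * Real.exp (l (horiz p)) * vert p) • EuclideanSpace.single (2 : Fin 3) (1 : ℝ)
  have hG' : ∀ p, G p = join (horiz p) (2 * Real.pi * Real.exp (l (horiz p)) * vert p) := fun p =>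
    (join_eq _ _).symm
  have hG : G.HasTemperateGrowth := by
    have h1 : (fun p : R3 => Real.exp (l (horiz p))).HasTemperateGrowth :=
      hρ.comp horiz.hasTemperateGrowth
    have h2 : (fun p : R3 => joinL (horiz p)).HasTemperateGrowth :=
      (joinL.comp horiz).hasTemperateGrowth
    have h3 : (fun p : R3 => vert p).HasTemperateGrowth := vert.hasTemperateGrowth
    exact h2.add ((((Function.HasTemperateGrowth.const _).mul h1).mul h3).smul
      (Function.HasTemperateGrowth.const _))
  obtain ⟨M, hM⟩ := hl.continuous.bounded_above_of_compact_support hl'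
  -- Properness of `G`, which makes composition preserve Schwartz functions: `l` is bounded, hence
  -- `ρ` is bounded below and `|z|` is controlled by `2π ρ |z|`.
  have hup : ∃ (k : ℕ) (C : ℝ), ∀ p, ‖p‖ ≤ C * (1 + ‖G p‖) ^ k := by
    refine ⟨1, 1 + Real.exp M, fun p => ?_⟩
    have h1 : ‖p‖ ≤ ‖horiz p‖ + |vert p| := by
      have := norm_join_le (horiz p) (vert p)
      rwa [join_horiz_vert] at this
    have h2 : ‖horiz p‖ ≤ ‖G p‖ := by rw [hG']; exact norm_le_norm_join _ _
    have h3 : 2 * Real.pi * Real.exp (l (horiz p)) * |vert p| ≤ ‖G p‖ := by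
      have := abs_le_norm_join (horiz p) (2 * Real.pi * Real.exp (l (horiz p)) * vert p)
      rw [hG']
      rwa [abs_mul, abs_of_pos (by positivity)] at this
    have h4 : 1 ≤ Real.exp M * Real.exp (l (horiz p)) := by
      rw [← Real.exp_add]
      refine Real.one_le_exp ?_
      have := hM (horiz p)
      rw [Real.norm_eq_abs] at this
      linarith [neg_abs_le (l (horiz p))]
    have h5 : |vert p| ≤ Real.exp M * ‖G p‖ := by
      have hpi := Real.pi_gt_three
      have hE := Real.exp_pos (l (horiz p))
      have h6 : Real.exp (l (horiz p)) * |vert p| ≤ ‖G p‖ := by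
        refine le_trans ?_ h3
        rw [mul_assoc]
        exact le_mul_of_one_le_left (by positivity) (by linarith)
      calc |vert p| ≤ (Real.exp M * Real.exp (l (horiz p))) * |vert p| :=
            le_mul_of_one_le_left (abs_nonneg _) h4
        _ = Real.exp M * (Real.exp (l (horiz p)) * |vert p|) := by ring
        _ ≤ _ := by gcongr
    rw [pow_one]
    nlinarith [Real.exp_pos M, norm_nonneg (G p)]
  let F : 𝓢(R3, ℂ) := SchwartzMap.compCLM ℂ hG hup (tensor expSchwartz g)
  have hF : ∀ x z, F (join x z) = g x * expSchwartz (2 * Real.pi * Real.exp (l x) * z) := by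
    intro x z
    change tensor expSchwartz g (G (join x z)) = _
    rw [hG']
    simp only [horiz_join, vert_join, tensor_apply]
  obtain ⟨S, hS, hS'⟩ := exists_slice F
  refine ⟨S, fun z hz η => ?_, ?_, hS'⟩
  · rw [hS, hF, expSchwartz_apply_of_nonneg (by positivity)]
  · simp_rw [hS, join_eq]
    exact F.continuous.comp (by fun_prop)

/-! ### Decay of the kernels -/

/-- The basic decay rate. -/
def decay {E : Type*} [NormedAddCommGroup E] (x : E) : ℝ≥0∞ := ENNReal.ofReal ((1 + ‖x‖) ^ 4)⁻¹

/-- Continuity of the inverse Fourier transform on Schwartz space bounds the weighted sup norm of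
`𝓕⁻ (S z)` by finitely many seminorms of `S z`, each of which decays like `(1 + |z|)⁻⁴`. -/
lemma exists_fourierInv_bound (S : ℝ → 𝓢(R2, ℂ))
    (hS : ∀ k n : ℕ, ∃ C, ∀ z, (1 + |z|) ^ 4 * SchwartzMap.seminorm ℂ k n (S z) ≤ C) :
    ∃ C : ℝ≥0, ∀ z x, ‖𝓕⁻ (S z) x‖ₑ ≤ C * (decay x * decay z) := by
  obtain ⟨C₁, hC₁⟩ : ∃ C₁, ∀ z x, (1 + |z|) ^ 4 * ((1 + ‖x‖) ^ 4 * ‖𝓕⁻ (S z) x‖) ≤ C₁ := by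
    let q : Seminorm ℂ 𝓢(R2, ℂ) := ((Finset.Iic (4, 0)).sup (schwartzSeminormFamily ℂ R2 ℂ)).comp
      (FourierTransform.fourierInvCLM ℂ 𝓢(R2, ℂ)).toLinearMap
    have hq : Continuous q := by
      have h1 : Continuous ⇑((Finset.Iic (4, 0)).sup (schwartzSeminormFamily ℂ R2 ℂ)) :=
        Seminorm.continuous_finsetSup fun i _ =>
          (schwartz_withSeminorms ℂ R2 ℂ).continuous_seminorm i
      exact h1.comp (FourierTransform.fourierInvCLM ℂ 𝓢(R2, ℂ)).continuous
    obtain ⟨s, A, -, hA⟩ := Seminorm.bound_of_continuous (schwartz_withSeminorms ℂ R2 ℂ) q hq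
    choose D hD using hS
    refine ⟨2 ^ 4 * (A * ∑ i ∈ s, D i.1 i.2), fun z x => ?_⟩
    have h1 := SchwartzMap.one_add_le_sup_seminorm_apply (𝕜 := ℂ) (m := (4, 0)) (le_refl 4)
      (le_refl 0) (𝓕⁻ (S z)) x
    rw [norm_iteratedFDeriv_zero] at h1
    have h2 : ((Finset.Iic (4, 0)).sup fun m => SchwartzMap.seminorm ℂ m.1 m.2) (𝓕⁻ (S z)) ≤
        A * (s.sup (schwartzSeminormFamily ℂ R2 ℂ)) (S z) := hA (S z)
    have h3 : (s.sup (schwartzSeminormFamily ℂ R2 ℂ)) (S z) ≤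
        ∑ i ∈ s, SchwartzMap.seminorm ℂ i.1 i.2 (S z) :=
      Seminorm.finset_sup_apply_le (Finset.sum_nonneg fun _ _ => apply_nonneg _ _) fun i hi =>
        Finset.single_le_sum (f := fun i : ℕ × ℕ => SchwartzMap.seminorm ℂ i.1 i.2 (S z))
          (fun _ _ => apply_nonneg _ _) hi
    calc _ ≤ (1 + |z|) ^ 4 * (2 ^ 4 * (A * ∑ i ∈ s, SchwartzMap.seminorm ℂ i.1 i.2 (S z))) := by
          refine mul_le_mul_of_nonneg_left (h1.trans ?_) (by positivity)
          refine mul_le_mul_of_nonneg_left (h2.trans ?_) (by positivity)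
          exact mul_le_mul_of_nonneg_left h3 A.2
      _ = 2 ^ 4 * (A * ∑ i ∈ s, (1 + |z|) ^ 4 * SchwartzMap.seminorm ℂ i.1 i.2 (S z)) := by
          rw [← Finset.mul_sum]; ring
      _ ≤ _ := by
          gcongr with i hi
          exact hD _ _ z
  refine ⟨C₁.toNNReal, fun z x => ?_⟩
  have h := hC₁ z x
  unfold decay
  rw [← ENNReal.ofReal_mul (by positivity), ← ofReal_norm]
  change _ ≤ ENNReal.ofReal C₁ * _
  rw [← ENNReal.ofReal_mul' (by positivity)]
  refine ENNReal.ofReal_le_ofReal ?_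
  rw [← mul_inv, ← div_eq_mul_inv, le_div_iff₀ (by positivity), Real.norm_eq_abs]
  linarith

lemma lintegral_decay_lt_top_R2 : ∫⁻ x : R2, decay x < ⊤ := by
  have h := integrable_one_add_norm (E := R2) (μ := volume) (r := 4) (by simp; norm_num)
  have := h.lintegral_lt_top
  refine lt_of_le_of_lt (lintegral_mono fun x => ?_) this
  refine ENNReal.ofReal_le_ofReal (le_of_eq ?_)
  rw [Real.rpow_neg (by positivity)]
  norm_cast

lemma lintegral_decay_lt_top_R : ∫⁻ x : ℝ, decay x < ⊤ := by
  have h := integrable_one_add_norm (E := ℝ) (μ := volume) (r := 4) (by simp)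
  have := h.lintegral_lt_top
  refine lt_of_le_of_lt (lintegral_mono fun x => ?_) this
  refine ENNReal.ofReal_le_ofReal (le_of_eq ?_)
  rw [Real.rpow_neg (by positivity)]
  norm_cast

lemma measurable_decay {E : Type*} [NormedAddCommGroup E] [MeasurableSpace E] [BorelSpace E] :
    Measurable (decay : E → ℝ≥0∞) := by unfold decay; fun_prop

lemma lintegral_comp_inv_smul {E : Type*} [NormedAddCommGroup E] [NormedSpace ℝ E]
    [FiniteDimensional ℝ E] [MeasurableSpace E] [BorelSpace E] (μ : Measure E) [μ.IsAddHaarMeasure]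
    {f : E → ℝ≥0∞} (hf : Measurable f) {r : ℝ} (hr : 0 < r) :
    ∫⁻ x, f (r⁻¹ • x) ∂μ = ENNReal.ofReal (r ^ Module.finrank ℝ E) * ∫⁻ x, f x ∂μ := by
  rw [← lintegral_map hf (measurable_const_smul _), Measure.map_addHaar_smul μ (inv_ne_zero hr.ne'),
    lintegral_smul_measure, smul_eq_mul]
  congr 2
  rw [inv_pow, inv_inv, abs_of_pos (by positivity)]

/-! ### The one-dimensional resolvent kernels -/

/-- The sign, as a complex number, to the power `ε`. -/
def signPow (ε : ℕ) (z : ℝ) : ℂ := (if 0 < z then 1 else -1) ^ ε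

lemma measurable_signPow (ε : ℕ) : Measurable (signPow ε) :=
  (Measurable.ite measurableSet_Ioi measurable_const measurable_const).pow_const ε

lemma norm_signPow (ε : ℕ) (z : ℝ) : ‖signPow ε z‖ = 1 := by
  unfold signPow; split_ifs <;> simp

/-- Splitting at `0` leaves two elementary exponential integrals. They add up to `2c / (c² +
(2πζ)²)` for `ε = 0` and to `-4πiζ / (c² + (2πζ)²)` for `ε = 1`: up to factors free of `ζ`, the two
vertical profiles `1 / (ρ² + τ²)` and `τ / (ρ² + τ²)`. -/
lemma integral_signPow_mul_exp (ε : ℕ) {c : ℝ} (hc : 0 < c) (ζ : ℝ) :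
    ∫ z : ℝ, 𝐞 (-(z * ζ)) • (signPow ε z * Complex.exp (-(c * |z| : ℝ))) =
      ((c + 2 * Real.pi * ζ * Complex.I : ℂ))⁻¹ + (-1) ^ ε * (c - 2 * Real.pi * ζ * Complex.I : ℂ)⁻¹ := by
  have hre1 : (-(c + 2 * Real.pi * ζ * Complex.I : ℂ)).re < 0 := by simp [hc]
  have hre2 : 0 < ((c - 2 * Real.pi * ζ * Complex.I : ℂ)).re := by simp [hc]
  have h1 : Set.EqOn (fun z : ℝ => 𝐞 (-(z * ζ)) • (signPow ε z * Complex.exp (-(c * |z| : ℝ))))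
      (fun z : ℝ => Complex.exp (-(c + 2 * Real.pi * ζ * Complex.I : ℂ) * z)) (Set.Ioi 0) := by
    intro z hz
    have hz' : 0 < z := hz
    simp only [Circle.smul_def, Real.fourierChar_apply, signPow, if_pos hz', abs_of_pos hz',
      one_pow, one_mul, smul_eq_mul, ← Complex.exp_add]
    congr 1
    push_cast
    ring
  have h2 : Set.EqOn (fun z : ℝ => 𝐞 (-(z * ζ)) • (signPow ε z * Complex.exp (-(c * |z| : ℝ))))
      (fun z : ℝ => (-1) ^ ε * Complex.exp ((c - 2 * Real.pi * ζ * Complex.I : ℂ) * z))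
      (Set.Iic 0) := by
    intro z hz
    have hz' : z ≤ 0 := hz
    simp only [Circle.smul_def, Real.fourierChar_apply, signPow, if_neg (not_lt.2 hz'),
      abs_of_nonpos hz', smul_eq_mul]
    rw [mul_left_comm, ← Complex.exp_add]
    congr 2
    push_cast
    ring
  have i1 := (integrableOn_exp_mul_complex_Ioi hre1 0).congr_fun h1.symm measurableSet_Ioi
  have i2 : IntegrableOn _ _ _ := IntegrableOn.congr_fun
    ((integrableOn_exp_mul_complex_Iic hre2 0).const_mul ((-1 : ℂ) ^ ε)) h2.symm measurableSet_Iic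
  rw [← intervalIntegral.integral_Iic_add_Ioi i2 i1, setIntegral_congr_fun measurableSet_Ioi h1,
    setIntegral_congr_fun measurableSet_Iic h2, integral_const_mul,
    integral_exp_mul_complex_Ioi hre1, integral_exp_mul_complex_Iic hre2, add_comm]
  congr 1
  · simp only [Complex.ofReal_zero, mul_zero, Complex.exp_zero, neg_div_neg_eq, one_div]
  · simp [div_eq_mul_inv]

/-! ### The resolvent kernels in space -/

/-- The symbol `g(η) τ^ε / (ρ(η)² + τ²)`, where `ρ = exp l`, `η` is `r` times the horizontal
frequency and `τ` is `s` times the vertical frequency. -/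
def resolvent (g : 𝓢(R2, ℂ)) (l : R2 → ℝ) (ε : ℕ) (r s : ℝ) (ξ : R3) : ℂ :=
  g (r • horiz ξ) * ((s * vert ξ : ℝ) : ℂ) ^ ε *
    (((Real.exp (l (r • horiz ξ))) ^ 2 + (s * vert ξ) ^ 2 : ℝ) : ℂ)⁻¹

/-- Write `(ρ² + τ²)⁻¹ = ρ⁻² (1 + (τ / ρ)²)⁻¹` with `ρ⁻¹ = exp (-l)`; the last factor is a power of
the Japanese bracket composed with a map of temperate growth. -/
lemma resolvent_hasTemperateGrowth (g : 𝓢(R2, ℂ)) {l : R2 → ℝ} (hl : ContDiff ℝ ∞ l)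
    (hl' : HasCompactSupport l) (ε : ℕ) (r s : ℝ) :
    (resolvent g l ε r s).HasTemperateGrowth := by
  have hκ : (fun ξ : R3 => Real.exp (-l (r • horiz ξ))).HasTemperateGrowth :=
    (hasTemperateGrowth_exp (l := fun x => -l x) hl.neg
      (hl'.comp_left (g := fun t : ℝ => -t) neg_zero)).comp (r • horiz).hasTemperateGrowth
  have hg : (fun ξ : R3 => g (r • horiz ξ)).HasTemperateGrowth :=
    g.hasTemperateGrowth.comp (r • horiz).hasTemperateGrowth
  have hτ : (fun ξ : R3 => s * vert ξ).HasTemperateGrowth := (s • vert).hasTemperateGrowth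
  have hJ : (fun y : ℝ => (1 + ‖y‖ ^ 2) ^ (-1 : ℝ)).HasTemperateGrowth :=
    Function.hasTemperateGrowth_one_add_norm_sq_rpow ℝ (-1)
  have hJ2 := hJ.comp (hτ.mul hκ)
  have h1 : (fun ξ : R3 => ((Real.exp (-l (r • horiz ξ)) ^ 2 *
      (1 + ‖s * vert ξ * Real.exp (-l (r • horiz ξ))‖ ^ 2) ^ (-1 : ℝ) : ℝ) : ℂ)).HasTemperateGrowth :=
    Function.Complex.hasTemperateGrowth_ofReal.comp ((hκ.pow 2).mul hJ2)
  have h2 : (fun ξ : R3 => g (r • horiz ξ) * ((s * vert ξ : ℝ) : ℂ) ^ ε *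
      ((Real.exp (-l (r • horiz ξ)) ^ 2 *
      (1 + ‖s * vert ξ * Real.exp (-l (r • horiz ξ))‖ ^ 2) ^ (-1 : ℝ) : ℝ) : ℂ)).HasTemperateGrowth :=
    (hg.mul ((Function.Complex.hasTemperateGrowth_ofReal.comp hτ).pow ε)).mul h1
  refine (congrArg Function.HasTemperateGrowth (funext fun ξ => ?_)).mp h2
  simp only [resolvent]
  congr 1
  rw [← Complex.ofReal_inv]
  congr 1
  rw [Real.rpow_neg_one, Real.norm_eq_abs, sq_abs, Real.exp_neg,
    inv_pow, ← mul_inv]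
  congr 1
  have := Real.exp_pos (l (r • horiz ξ))
  field_simp

lemma integral_fourierChar_smul_comp_inv_smul (f : R2 → ℂ) {r : ℝ} (hr : 0 < r) (ξ : R2) :
    ∫ x, 𝐞 (-inner ℝ x ξ) • f (r⁻¹ • x) = (r : ℂ) ^ 2 * 𝓕 f (r • ξ) := by
  have h := Measure.integral_comp_smul (volume : Measure R2)
    (fun y => 𝐞 (-inner ℝ y (r • ξ)) • f y) r⁻¹
  have e : ∀ x : R2, 𝐞 (-inner ℝ (r⁻¹ • x) (r • ξ)) • f (r⁻¹ • x)
      = 𝐞 (-inner ℝ x ξ) • f (r⁻¹ • x) := by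
    intro x
    rw [inner_smul_left, inner_smul_right]
    congr 3
    simp
    field_simp
  simp_rw [e] at h
  rw [h, Real.fourier_eq]
  simp [abs_of_pos hr]

/-- The rescaled kernel with horizontal Fourier transforms `S`. -/
def kern (S : ℝ → 𝓢(R2, ℂ)) (ε : ℕ) (r s : ℝ) (p : R3) : ℂ :=
  ((r ^ 2 * s : ℝ) : ℂ)⁻¹ * (signPow ε (vert p) * 𝓕⁻ (S |s⁻¹ * vert p|) (r⁻¹ • horiz p))

section Kern

variable {S : ℝ → 𝓢(R2, ℂ)} (hcont : Continuous fun w : R2 × ℝ => S w.2 w.1)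

include hcont in
lemma measurable_kern (ε : ℕ) (r s : ℝ) : Measurable (kern S ε r s) := by
  have h1 : StronglyMeasurable fun w : R2 × ℝ => ∫ η, 𝐞 (inner ℝ η w.1) • S w.2 η := by
    have h2 : Continuous fun w : (R2 × ℝ) × R2 => 𝐞 (inner ℝ w.2 w.1.1) • S w.1.2 w.2 := by
      have h0 : Continuous fun w : (R2 × ℝ) × R2 => inner ℝ w.2 w.1.1 := by fun_prop
      refine Continuous.smul (continuous_subtype_val.comp (Real.continuous_fourierChar.comp h0)) ?_
      exact hcont.comp (f := fun w : (R2 × ℝ) × R2 => (w.2, w.1.2)) (by fun_prop)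
    exact h2.stronglyMeasurable.integral_prod_right'
  have h3 : (fun w : R2 × ℝ => 𝓕⁻ (S w.2) w.1) = fun w : R2 × ℝ => ∫ η, 𝐞 (inner ℝ η w.1) • S w.2 η := by
    ext w
    rw [SchwartzMap.fourierInv_coe, Real.fourierInv_eq]
  have h4 : Measurable fun w : R2 × ℝ => 𝓕⁻ (S w.2) w.1 := by
    rw [h3]; exact h1.measurable
  have h5 : Measurable fun p : R3 => 𝓕⁻ (S |s⁻¹ * vert p|) (r⁻¹ • horiz p) :=
    h4.comp (f := fun p : R3 => (r⁻¹ • horiz p, |s⁻¹ * vert p|)) (Continuous.measurable (by fun_prop))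
  exact (((measurable_signPow ε).comp vert.continuous.measurable).mul h5).const_mul _

variable {C : ℝ≥0} (hC : ∀ z x, ‖𝓕⁻ (S z) x‖ₑ ≤ C * (decay x * decay z))

include hC in
lemma enorm_kern_le (ε : ℕ) {r s : ℝ} (hr : 0 < r) (hs : 0 < s) (p : R3) :
    ‖kern S ε r s p‖ₑ ≤ ENNReal.ofReal (r ^ 2 * s)⁻¹ *
      (C * (decay (r⁻¹ • horiz p) * decay (s⁻¹ • vert p))) := by
  unfold kern
  have h1 : ‖signPow ε (vert p)‖ₑ = 1 := by
    rw [← ofReal_norm, norm_signPow, ENNReal.ofReal_one]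
  rw [enorm_mul, enorm_mul, h1, one_mul, ← Complex.ofReal_inv, ← ofReal_norm,
    Complex.norm_of_nonneg (by positivity)]
  gcongr
  refine (hC _ _).trans (le_of_eq ?_)
  simp [decay]

-- The amplitude `(r² s)⁻¹` cancels the volume factor `r² s` of the dilation exactly.
include hC in
lemma lintegral_enorm_kern_le (ε : ℕ) {r s : ℝ} (hr : 0 < r) (hs : 0 < s) :
    ∫⁻ p, ‖kern S ε r s p‖ₑ ≤ C * ((∫⁻ x : R2, decay x) * ∫⁻ z : ℝ, decay z) := by
  calc _ ≤ ∫⁻ p, ENNReal.ofReal (r ^ 2 * s)⁻¹ *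
      (C * (decay (r⁻¹ • horiz p) * decay (s⁻¹ • vert p))) :=
        lintegral_mono fun p => enorm_kern_le hC ε hr hs p
    _ = ENNReal.ofReal (r ^ 2 * s)⁻¹ * (C * ((ENNReal.ofReal (r ^ 2) * ∫⁻ x : R2, decay x) *
          (ENNReal.ofReal s * ∫⁻ z : ℝ, decay z))) := by
        rw [lintegral_const_mul' _ _ ENNReal.ofReal_ne_top, lintegral_const_mul' _ _
          ENNReal.coe_ne_top, lintegral_horiz_mul_vert (A := fun x => decay (r⁻¹ • x))
          (B := fun z => decay (s⁻¹ • z)) (measurable_decay.comp (measurable_const_smul _))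
          (measurable_decay.comp (measurable_const_smul _)),
          lintegral_comp_inv_smul _ measurable_decay hr,
          lintegral_comp_inv_smul _ measurable_decay hs]
        simp
    _ = (ENNReal.ofReal (r ^ 2 * s)⁻¹ * (ENNReal.ofReal (r ^ 2) * ENNReal.ofReal s)) *
        (C * ((∫⁻ x : R2, decay x) * ∫⁻ z : ℝ, decay z)) := by ring
    _ = _ := by
        rw [← ENNReal.ofReal_mul (by positivity), ← ENNReal.ofReal_mul (by positivity),
          inv_mul_cancel₀ (by positivity), ENNReal.ofReal_one, one_mul]

lemma decay_le_one {E : Type*} [NormedAddCommGroup E] (x : E) : decay x ≤ 1 := by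
  rw [decay, ENNReal.ofReal_le_one]
  exact inv_le_one_of_one_le₀ (one_le_pow₀ (by linarith [norm_nonneg x]))

/-- One of the two factors of `decay`, of order four, absorbs the growth `1 + z²` of the inverse
weight. This needs a bound on `s`: `|z| = s ‖s⁻¹ z‖ ≤ 8 ‖s⁻¹ z‖`, whence `64 = 8²`. -/
lemma decay_sq_mul_weight_inv_le {s : ℝ} (hs : 0 < s) (hs' : s ≤ 2 * Real.pi) (z : ℝ) :
    decay (s⁻¹ • z) ^ 2 * (weight z)⁻¹ ≤ 64 * decay (s⁻¹ • z) := by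
  have hpi := Real.pi_lt_four
  rw [decay, weight, ← ENNReal.ofReal_inv_of_pos (by positivity), inv_inv,
    ← ENNReal.ofReal_pow (by positivity), ← ENNReal.ofReal_mul (by positivity),
    show (64 : ℝ≥0∞) = ENNReal.ofReal 64 by simp, ← ENNReal.ofReal_mul (by positivity)]
  refine ENNReal.ofReal_le_ofReal ?_
  set y := ‖s⁻¹ • z‖ with hy
  have hy0 : 0 ≤ y := norm_nonneg _
  have hz : |z| = s * y := by
    rw [hy, norm_smul, Real.norm_eq_abs, Real.norm_eq_abs, abs_of_pos (inv_pos.2 hs)]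
    field_simp
  have h1 : 1 + z ^ 2 ≤ 64 * (1 + y) ^ 4 := by
    rw [← sq_abs, hz]
    have h2 : s * y ≤ 8 * y := by gcongr; linarith
    have h3 : (s * y) ^ 2 ≤ (8 * y) ^ 2 := by gcongr
    have h4 : 1 + (8 * y) ^ 2 ≤ 64 * (1 + y) ^ 2 := by nlinarith
    have h5 : (1 + y) ^ 2 ≤ (1 + y) ^ 4 := pow_le_pow_right₀ (by linarith) (by norm_num)
    linarith
  rw [inv_pow, sq, mul_inv, mul_assoc]
  rw [mul_comm (64 : ℝ)]
  gcongr
  rw [inv_mul_le_iff₀ (by positivity)]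
  linarith

-- The squared amplitude `(r² s)⁻²` meets only one volume factor `r² s`, so one power of `(r² s)⁻¹`
-- survives. This is the scaling behind all passages from `L²` to `L^∞` with a resolvent.
include hC in
lemma lintegral_enorm_sq_kern_le (ε : ℕ) {r s : ℝ} (hr : 0 < r) (hs : 0 < s)
    (hs' : s ≤ 2 * Real.pi) :
    ∫⁻ p, ‖kern S ε r s p‖ₑ ^ 2 * (weight (vert p))⁻¹ ≤ ENNReal.ofReal (r ^ 2 * s)⁻¹ *
      (64 * C ^ 2 * ((∫⁻ x : R2, decay x) * ∫⁻ z : ℝ, decay z)) := by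
  set a := ENNReal.ofReal (r ^ 2 * s)⁻¹ with ha
  calc _ ≤ ∫⁻ p, a ^ 2 * (64 * C ^ 2 * (decay (r⁻¹ • horiz p) * decay (s⁻¹ • vert p))) := by
        refine lintegral_mono fun p => ?_
        calc _ ≤ (a * (C * (decay (r⁻¹ • horiz p) * decay (s⁻¹ • vert p)))) ^ 2 *
              (weight (vert p))⁻¹ := by
              gcongr
              exact enorm_kern_le hC ε hr hs p
          _ = a ^ 2 * (C ^ 2 * (decay (r⁻¹ • horiz p) ^ 2 * (decay (s⁻¹ • vert p) ^ 2 *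
              (weight (vert p))⁻¹))) := by ring
          _ ≤ a ^ 2 * (C ^ 2 * (decay (r⁻¹ • horiz p) * (64 * decay (s⁻¹ • vert p)))) := by
              refine mul_le_mul_right (mul_le_mul_right (mul_le_mul' ?_ ?_) _) _
              · exact pow_le_of_le_one zero_le (decay_le_one _) two_ne_zero
              · exact decay_sq_mul_weight_inv_le hs hs' _
          _ = _ := by ring
    _ = a ^ 2 * (64 * C ^ 2 * ((ENNReal.ofReal (r ^ 2) * ∫⁻ x : R2, decay x) *
          (ENNReal.ofReal s * ∫⁻ z : ℝ, decay z))) := by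
        rw [lintegral_const_mul' _ _ (by simp [ha]), lintegral_const_mul' _ _ (by
          finiteness), lintegral_horiz_mul_vert (A := fun x => decay (r⁻¹ • x))
          (B := fun z => decay (s⁻¹ • z)) (measurable_decay.comp (measurable_const_smul _))
          (measurable_decay.comp (measurable_const_smul _)),
          lintegral_comp_inv_smul _ measurable_decay hr,
          lintegral_comp_inv_smul _ measurable_decay hs]
        simp
    _ = (a * (ENNReal.ofReal (r ^ 2) * ENNReal.ofReal s)) * (a *
        (64 * C ^ 2 * ((∫⁻ x : R2, decay x) * ∫⁻ z : ℝ, decay z))) := by ring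
    _ = _ := by
        rw [ha, ← ENNReal.ofReal_mul (by positivity), ← ENNReal.ofReal_mul (by positivity),
          inv_mul_cancel₀ (by positivity), ENNReal.ofReal_one, one_mul]

include hcont hC in
lemma integrable_kern (ε : ℕ) {r s : ℝ} (hr : 0 < r) (hs : 0 < s) :
    Integrable (kern S ε r s) := by
  refine ⟨(measurable_kern hcont ε r s).aestronglyMeasurable, ?_⟩
  refine (lintegral_enorm_kern_le hC ε hr hs).trans_lt ?_
  exact ENNReal.mul_lt_top ENNReal.coe_lt_top
    (ENNReal.mul_lt_top lintegral_decay_lt_top_R2 lintegral_decay_lt_top_R)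

-- Fubini with the horizontal integral inside: it undoes `𝓕⁻` and returns `S` at `r • horiz ξ`,
-- which by `hS` is an exponential in `|z|`. The vertical integral is then
-- `integral_signPow_mul_exp`.
include hcont hC in
lemma fourier_kern {g : 𝓢(R2, ℂ)} {l : R2 → ℝ}
    (hS : ∀ z, 0 ≤ z → ∀ η, S z η = g η * Complex.exp (-(2 * Real.pi * Real.exp (l η) * z : ℝ)))
    (ε : ℕ) {r s : ℝ} (hr : 0 < r) (hs : 0 < s) (ξ : R3) :
    𝓕 (kern S ε r s) ξ = g (r • horiz ξ) * (s : ℂ)⁻¹ *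
      (((2 * Real.pi * Real.exp (l (r • horiz ξ)) * s⁻¹ : ℝ) + 2 * Real.pi * vert ξ * Complex.I : ℂ)⁻¹
      + (-1) ^ ε * ((2 * Real.pi * Real.exp (l (r • horiz ξ)) * s⁻¹ : ℝ) -
        2 * Real.pi * vert ξ * Complex.I : ℂ)⁻¹) := by
  have hint : Integrable (fun p : R3 => 𝐞 (-inner ℝ p ξ) • kern S ε r s p) :=
    (Real.fourierIntegral_convergent_iff ξ).2 (integrable_kern hcont hC ε hr hs)
  have hint2 : Integrable (fun w : R2 × ℝ => 𝐞 (-inner ℝ (join w.1 w.2) ξ) • kern S ε r s (join w.1 w.2))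
      (volume.prod volume) :=
    (measurePreserving_join.integrable_comp_emb measurableEmbedding_join).2 hint
  rw [Real.fourier_eq, integral_split, integral_prod_symm _ hint2]
  have h1 : ∀ z : ℝ, ∫ x : R2, 𝐞 (-inner ℝ (join x z) ξ) • kern S ε r s (join x z) =
      g (r • horiz ξ) * (s : ℂ)⁻¹ * (𝐞 (-(z * vert ξ)) • (signPow ε z * Complex.exp
        (-((2 * Real.pi * Real.exp (l (r • horiz ξ)) * s⁻¹) * |z| : ℝ)))) := by
    intro z
    have e : ∀ x : R2, 𝐞 (-inner ℝ (join x z) ξ) • kern S ε r s (join x z) =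
        (𝐞 (-(z * vert ξ)) : ℂ) * (((r ^ 2 * s : ℝ) : ℂ)⁻¹ * signPow ε z) *
          (𝐞 (-inner ℝ x (horiz ξ)) • 𝓕⁻ (S |s⁻¹ * z|) (r⁻¹ • x)) := by
      intro x
      rw [inner_eq_horiz_vert, horiz_join, vert_join, neg_add, AddChar.map_add_eq_mul]
      simp only [kern, horiz_join, vert_join, Circle.smul_def, Circle.coe_mul, smul_eq_mul]
      ring
    simp_rw [e]
    rw [integral_const_mul, integral_fourierChar_smul_comp_inv_smul _ hr]
    have e2 : 𝓕 (⇑(𝓕⁻ (S |s⁻¹ * z|))) (r • horiz ξ) = S |s⁻¹ * z| (r • horiz ξ) := by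
      rw [← SchwartzMap.fourier_coe, fourier_fourierInv_eq]
    rw [e2, hS _ (abs_nonneg _), Circle.smul_def, smul_eq_mul, abs_mul, abs_of_pos (inv_pos.2 hs)]
    have hr' : (r : ℂ) ≠ 0 := by exact_mod_cast hr.ne'
    push_cast
    rw [mul_inv, ← mul_assoc (2 * (Real.pi : ℂ) * _)]
    field_simp
  simp_rw [h1]
  rw [integral_const_mul, integral_signPow_mul_exp ε (by positivity)]

end Kern

/-- Every resolvent symbol is the Fourier transform of an integrable kernel, with bounds that are
uniform in the scales. -/
lemma exists_kernel (g : 𝓢(R2, ℂ)) {l : R2 → ℝ} (hl : ContDiff ℝ ∞ l)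
    (hl' : HasCompactSupport l) {ε : ℕ} (hε : ε ≤ 1) : ∃ A : ℝ≥0, A ≠ 0 ∧ ∀ r s : ℝ, 0 < r → 0 < s →
      ∃ K : R3 → ℂ, Integrable K ∧ 𝓕 K = resolvent g l ε r s ∧ ∫⁻ p, ‖K p‖ₑ ≤ A ∧
        (s ≤ 2 * Real.pi → ∫⁻ p, ‖K p‖ₑ ^ 2 * (weight (vert p))⁻¹ ≤
          ENNReal.ofReal (r ^ 2 * s)⁻¹ * A) := by
  -- `m` normalises the amplitude: it cancels the factors produced by the vertical integral, `ρ / π`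
  -- for `ε = 0` and a multiple of `-i / π` for `ε = 1`.
  obtain ⟨m, hm, hm0, hm1⟩ : ∃ m : R2 → ℂ, m.HasTemperateGrowth ∧
      (ε = 0 → ∀ η, m η = Real.pi * (Real.exp (l η) : ℂ)⁻¹) ∧
      (ε = 1 → ∀ η, m η = Real.pi * Complex.I) := by
    by_cases h0 : ε = 0
    · refine ⟨fun η => ((Real.pi * Real.exp (-l η) : ℝ) : ℂ),
        Function.Complex.hasTemperateGrowth_ofReal.comp ((Function.HasTemperateGrowth.const _).mul
        (hasTemperateGrowth_exp (l := fun x => -l x) hl.neg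
        (hl'.comp_left (g := fun t : ℝ => -t) neg_zero))), fun _ η => ?_, fun h => by omega⟩
      simp [Complex.exp_neg]
    · exact ⟨fun _ => Real.pi * Complex.I, Function.HasTemperateGrowth.const _, fun h => absurd h h0,
        fun _ _ => rfl⟩
  obtain ⟨S, hS, hcont, hbd⟩ := exists_exp_slice (SchwartzMap.smulLeftCLM ℂ m g) hl hl'
  obtain ⟨C, hC⟩ := exists_fourierInv_bound S hbd
  set D := (∫⁻ x : R2, decay x) * ∫⁻ z : ℝ, decay z with hD
  have hDtop : D ≠ ⊤ := (ENNReal.mul_lt_top lintegral_decay_lt_top_R2 lintegral_decay_lt_top_R).ne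
  lift D to ℝ≥0 using hDtop with D'
  refine ⟨1 + C * D' + 64 * C ^ 2 * D', by positivity, fun r s hr hs => ⟨kern S ε r s,
    integrable_kern hcont hC ε hr hs, ?_, ?_, fun hs' => ?_⟩⟩
  · ext ξ
    rw [fourier_kern hcont hC hS ε hr hs, SchwartzMap.smulLeftCLM_apply_apply hm, resolvent]
    have hpi : (Real.pi : ℂ) ≠ 0 := by exact_mod_cast Real.pi_ne_zero
    have hs0 : (s : ℂ) ≠ 0 := by exact_mod_cast hs.ne'
    set E := Real.exp (l (r • horiz ξ)) with hE
    have hEpos : 0 < E := Real.exp_pos _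
    have hE0 : (E : ℂ) ≠ 0 := by exact_mod_cast hEpos.ne'
    set τ := vert ξ
    have hd : ((E ^ 2 + (s * τ) ^ 2 : ℝ) : ℂ) ≠ 0 := by
      have : 0 < E ^ 2 + (s * τ) ^ 2 := by positivity
      exact_mod_cast this.ne'
    -- The denominators in `fourier_kern` are the two complex factors `P`, `Q` of `E² + (sτ)²`. The
    -- case `ε = 0` uses `P + Q = 2E`, the case `ε = 1` uses that `Q - P` is proportional to `sτ`.
    have hfac : ((E ^ 2 + (s * τ) ^ 2 : ℝ) : ℂ) = (E + s * τ * Complex.I) * (E - s * τ * Complex.I) := by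
      push_cast
      linear_combination ((s * τ : ℂ) ^ 2) * Complex.I_sq
    rw [hfac] at hd ⊢
    have hd1 := left_ne_zero_of_mul hd
    have hd2 := right_ne_zero_of_mul hd
    have e1 : ((2 * Real.pi * E * s⁻¹ : ℝ) + 2 * Real.pi * τ * Complex.I : ℂ) =
        2 * Real.pi * (s : ℂ)⁻¹ * (E + s * τ * Complex.I) := by
      push_cast; field_simp
    have e2 : ((2 * Real.pi * E * s⁻¹ : ℝ) - 2 * Real.pi * τ * Complex.I : ℂ) =
        2 * Real.pi * (s : ℂ)⁻¹ * (E - s * τ * Complex.I) := by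
      push_cast; field_simp
    rw [e1, e2]
    set P : ℂ := E + s * τ * Complex.I with hP
    set Q : ℂ := E - s * τ * Complex.I with hQ
    have hPQ : P + Q = 2 * E := by rw [hP, hQ]; ring
    have hQP : Complex.I * (Q - P) = 2 * (s * τ) := by
      rw [hP, hQ]; linear_combination (-2 * s * τ : ℂ) * Complex.I_sq
    clear_value P Q
    have e3 : (2 * Real.pi * (s : ℂ)⁻¹ * P)⁻¹ + (-1) ^ ε * (2 * Real.pi * (s : ℂ)⁻¹ * Q)⁻¹ =
        s * (2 * Real.pi : ℂ)⁻¹ * (Q + (-1) ^ ε * P) * (P * Q)⁻¹ := by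
      field_simp
    rw [e3, smul_eq_mul]
    rcases Nat.le_one_iff_eq_zero_or_eq_one.1 hε with h0 | h1
    · rw [hm0 h0, h0, ← hE]
      have e4 : Q + (-1) ^ 0 * P = 2 * E := by rw [← hPQ]; ring
      rw [e4]
      field_simp
    · rw [hm1 h1, h1]
      have e4 : ((s * τ : ℝ) : ℂ) ^ 1 = Complex.I * (Q + (-1) ^ 1 * P) * 2⁻¹ := by
        push_cast
        linear_combination (-2⁻¹ : ℂ) * hQP
      rw [e4]
      field_simp
  · refine (lintegral_enorm_kern_le hC ε hr hs).trans ?_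
    rw [← hD]
    norm_cast
    rw [add_right_comm]
    exact le_add_of_nonneg_left (by positivity)
  · refine (lintegral_enorm_sq_kern_le hC ε hr hs hs').trans ?_
    rw [← hD]
    gcongr
    norm_cast
    exact le_add_of_nonneg_left (by positivity)

/-! ### Bounds for multipliers -/

lemma weight_ne_zero (z : ℝ) : weight z ≠ 0 := by
  rw [weight, Ne, ENNReal.ofReal_eq_zero, not_le]
  positivity

lemma weight_ne_top (z : ℝ) : weight z ≠ ⊤ := ENNReal.ofReal_ne_top

/-- The weighted Cauchy-Schwarz inequality. -/
lemma lintegral_mul_le_weighted {X : Type*} [MeasurableSpace X] {μ : Measure X}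
    {f k w : X → ℝ≥0∞} (hf : AEMeasurable f μ) (hk : AEMeasurable k μ) (hw : AEMeasurable w μ)
    (h0 : ∀ x, w x ≠ 0) (h1 : ∀ x, w x ≠ ⊤) :
    ∫⁻ x, f x * k x ∂μ ≤ (∫⁻ x, f x ^ 2 * w x ∂μ) ^ (1 / 2 : ℝ) *
      (∫⁻ x, k x ^ 2 * (w x)⁻¹ ∂μ) ^ (1 / 2 : ℝ) := by
  have h := ENNReal.lintegral_mul_le_Lp_mul_Lq μ (p := 2) (q := 2)
    (Real.HolderConjugate.two_two) (f := fun x => f x * w x ^ (1 / 2 : ℝ))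
    (g := fun x => k x * (w x)⁻¹ ^ (1 / 2 : ℝ)) (hf.mul (hw.pow_const _))
    (hk.mul (hw.inv.pow_const _))
  have e : ∀ x, (((fun x => f x * w x ^ (1 / 2 : ℝ)) * fun x => k x * (w x)⁻¹ ^ (1 / 2 : ℝ)) x) =
      f x * k x := by
    intro x
    simp only [Pi.mul_apply]
    rw [mul_mul_mul_comm, ← ENNReal.mul_rpow_of_nonneg _ _ (by norm_num),
      ENNReal.mul_inv_cancel (h0 x) (h1 x), ENNReal.one_rpow, mul_one]
  simp_rw [e] at h
  refine h.trans (le_of_eq ?_)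
  congr 2 <;>
  · refine lintegral_congr fun x => ?_
    rw [ENNReal.mul_rpow_of_nonneg _ _ (by norm_num), ← ENNReal.rpow_mul]
    norm_num

lemma lintegral_sq_eq_eLpNorm_sq {X : Type*} [MeasurableSpace X] {μ : Measure X} (f : X → ℂ) :
    (∫⁻ x, ‖f x‖ₑ ^ 2 ∂μ) ^ (1 / 2 : ℝ) = eLpNorm f 2 μ := by
  rw [eLpNorm_eq_lintegral_rpow_enorm_toReal (by norm_num) (by norm_num)]
  norm_num

/-- The pairing of a periodic function with a decaying kernel. -/
lemma exists_lintegral_pairing_le : ∃ C : ℝ≥0, ∀ f : R3 → ℂ, AEStronglyMeasurable f volume →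
    (∀ᵐ p, f (p + period) = f p) → ∀ (k : R3 → ℂ) (y : R3), AEStronglyMeasurable k volume →
    ∫⁻ p, ‖f p‖ₑ * ‖k p‖ₑ ≤ C * eLpNorm f 2 (volume.restrict strip) *
      (∫⁻ p, ‖k p‖ₑ ^ 2 * (weight (vert (y - p)))⁻¹) ^ (1 / 2 : ℝ) := by
  obtain ⟨C, hC⟩ := exists_lintegral_sq_mul_weight_le
  refine ⟨NNReal.sqrt C, fun f hf hper k y hk => ?_⟩
  have hw : Measurable fun p : R3 => weight (vert (y - p)) :=
    measurable_weight.comp (vert.continuous.measurable.comp (measurable_const.sub measurable_id))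
  refine (lintegral_mul_le_weighted hf.enorm hk.enorm hw.aemeasurable (fun _ => weight_ne_zero _)
    fun _ => weight_ne_top _).trans ?_
  gcongr
  rw [← lintegral_sq_eq_eLpNorm_sq]
  refine (ENNReal.rpow_le_rpow (hC f hf hper y) (by norm_num)).trans (le_of_eq ?_)
  rw [ENNReal.mul_rpow_of_nonneg _ _ (by norm_num), NNReal.sqrt_eq_rpow,
    ENNReal.coe_rpow_of_nonneg _ (by norm_num)]

/-- Resolvents act on periodic distributions, from `L^∞` and `L²` to `L^∞`. -/
theorem exists_resolvent_bound (g : 𝓢(R2, ℂ)) {l : R2 → ℝ} (hl : ContDiff ℝ ∞ l)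
    (hl' : HasCompactSupport l) {ε : ℕ} (hε : ε ≤ 1) : ∃ A : ℝ≥0, A ≠ 0 ∧ ∀ r s : ℝ, 0 < r → 0 < s →
      ∀ W : 𝓢'(R3, ℂ), IsPeriodic W →
        distNorm ∞ Set.univ (mult (resolvent g l ε r s) W) ≤ A * distNorm ∞ strip W ∧
        (s ≤ 2 * Real.pi → distNorm ∞ Set.univ (mult (resolvent g l ε r s) W) ≤
          A * ENNReal.ofReal (r ^ 2 * s)⁻¹ ^ (1 / 2 : ℝ) * distNorm 2 strip W) := by
  obtain ⟨A, hA0, hA⟩ := exists_kernel g hl hl' hε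
  obtain ⟨C, hC⟩ := exists_lintegral_pairing_le
  refine ⟨A + C * NNReal.sqrt A + 1, by positivity, fun r s hr hs W hW => ?_⟩
  obtain ⟨K, hK, hKres, hK1, hK2⟩ := hA r s hr hs
  have hm : (𝓕 K : R3 → ℂ).HasTemperateGrowth := by
    rw [hKres]; exact resolvent_hasTemperateGrowth g hl hl' ε r s
  rw [← hKres]
  constructor
  · refine (distNorm_top_mult_le_mul hK hm hA0 hK1 W _).trans ?_
    gcongr
    · rw [add_assoc]
      exact le_add_of_nonneg_right (by positivity)
    · exact hW.distNorm_top_univ_le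
  · intro hs'
    -- A nonzero finite constant can be divided out, after which a representing function of `W` may
    -- be fixed.
    have ha0 : ENNReal.ofReal (r ^ 2 * s)⁻¹ ^ (1 / 2 : ℝ) ≠ 0 := by
      rw [Ne, ENNReal.rpow_eq_zero_iff_of_pos (by norm_num), ENNReal.ofReal_eq_zero, not_le]
      positivity
    have ha1 : ENNReal.ofReal (r ^ 2 * s)⁻¹ ^ (1 / 2 : ℝ) ≠ ⊤ :=
      ENNReal.rpow_ne_top_of_nonneg (by norm_num) ENNReal.ofReal_ne_top
    have hc0 : ((A + C * NNReal.sqrt A + 1 : ℝ≥0) : ℝ≥0∞) *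
        ENNReal.ofReal (r ^ 2 * s)⁻¹ ^ (1 / 2 : ℝ) ≠ 0 :=
      mul_ne_zero (by simp) ha0
    have hc1 : ((A + C * NNReal.sqrt A + 1 : ℝ≥0) : ℝ≥0∞) *
        ENNReal.ofReal (r ^ 2 * s)⁻¹ ^ (1 / 2 : ℝ) ≠ ⊤ := ENNReal.mul_ne_top ENNReal.coe_ne_top ha1
    rw [← ENNReal.div_le_iff' hc0 hc1]
    refine le_distNorm fun f hf => ?_
    rw [ENNReal.div_le_iff' hc0 hc1]
    refine distNorm_top_mult_le hK hm hf (fun y => ?_) _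
    have hKy : AEStronglyMeasurable (fun p => K (y - p)) volume :=
      hK.1.comp_quasiMeasurePreserving (quasiMeasurePreserving_sub_left_of_right_invariant volume y)
    refine (hC f hf.1 (hW.ae_add_period hf) (fun p => K (y - p)) y hKy).trans ?_
    rw [lintegral_sub_left_eq_self (fun p => ‖K p‖ₑ ^ 2 * (weight (vert p))⁻¹) y]
    calc _ ≤ C * eLpNorm f 2 (volume.restrict strip) *
          (ENNReal.ofReal (r ^ 2 * s)⁻¹ * A) ^ (1 / 2 : ℝ) := by
          gcongr
          exact hK2 hs'
      _ = (C * NNReal.sqrt A : ℝ≥0) * ENNReal.ofReal (r ^ 2 * s)⁻¹ ^ (1 / 2 : ℝ) *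
          eLpNorm f 2 (volume.restrict strip) := by
          rw [ENNReal.mul_rpow_of_nonneg _ _ (by norm_num), NNReal.sqrt_eq_rpow, ENNReal.coe_mul,
            ENNReal.coe_rpow_of_nonneg _ (by norm_num)]
          ring
      _ ≤ _ := by
          gcongr
          rw [add_right_comm]
          exact le_add_of_nonneg_left (by positivity)

/-- The restriction of a Fourier transform to a horizontal plane is a Fourier transform. -/
lemma exists_fourier_join {K : R3 → ℂ} (hK : Integrable K) (t : ℝ) :
    ∃ k : R2 → ℂ, Integrable k ∧ (∀ ξ, 𝓕 k ξ = 𝓕 K (join ξ t)) ∧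
      ∫⁻ x, ‖k x‖ₑ ≤ ∫⁻ p, ‖K p‖ₑ := by
  have hK2 : Integrable (fun w : R2 × ℝ => K (join w.1 w.2)) (volume.prod volume) :=
    (measurePreserving_join.integrable_comp_emb measurableEmbedding_join).2 hK
  have hK3 : Integrable (fun w : R2 × ℝ => 𝐞 (-(w.2 * t)) • K (join w.1 w.2))
      (volume.prod volume) := by
    refine (hK2.bdd_mul (c := 1) (f := fun w : R2 × ℝ => ((𝐞 (-(w.2 * t)) : Circle) : ℂ)) ?_ ?_)
    · have h0 : Continuous fun w : R2 × ℝ => -(w.2 * t) := by fun_prop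
      exact (continuous_subtype_val.comp
        (Real.continuous_fourierChar.comp h0)).aestronglyMeasurable
    · exact Filter.Eventually.of_forall fun z => (Circle.norm_coe _).le
  refine ⟨fun x => ∫ z, 𝐞 (-(z * t)) • K (join x z), hK3.integral_prod_left, fun ξ => ?_, ?_⟩
  · rw [Real.fourier_eq, Real.fourier_eq, integral_split, integral_prod]
    · refine integral_congr_ae (Filter.Eventually.of_forall fun x => ?_)
      simp only [Circle.smul_def, smul_eq_mul]
      rw [← integral_const_mul]
      refine integral_congr_ae (Filter.Eventually.of_forall fun z => ?_)
      simp only [inner_eq_horiz_vert, horiz_join, vert_join, neg_add, AddChar.map_add_eq_mul,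
        Circle.coe_mul]
      ring
    · exact (measurePreserving_join.integrable_comp_emb measurableEmbedding_join).2
        ((Real.fourierIntegral_convergent_iff (join ξ t)).2 hK)
  · rw [lintegral_split, lintegral_prod _ hK2.1.enorm]
    refine lintegral_mono fun x => (enorm_integral_le_lintegral_enorm _).trans (le_of_eq ?_)
    refine lintegral_congr fun z => ?_
    rw [Circle.smul_def, enorm_smul, ← ofReal_norm (E := ℂ), Circle.norm_coe, ENNReal.ofReal_one,
      one_mul]

/-- The resolvent symbol on the plane, with a vertical frequency `t` as parameter. -/
def resolvent2 (g : 𝓢(R2, ℂ)) (l : R2 → ℝ) (ε : ℕ) (r t : ℝ) (ξ : R2) : ℂ :=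
  g (r • ξ) * (t : ℂ) ^ ε * (((Real.exp (l (r • ξ))) ^ 2 + t ^ 2 : ℝ) : ℂ)⁻¹

lemma resolvent_join (g : 𝓢(R2, ℂ)) (l : R2 → ℝ) (ε : ℕ) (r t : ℝ) (ξ : R2) :
    resolvent g l ε r 1 (join ξ t) = resolvent2 g l ε r t ξ := by
  simp [resolvent, resolvent2, -vert_apply]

lemma resolvent2_hasTemperateGrowth (g : 𝓢(R2, ℂ)) {l : R2 → ℝ} (hl : ContDiff ℝ ∞ l)
    (hl' : HasCompactSupport l) (ε : ℕ) (r t : ℝ) :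
    (resolvent2 g l ε r t).HasTemperateGrowth := by
  have h1 : (fun ξ : R2 => joinL ξ + t • EuclideanSpace.single (2 : Fin 3) (1 : ℝ)).HasTemperateGrowth :=
    joinL.hasTemperateGrowth.add (Function.HasTemperateGrowth.const _)
  refine (congrArg Function.HasTemperateGrowth (funext fun ξ => ?_)).mp
    ((resolvent_hasTemperateGrowth g hl hl' ε r 1).comp h1)
  rw [Function.comp_apply, ← join_eq, resolvent_join]

/-- For a fixed vertical frequency `t` the symbol is the restriction of the space symbol with `s =
1` to the plane at height `t`. Its kernel is the vertical integral of the space kernel against a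
character, so its `L¹` norm is no larger and the bound is uniform in `t`. -/
theorem exists_resolvent2_bound (g : 𝓢(R2, ℂ)) {l : R2 → ℝ} (hl : ContDiff ℝ ∞ l)
    (hl' : HasCompactSupport l) {ε : ℕ} (hε : ε ≤ 1) : ∃ A : ℝ≥0, A ≠ 0 ∧ ∀ r t : ℝ, 0 < r →
      ∀ W : 𝓢'(R2, ℂ),
        distNorm ∞ Set.univ (mult (resolvent2 g l ε r t) W) ≤ A * distNorm ∞ Set.univ W := by
  obtain ⟨A, hA0, hA⟩ := exists_kernel g hl hl' hε
  refine ⟨A, hA0, fun r t hr W => ?_⟩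
  obtain ⟨K, hK, hKres, hK1, -⟩ := hA r 1 hr one_pos
  obtain ⟨k, hk, hkf, hk1⟩ := exists_fourier_join hK t
  have e : (𝓕 k : R2 → ℂ) = resolvent2 g l ε r t := by
    ext ξ
    rw [hkf, hKres, resolvent_join]
  rw [← e]
  refine distNorm_top_mult_le_mul hk ?_ hA0 (hk1.trans hK1) W _
  rw [e]
  exact resolvent2_hasTemperateGrowth g hl hl' ε r t

/-! ### Dilated Schwartz symbols on the plane -/

/-- The kernel of the multiplier with symbol `g (r • ξ)`. -/
def dilKernel (g : 𝓢(R2, ℂ)) (r : ℝ) (x : R2) : ℂ := ((r ^ 2 : ℝ) : ℂ)⁻¹ * 𝓕⁻ g (r⁻¹ • x)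

lemma continuous_dilKernel (g : 𝓢(R2, ℂ)) (r : ℝ) : Continuous (dilKernel g r) :=
  continuous_const.mul ((𝓕⁻ g).continuous.comp (continuous_const_smul _))

lemma lintegral_enorm_dilKernel (g : 𝓢(R2, ℂ)) {r : ℝ} (hr : 0 < r) :
    ∫⁻ x, ‖dilKernel g r x‖ₑ = ∫⁻ x, ‖𝓕⁻ g x‖ₑ := by
  simp only [dilKernel, enorm_mul]
  rw [lintegral_const_mul' _ _ enorm_ne_top, lintegral_comp_inv_smul _ (f := fun x => ‖𝓕⁻ g x‖ₑ)
    (𝓕⁻ g).continuous.enorm.measurable hr, ← mul_assoc, ← Complex.ofReal_inv, ← ofReal_norm,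
    Complex.norm_of_nonneg (by positivity), ← ENNReal.ofReal_mul (by positivity)]
  simp [hr.ne']

lemma lintegral_enorm_sq_dilKernel (g : 𝓢(R2, ℂ)) {r : ℝ} (hr : 0 < r) :
    ∫⁻ x, ‖dilKernel g r x‖ₑ ^ 2 = ENNReal.ofReal (r ^ 2)⁻¹ * ∫⁻ x, ‖𝓕⁻ g x‖ₑ ^ 2 := by
  simp only [dilKernel, enorm_mul, mul_pow]
  rw [lintegral_const_mul' _ _ (by finiteness),
    lintegral_comp_inv_smul _ (f := fun x => ‖𝓕⁻ g x‖ₑ ^ 2)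
    ((𝓕⁻ g).continuous.enorm.measurable.pow_const 2) hr, ← mul_assoc, ← Complex.ofReal_inv,
    ← ofReal_norm, Complex.norm_of_nonneg (by positivity), ← ENNReal.ofReal_pow (by positivity),
    ← ENNReal.ofReal_mul (by positivity)]
  congr 2
  field_simp
  simp

lemma integrable_dilKernel (g : 𝓢(R2, ℂ)) {r : ℝ} (hr : 0 < r) : Integrable (dilKernel g r) := by
  refine ⟨(continuous_dilKernel g r).aestronglyMeasurable, ?_⟩
  rw [HasFiniteIntegral, lintegral_enorm_dilKernel g hr]
  exact (𝓕⁻ g).integrable.2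

lemma fourier_dilKernel (g : 𝓢(R2, ℂ)) {r : ℝ} (hr : 0 < r) :
    (𝓕 (dilKernel g r) : R2 → ℂ) = fun ξ => g (r • ξ) := by
  ext ξ
  have e : ∀ x, 𝐞 (-inner ℝ x ξ) • dilKernel g r x =
      ((r ^ 2 : ℝ) : ℂ)⁻¹ * (𝐞 (-inner ℝ x ξ) • 𝓕⁻ g (r⁻¹ • x)) := by
    intro x
    simp only [dilKernel, Circle.smul_def, smul_eq_mul]
    ring
  rw [Real.fourier_eq]
  simp_rw [e]
  rw [integral_const_mul, integral_fourierChar_smul_comp_inv_smul _ hr, ← SchwartzMap.fourier_coe,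
    fourier_fourierInv_eq]
  have hr' : (r : ℂ) ≠ 0 := by exact_mod_cast hr.ne'
  push_cast
  field_simp

lemma dilation_hasTemperateGrowth (g : 𝓢(R2, ℂ)) (r : ℝ) :
    (fun ξ => g (r • ξ)).HasTemperateGrowth :=
  g.hasTemperateGrowth.comp (r • ContinuousLinearMap.id ℝ R2).hasTemperateGrowth

/-- The kernel `r⁻² (𝓕⁻ g)(x / r)` has an `L¹` norm independent of `r`. -/
theorem exists_dilation_bound (g : 𝓢(R2, ℂ)) : ∃ A : ℝ≥0, A ≠ 0 ∧ ∀ r : ℝ, 0 < r →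
    ∀ W : 𝓢'(R2, ℂ),
      distNorm ∞ Set.univ (mult (fun ξ => g (r • ξ)) W) ≤ A * distNorm ∞ Set.univ W := by
  have hfin : ∫⁻ x, ‖𝓕⁻ g x‖ₑ ≠ ⊤ := (𝓕⁻ g).integrable.2.ne
  refine ⟨(∫⁻ x, ‖𝓕⁻ g x‖ₑ).toNNReal + 1, by positivity, fun r hr W => ?_⟩
  rw [← fourier_dilKernel g hr]
  refine distNorm_top_mult_le_mul (integrable_dilKernel g hr) ?_ (by positivity) ?_ W _
  · rw [fourier_dilKernel g hr]
    exact dilation_hasTemperateGrowth g r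
  · rw [lintegral_enorm_dilKernel g hr]
    push_cast
    rw [ENNReal.coe_toNNReal hfin]
    exact le_self_add

lemma exists_schwartz_decay (η : 𝓢(ℝ, ℂ)) : ∃ C : ℝ≥0, ∀ z, ‖η z‖ₑ ≤ C * decay z := by
  refine ⟨(2 ^ 4 * ((Finset.Iic (4, 0)).sup (schwartzSeminormFamily ℂ ℝ ℂ)) η).toNNReal,
    fun z => ?_⟩
  have h1 := SchwartzMap.one_add_le_sup_seminorm_apply (𝕜 := ℂ) (m := (4, 0)) (le_refl 4)
    (le_refl 0) η z
  rw [norm_iteratedFDeriv_zero] at h1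
  change _ ≤ ENNReal.ofReal _ * _
  rw [decay, ← ENNReal.ofReal_mul' (by positivity), ← ofReal_norm]
  refine ENNReal.ofReal_le_ofReal ?_
  rw [← div_eq_mul_inv, le_div_iff₀ (by positivity), mul_comm]
  exact h1

/-- Bernstein's inequality for the mean value over a period. -/
theorem exists_dilation_fourierCoeff_bound (g : 𝓢(R2, ℂ)) (n : ℤ) : ∃ A : ℝ≥0, A ≠ 0 ∧
    ∀ r : ℝ, 0 < r → ∀ v : 𝓢'(R3, ℂ), IsPeriodic v →
      distNorm ∞ Set.univ (mult (fun ξ => g (r • ξ)) (fourierCoeff n v)) ≤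
        A * ENNReal.ofReal r⁻¹ * distNorm 2 strip v := by
  obtain ⟨C, hC⟩ := exists_lintegral_pairing_le
  obtain ⟨D, hD⟩ := exists_schwartz_decay (mode n)
  have hfin : ∫⁻ x, ‖𝓕⁻ g x‖ₑ ^ 2 ≠ ⊤ := by
    have h := ((𝓕⁻ g).memLp 2 volume).2
    rw [← lintegral_sq_eq_eLpNorm_sq] at h
    exact ((ENNReal.rpow_lt_top_iff_of_pos (by norm_num)).1 h).ne
  have hfin2 : ∫⁻ z, ‖mode n z‖ₑ ^ 2 * (weight z)⁻¹ ≠ ⊤ := by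
    refine ne_top_of_le_ne_top (b := D ^ 2 * (64 * ∫⁻ z : ℝ, decay z)) ?_ ?_
    · exact ENNReal.mul_ne_top (by finiteness)
        (ENNReal.mul_ne_top (by finiteness) lintegral_decay_lt_top_R.ne)
    · rw [← lintegral_const_mul' _ _ (by finiteness), ← lintegral_const_mul' _ _ (by finiteness)]
      refine lintegral_mono fun z => ?_
      have h1 := decay_sq_mul_weight_inv_le one_pos (by linarith [Real.pi_gt_three]) z
      rw [inv_one, one_smul] at h1
      calc _ ≤ (D * decay z) ^ 2 * (weight z)⁻¹ := by
            gcongr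
            exact hD z
        _ = D ^ 2 * (decay z ^ 2 * (weight z)⁻¹) := by ring
        _ ≤ _ := by gcongr
  set I₁ := ∫⁻ x, ‖𝓕⁻ g x‖ₑ ^ 2
  set I₂ := ∫⁻ z, ‖mode n z‖ₑ ^ 2 * (weight z)⁻¹
  set c : ℂ := (2 * Real.pi : ℂ)⁻¹
  have hAfin : C * (‖c‖ₑ ^ 2 * (I₁ * I₂)) ^ (1 / 2 : ℝ) ≠ ⊤ :=
    ENNReal.mul_ne_top ENNReal.coe_ne_top (ENNReal.rpow_ne_top_of_nonneg (by norm_num)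
      (ENNReal.mul_ne_top (by finiteness) (ENNReal.mul_ne_top hfin hfin2)))
  refine ⟨(C * (‖c‖ₑ ^ 2 * (I₁ * I₂)) ^ (1 / 2 : ℝ)).toNNReal + 1, by positivity,
    fun r hr v hv => ?_⟩
  have hc0 : (((C * (‖c‖ₑ ^ 2 * (I₁ * I₂)) ^ (1 / 2 : ℝ)).toNNReal + 1 : ℝ≥0) : ℝ≥0∞) *
      ENNReal.ofReal r⁻¹ ≠ 0 := by
    refine mul_ne_zero (by simp) ?_
    rw [Ne, ENNReal.ofReal_eq_zero, not_le]
    positivity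
  have hc1 : (((C * (‖c‖ₑ ^ 2 * (I₁ * I₂)) ^ (1 / 2 : ℝ)).toNNReal + 1 : ℝ≥0) : ℝ≥0∞) *
      ENNReal.ofReal r⁻¹ ≠ ⊤ := ENNReal.mul_ne_top ENNReal.coe_ne_top ENNReal.ofReal_ne_top
  rw [← ENNReal.div_le_iff' hc0 hc1]
  refine le_distNorm fun f hf => ?_
  rw [ENNReal.div_le_iff' hc0 hc1]
  have hcont : Continuous fun w : R3 × R2 =>
      c * (mode n (vert w.1) * dilKernel g r (w.2 - horiz w.1)) :=
    continuous_const.mul (((mode n).continuous.comp (by fun_prop)).mul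
      ((continuous_dilKernel g r).comp (by fun_prop)))
  -- Fourier coefficient and multiplier together act on `f` through one product kernel: `mode n` in
  -- `z` times a horizontal convolution kernel, whose `L²` norm is a constant times `r⁻¹`.
  refine distNorm_top_le_of_kernel (μ := volume) (f := f)
    (κ := fun p y => c * (mode n (vert p) * dilKernel g r (y - horiz p))) _ hf.1
    hcont.aestronglyMeasurable ?_ (fun y => ?_) _
  · intro ψ
    rw [TemperedDistribution.fourierMultiplierCLM_apply_apply, fourierCoeff_apply, (hf.2 _).2,
      ← integral_const_mul]
    refine integral_congr_ae (Filter.Eventually.of_forall fun p => ?_)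
    have hm : (𝓕 (dilKernel g r) : R2 → ℂ).HasTemperateGrowth := by
      rw [fourier_dilKernel g hr]; exact dilation_hasTemperateGrowth g r
    simp only [tensor_apply]
    rw [← fourier_dilKernel g hr, fourier_smulLeft_fourierInv_apply (integrable_dilKernel g hr) hm]
    simp only [mul_assoc]
    rw [integral_const_mul, integral_const_mul]
    ring
  · have hm1 : AEStronglyMeasurable (fun p : R3 => c * (mode n (vert p) * dilKernel g r (y - horiz p)))
        volume := (hcont.comp (Continuous.prodMk_left y)).aestronglyMeasurable
    -- The kernel is not a convolution in `z`, so the weight is centred at `0`, where `mode n` is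
    -- concentrated.
    refine (hC f hf.1 (hv.ae_add_period hf) _ 0 hm1).trans ?_
    have e1 : ∫⁻ p : R3, ‖c * (mode n (vert p) * dilKernel g r (y - horiz p))‖ₑ ^ 2 *
        (weight (vert (0 - p)))⁻¹ = ‖c‖ₑ ^ 2 * ((ENNReal.ofReal (r ^ 2)⁻¹ * I₁) * I₂) := by
      have e2 : ∀ p : R3, ‖c * (mode n (vert p) * dilKernel g r (y - horiz p))‖ₑ ^ 2 *
          (weight (vert (0 - p)))⁻¹ = ‖c‖ₑ ^ 2 * (‖dilKernel g r (y - horiz p)‖ₑ ^ 2 *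
            (‖mode n (vert p)‖ₑ ^ 2 * (weight (vert p))⁻¹)) := by
        intro p
        have : weight (vert (0 - p)) = weight (vert p) := by simp [weight]
        rw [this, enorm_mul, enorm_mul]
        ring
      simp_rw [e2]
      rw [lintegral_const_mul' _ _ (by finiteness), lintegral_horiz_mul_vert
        (A := fun x => ‖dilKernel g r (y - x)‖ₑ ^ 2)
        (B := fun z => ‖mode n z‖ₑ ^ 2 * (weight z)⁻¹)
        (((continuous_dilKernel g r).comp (by fun_prop)).enorm.measurable.pow_const 2)
        (((mode n).continuous.enorm.measurable.pow_const 2).mul measurable_weight.inv),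
        lintegral_sub_left_eq_self (fun x => ‖dilKernel g r x‖ₑ ^ 2) y,
        lintegral_enorm_sq_dilKernel g hr]
    have e3 : ENNReal.ofReal (r ^ 2)⁻¹ ^ (1 / 2 : ℝ) = ENNReal.ofReal r⁻¹ := by
      rw [← inv_pow, ENNReal.ofReal_pow (by positivity), ← ENNReal.rpow_natCast, ← ENNReal.rpow_mul]
      norm_num
    have e4 : ‖c‖ₑ ^ 2 * ((ENNReal.ofReal (r ^ 2)⁻¹ * I₁) * I₂) =
        ENNReal.ofReal (r ^ 2)⁻¹ * (‖c‖ₑ ^ 2 * (I₁ * I₂)) := by ring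
    rw [e1, e4, ENNReal.mul_rpow_of_nonneg _ _ (by norm_num), e3]
    push_cast
    rw [ENNReal.coe_toNNReal hAfin]
    calc _ = C * (‖c‖ₑ ^ 2 * (I₁ * I₂)) ^ (1 / 2 : ℝ) * ENNReal.ofReal r⁻¹ *
          eLpNorm f 2 (volume.restrict strip) := by ring
      _ ≤ _ := by
          gcongr
          exact le_self_add

/-! ### Calculus of Fourier multipliers -/

section Multipliers

variable {E : Type*} [NormedAddCommGroup E] [InnerProductSpace ℝ E] [FiniteDimensional ℝ E]
  [MeasurableSpace E] [BorelSpace E]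

lemma mult_mult {m₁ m₂ : E → ℂ} (h₁ : m₁.HasTemperateGrowth) (h₂ : m₂.HasTemperateGrowth)
    (u : 𝓢'(E, ℂ)) : mult m₁ (mult m₂ u) = mult (fun ξ => m₁ ξ * m₂ ξ) u := by
  rw [mult, mult, TemperedDistribution.fourierMultiplierCLM_fourierMultiplierCLM_apply h₂ h₁,
    mul_comm]
  rfl

lemma mult_comm {m₁ m₂ : E → ℂ} (h₁ : m₁.HasTemperateGrowth) (h₂ : m₂.HasTemperateGrowth)
    (u : 𝓢'(E, ℂ)) : mult m₁ (mult m₂ u) = mult m₂ (mult m₁ u) := by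
  rw [mult_mult h₁ h₂, mult_mult h₂ h₁]
  simp only [mul_comm]

lemma mult_const_mul {m : E → ℂ} (h : m.HasTemperateGrowth) (c : ℂ) (u : 𝓢'(E, ℂ)) :
    mult (fun ξ => c * m ξ) u = c • mult m u :=
  congrArg (fun T : 𝓢'(E, ℂ) →L[ℂ] 𝓢'(E, ℂ) => T u)
    (TemperedDistribution.fourierMultiplierCLM_smul (F := ℂ) h c)

lemma mult_sum {ι : Type*} {s : Finset ι} {m : ι → E → ℂ}
    (h : ∀ i ∈ s, (m i).HasTemperateGrowth) (u : 𝓢'(E, ℂ)) :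
    mult (fun ξ => ∑ i ∈ s, m i ξ) u = ∑ i ∈ s, mult (m i) u := by
  have := congrArg (fun T : 𝓢'(E, ℂ) →L[ℂ] 𝓢'(E, ℂ) => T u)
    (TemperedDistribution.fourierMultiplierCLM_sum (F := ℂ) h)
  simpa [sum_apply] using this

lemma mult_one (u : 𝓢'(E, ℂ)) : mult (fun _ => 1) u = u := by
  simp [mult]

/-- Elliptic inversion: if `-∑ σ_k(D)² w = ∑ σ_k(D) G_k` and `Q` inverts the symbol on the support
of `Φ`, then `Φ(D) s(D) w` is given by multipliers of order `0` applied to `Φ(D) G_k`. -/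
lemma mult_elliptic {σ : Fin 3 → E → ℂ} {Φ Q s : E → ℂ} (hσ : ∀ k, (σ k).HasTemperateGrowth)
    (hΦ : Φ.HasTemperateGrowth) (hQ : Q.HasTemperateGrowth) (hs : s.HasTemperateGrowth)
    (h : ∀ ξ, Φ ξ * s ξ = Q ξ * Φ ξ * -∑ k, σ k ξ * σ k ξ) {w : 𝓢'(E, ℂ)} {G : Fin 3 → 𝓢'(E, ℂ)}
    (hw : -∑ k, mult (σ k) (mult (σ k) w) = ∑ k, mult (σ k) (G k)) :
    mult Φ (mult s w) = ∑ k, mult (fun ξ => Q ξ * σ k ξ) (mult Φ (G k)) := by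
  have hσ2 : ∀ k, (fun ξ => σ k ξ * σ k ξ).HasTemperateGrowth := fun k => (hσ k).mul (hσ k)
  have hQσ : ∀ k, (fun ξ => Q ξ * σ k ξ).HasTemperateGrowth := fun k => hQ.mul (hσ k)
  have hQΦ : (fun ξ => Q ξ * Φ ξ).HasTemperateGrowth := hQ.mul hΦ
  have hΔ : (fun ξ => ∑ k, σ k ξ * σ k ξ).HasTemperateGrowth := .sum fun k _ => hσ2 k
  have hΔ' : (fun ξ => (-1) * ∑ k, σ k ξ * σ k ξ).HasTemperateGrowth :=
    (Function.HasTemperateGrowth.const _).mul hΔ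
  have e1 : ∀ k, mult (fun ξ => Q ξ * σ k ξ) (mult Φ (G k)) =
      mult (fun ξ => Q ξ * Φ ξ) (mult (σ k) (G k)) := fun k => by
    rw [mult_mult (hQσ k) hΦ, mult_mult hQΦ (hσ k)]
    congr 2; ext ξ; ring
  have e2 : ∀ k, mult (σ k) (mult (σ k) w) = mult (fun ξ => σ k ξ * σ k ξ) w :=
    fun k => mult_mult (hσ k) (hσ k) w
  have e3 : -∑ k, mult (σ k) (mult (σ k) w) = mult (fun ξ => (-1) * ∑ k, σ k ξ * σ k ξ) w := by
    rw [mult_const_mul hΔ, mult_sum fun k _ => hσ2 k]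
    simp_rw [e2]
    ext ψ
    exact (neg_one_mul _).symm
  simp_rw [e1]
  rw [← map_sum, ← hw, e3, mult_mult hΦ hs, mult_mult hQΦ hΔ']
  congr 2; ext ξ; rw [h]; ring

end Multipliers

/-! ### The vector calculus identities -/

/-- The symbol of `∂ₖ`. -/
def derivSymbol (k : Fin 3) (ξ : R3) : ℂ := 2 * Real.pi * Complex.I * ((ξ k : ℝ) : ℂ)

lemma derivSymbol_hasTemperateGrowth (k : Fin 3) : (derivSymbol k).HasTemperateGrowth :=
  (Function.HasTemperateGrowth.const _).mul (coord_hasTemperateGrowth k)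

lemma pd_eq_mult (k : Fin 3) (u : 𝓢'(R3, ℂ)) : pd k u = mult (derivSymbol k) u := by
  rw [pd, TemperedDistribution.lineDeriv_eq_fourierMultiplierCLM]
  have e : (fun ξ : R3 => ((inner ℝ ξ (EuclideanSpace.single k (1 : ℝ)) : ℝ) : ℂ)) =
      fun ξ => ((ξ k : ℝ) : ℂ) := by
    ext ξ; simp [EuclideanSpace.inner_single_right]
  have e' := mult_const_mul (coord_hasTemperateGrowth k) (2 * Real.pi * Complex.I) u
  unfold derivSymbol
  rw [e', ← e]

lemma pd_add (k : Fin 3) (u v : 𝓢'(R3, ℂ)) : pd k (u + v) = pd k u + pd k v := by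
  simp only [pd_eq_mult, map_add]

lemma pd_sub (k : Fin 3) (u v : 𝓢'(R3, ℂ)) : pd k (u - v) = pd k u - pd k v := by
  simp only [pd_eq_mult, map_sub]

lemma pd_comm (i k : Fin 3) (u : 𝓢'(R3, ℂ)) : pd i (pd k u) = pd k (pd i u) := by
  simp only [pd_eq_mult]
  exact mult_comm (derivSymbol_hasTemperateGrowth i) (derivSymbol_hasTemperateGrowth k) u

lemma pd_coordMul (k a : Fin 3) (u : 𝓢'(R3, ℂ)) :
    pd k (coordMul a u) = (if k = a then u else 0) + coordMul a (pd k u) := by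
  ext ψ
  have h : SchwartzMap.smulLeftCLM ℂ (fun p : R3 => ((p a : ℝ) : ℂ))
        (-∂_{(EuclideanSpace.single k (1 : ℝ) : R3)} ψ) = (if k = a then ψ else 0) +
      -∂_{(EuclideanSpace.single k (1 : ℝ) : R3)}
        (SchwartzMap.smulLeftCLM ℂ (fun p : R3 => ((p a : ℝ) : ℂ)) ψ) := by
    ext p
    have hd : HasFDerivAt (fun p : R3 => ((p a : ℝ) : ℂ))
        (Complex.ofRealCLM ∘L (EuclideanSpace.proj a : R3 →L[ℝ] ℝ)) p :=
      (Complex.ofRealCLM ∘L (EuclideanSpace.proj a : R3 →L[ℝ] ℝ)).hasFDerivAt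
    have e : ((SchwartzMap.smulLeftCLM ℂ (fun p : R3 => ((p a : ℝ) : ℂ)) ψ : 𝓢(R3, ℂ)) : R3 → ℂ) =
        fun p => ((p a : ℝ) : ℂ) * ψ p := by
      ext p
      rw [SchwartzMap.smulLeftCLM_apply_apply (coord_hasTemperateGrowth a), smul_eq_mul]
    rw [SchwartzMap.smulLeftCLM_apply_apply (coord_hasTemperateGrowth a), neg_apply,
      add_apply, neg_apply, SchwartzMap.lineDerivOp_apply_eq_fderiv,
      SchwartzMap.lineDerivOp_apply_eq_fderiv, e,
      fderiv_fun_mul hd.differentiableAt (ψ.hasFDerivAt p).differentiableAt, hd.fderiv]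
    by_cases hka : k = a
    · subst hka; simp
    · simp [hka, Ne.symm hka]
  have h1 : pd k (coordMul a u) ψ = u (SchwartzMap.smulLeftCLM ℂ (fun p : R3 => ((p a : ℝ) : ℂ))
        (-∂_{(EuclideanSpace.single k (1 : ℝ) : R3)} ψ)) := rfl
  have h2 : ((if k = a then u else 0) + coordMul a (pd k u)) ψ = (if k = a then u else 0) ψ +
      u (-∂_{(EuclideanSpace.single k (1 : ℝ) : R3)}
        (SchwartzMap.smulLeftCLM ℂ (fun p : R3 => ((p a : ℝ) : ℂ)) ψ)) := rfl
  rw [h1, h2, h, map_add]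
  split_ifs <;> simp

/-- The antisymmetric matrix of a vector; `(curl Ω)ᵢ = ∑ₖ ∂ₖ (skew Ω i k)`. -/
def skew {M : Type*} [AddCommGroup M] (Ω : Fin 3 → M) : Fin 3 → Fin 3 → M :=
  ![![0, Ω 2, -Ω 1], ![-Ω 2, 0, Ω 0], ![Ω 1, -Ω 0, 0]]

lemma skew_curl (v : Fin 3 → 𝓢'(R3, ℂ)) (i k : Fin 3) :
    skew (curl v) i k = pd i (v k) - pd k (v i) := by
  fin_cases i <;> fin_cases k <;> simp [skew, curl]

lemma skew_map {M N : Type*} [AddCommGroup M] [AddCommGroup N] (f : M →+ N) (Ω : Fin 3 → M)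
    (i k : Fin 3) : f (skew Ω i k) = skew (fun j => f (Ω j)) i k := by
  fin_cases i <;> fin_cases k <;> simp [skew]

/-- This is `-Δ v = curl (curl v)` in divergence form: in `∑ₖ ∂ₖ(∂ᵢ vₖ - ∂ₖ vᵢ)` the first terms add
up to `∂ᵢ div v = 0`. -/
lemma neg_laplacian_eq {v : Fin 3 → 𝓢'(R3, ℂ)} (hv : divergence v = 0) (i : Fin 3) :
    -∑ k, pd k (pd k (v i)) = ∑ k, pd k (skew (curl v) i k) := by
  have h : ∑ k, pd k (pd i (v k)) = 0 := by
    simp_rw [pd_comm _ i, pd_eq_mult i, ← map_sum]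
    rw [Fin.sum_univ_three]
    exact (congrArg _ hv).trans (map_zero _)
  simp_rw [skew_curl, pd_sub]
  rw [Finset.sum_sub_distrib, h, zero_sub]

/-- The right-hand side potentials for the weighted field `x_a v`. -/
def weightedPotential (v : Fin 3 → 𝓢'(R3, ℂ)) (a i k : Fin 3) : 𝓢'(R3, ℂ) :=
  skew (fun j => coordMul a (curl v j)) i k - (if k = a then v i else 0) -
    (if k = i then v a else 0)

/-- The commutator of `-Δ` with `x_a` gives `-2 ∂_a vᵢ`. Moving `x_a` inside the divergence in
`neg_laplacian_eq` gives `∂_a vᵢ - ∂ᵢ v_a`. What remains, `-∂_a vᵢ - ∂ᵢ v_a`, is again a divergence.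
-/
lemma neg_laplacian_coordMul_eq {v : Fin 3 → 𝓢'(R3, ℂ)} (hv : divergence v = 0) (a i : Fin 3) :
    -∑ k, pd k (pd k (coordMul a (v i))) = ∑ k, pd k (weightedPotential v a i k) := by
  have h1 : ∀ k, pd k (pd k (coordMul a (v i))) = (if k = a then pd a (v i) else 0) +
      (if k = a then pd a (v i) else 0) + coordMul a (pd k (pd k (v i))) := by
    intro k
    rw [pd_coordMul, pd_add, pd_coordMul, ← add_assoc]
    congr 2
    · split_ifs with h
      · rw [h]
      · rw [pd_eq_mult, map_zero]
    · split_ifs with h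
      · rw [h]
      · rfl
  have h2 : ∀ k, pd k (weightedPotential v a i k) =
      (if k = a then pd i (v a) - pd a (v i) else 0) + coordMul a (pd k (skew (curl v) i k)) -
        (if k = a then pd a (v i) else 0) - (if k = i then pd i (v a) else 0) := by
    intro k
    have e : skew (fun j => coordMul a (curl v j)) i k = coordMul a (skew (curl v) i k) :=
      (skew_map (TemperedDistribution.smulLeftCLM ℂ
        (fun p : R3 => ((p a : ℝ) : ℂ)) : 𝓢'(R3, ℂ) →L[ℂ] 𝓢'(R3, ℂ)).toLinearMap.toAddMonoidHom
        (curl v) i k).symm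
    rw [weightedPotential, pd_sub, pd_sub, e, pd_coordMul]
    congr 1
    · congr 1
      · congr 1
        split_ifs with h
        · rw [skew_curl, h]
        · rfl
      · split_ifs with h
        · rw [h]
        · rw [pd_eq_mult, map_zero]
    · split_ifs with h
      · rw [h]
      · rw [pd_eq_mult, map_zero]
  have h3 : ∑ k, coordMul a (pd k (skew (curl v) i k)) =
      -∑ k, coordMul a (pd k (pd k (v i))) := by
    simp only [coordMul, ← map_sum, ← map_neg]
    rw [← neg_laplacian_eq hv]
  simp_rw [h1, h2]
  simp only [Finset.sum_add_distrib, Finset.sum_sub_distrib, Finset.sum_ite_eq', Finset.mem_univ,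
    if_true]
  rw [h3]
  abel

/-! ### Cutoff functions -/

/-- Supplies a Schwartz amplitude for the inverse Laplacian that is invisible on the support of `φ`.
-/
lemma exists_cutoff : ∃ χ : 𝓢(R2, ℂ), ∀ η, ‖η‖ ≤ 8 / 3 → χ η = 1 := by
  let b : ContDiffBump (0 : R2) := ⟨3, 4, by norm_num, by norm_num⟩
  have hb1 : HasCompactSupport fun x => (b x : ℂ) :=
    b.hasCompactSupport.comp_left (g := Complex.ofReal) Complex.ofReal_zero
  have hb2 : ContDiff ℝ ∞ fun x => (b x : ℂ) := Complex.ofRealCLM.contDiff.comp b.contDiff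
  refine ⟨hb1.toSchwartzMap hb2, fun η hη => ?_⟩
  have : b η = 1 := b.one_of_mem_closedBall (by simp [b]; linarith)
  simp [this]

/-- With `exp l` in place of `‖η‖` the resolvent symbol is smooth, and `ρ` is bounded above and
below on the whole plane, while nothing changes on the annulus that carries `φ`. -/
lemma exists_log_cutoff : ∃ l : R2 → ℝ, ContDiff ℝ ∞ l ∧ HasCompactSupport l ∧
    ∀ η, 3 / 4 ≤ ‖η‖ → ‖η‖ ≤ 8 / 3 → Real.exp (l η) = ‖η‖ := by
  let b₁ : ContDiffBump (0 : R2) := ⟨3, 4, by norm_num, by norm_num⟩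
  let b₂ : ContDiffBump (0 : R2) := ⟨1 / 2, 3 / 4, by norm_num, by norm_num⟩
  -- `b₂` removes the singularity of the logarithm at `0` and vanishes for `‖η‖ ≥ 3/4`; `b₁`
  -- truncates at infinity and is `1` for `‖η‖ ≤ 3`.
  refine ⟨fun η => b₁ η * ((1 - b₂ η) * Real.log ‖η‖), ?_, b₁.hasCompactSupport.mul_right, ?_⟩
  · refine b₁.contDiff.mul (contDiff_iff_contDiffAt.2 fun η => ?_)
    by_cases hη : η = 0
    · subst hη
      have h : (fun η => (1 - b₂ η) * Real.log ‖η‖) =ᶠ[nhds 0] fun _ => 0 := by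
        filter_upwards [b₂.eventuallyEq_one] with x hx
        simp [hx]
      exact contDiffAt_const.congr_of_eventuallyEq h
    · exact (contDiffAt_const.sub b₂.contDiffAt).mul
        ((contDiffAt_norm ℝ hη).log (norm_ne_zero_iff.2 hη))
  · intro η h1 h2
    have e1 : b₁ η = 1 := b₁.one_of_mem_closedBall (by simp [b₁]; linarith)
    have e2 : b₂ η = 0 := b₂.zero_of_le_dist (by simpa [b₂] using h1)
    simp only [e1, e2, sub_zero, one_mul]
    exact Real.exp_log (by linarith)

lemma coord2_hasTemperateGrowth (b : Fin 2) :
    (fun η : R2 => ((η b : ℝ) : ℂ)).HasTemperateGrowth :=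
  (Complex.ofRealCLM ∘L (EuclideanSpace.proj b : R2 →L[ℝ] ℝ)).hasTemperateGrowth

/-- The Schwartz function `η ↦ η_b g(η)`. -/
def coordSchwartz (b : Fin 2) (g : 𝓢(R2, ℂ)) : 𝓢(R2, ℂ) :=
  SchwartzMap.smulLeftCLM ℂ (fun η : R2 => ((η b : ℝ) : ℂ)) g

lemma coordSchwartz_apply (b : Fin 2) (g : 𝓢(R2, ℂ)) (η : R2) :
    coordSchwartz b g η = η b * g η := by
  rw [coordSchwartz, SchwartzMap.smulLeftCLM_apply_apply (coord2_hasTemperateGrowth b), smul_eq_mul]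

/-! ### Derivatives of resolvents -/

lemma distNorm_sum_three_le {E : Type*} [NormedAddCommGroup E] [InnerProductSpace ℝ E]
    [FiniteDimensional ℝ E] [MeasurableSpace E] [BorelSpace E] (u : Fin 3 → 𝓢'(E, ℂ)) {p : ℝ≥0∞}
    (hp : 1 ≤ p) (s : Set E) : distNorm p s (∑ k, u k) ≤ ∑ k, distNorm p s (u k) := by
  rw [Fin.sum_univ_three, Fin.sum_univ_three]
  exact (distNorm_add_le _ _ hp s).trans (by gcongr; exact distNorm_add_le _ _ hp s)

lemma distNorm_mult_const_mul_le {E : Type*} [NormedAddCommGroup E] [InnerProductSpace ℝ E]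
    [FiniteDimensional ℝ E] [MeasurableSpace E] [BorelSpace E] {m : E → ℂ}
    (hm : m.HasTemperateGrowth) {c : ℂ} (hc : c ≠ 0) (u : 𝓢'(E, ℂ)) {p : ℝ≥0∞} (s : Set E) :
    distNorm p s (mult (fun ξ => c * m ξ) u) ≤ ‖c‖ₑ * distNorm p s (mult m u) := by
  rw [mult_const_mul hm]
  exact distNorm_smul_le hc _ s

/-- The amplitude of the symbol `g(r ξ_h) σ_k / (ρ² + τ²)`. -/
def derivAmplitude (g : 𝓢(R2, ℂ)) : Fin 3 → 𝓢(R2, ℂ) := ![coordSchwartz 0 g, coordSchwartz 1 g, g]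

/-- The power of the vertical frequency in the symbol `g(r ξ_h) σ_k / (ρ² + τ²)`. -/
def derivExponent : Fin 3 → ℕ := ![0, 0, 1]

lemma derivExponent_le (k : Fin 3) : derivExponent k ≤ 1 := by
  fin_cases k <;> simp [derivExponent]

/-- The length scale of the derivative `∂ₖ`. -/
def derivScale (r s : ℝ) : Fin 3 → ℝ := ![r, r, s]

lemma derivScale_pos {r s : ℝ} (hr : 0 < r) (hs : 0 < s) (k : Fin 3) : 0 < derivScale r s k := by
  fin_cases k <;> simpa [derivScale]

lemma derivScale_self (r : ℝ) (k : Fin 3) : derivScale r r k = r := by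
  fin_cases k <;> simp [derivScale]

/-- A horizontal derivative is absorbed by the amplitude and the vertical one by the exponent `ε`;
each costs `2πi` over its length scale. -/
lemma resolvent_mul_derivSymbol (g : 𝓢(R2, ℂ)) (l : R2 → ℝ) {r s : ℝ} (hr : 0 < r) (hs : 0 < s)
    (k : Fin 3) (ξ : R3) : resolvent g l 0 r s ξ * derivSymbol k ξ =
      (2 * Real.pi * Complex.I * ((derivScale r s k : ℝ) : ℂ)⁻¹) *
        resolvent (derivAmplitude g k) l (derivExponent k) r s ξ := by
  have hr' : (r : ℂ) ≠ 0 := by exact_mod_cast hr.ne'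
  have hs' : (s : ℂ) ≠ 0 := by exact_mod_cast hs.ne'
  fin_cases k
  · simp [resolvent, derivSymbol, derivScale, derivAmplitude, derivExponent, coordSchwartz_apply]
    field_simp
  · simp [resolvent, derivSymbol, derivScale, derivAmplitude, derivExponent, coordSchwartz_apply]
    field_simp
  · simp [resolvent, derivSymbol, derivScale, derivAmplitude, derivExponent]
    field_simp

lemma enorm_two_pi_I_mul_inv {x : ℝ} (hx : 0 < x) :
    ‖2 * Real.pi * Complex.I * (x : ℂ)⁻¹‖ₑ = (2 * NNReal.pi : ℝ≥0) * ENNReal.ofReal x⁻¹ := by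
  rw [← ofReal_norm]
  simp only [norm_mul, Complex.norm_I, norm_inv, mul_one, Complex.norm_real, Complex.norm_ofNat,
    Real.norm_of_nonneg Real.pi_pos.le, Real.norm_of_nonneg hx.le]
  rw [ENNReal.ofReal_mul (by positivity), ENNReal.ofReal_mul (by positivity)]
  push_cast
  congr 2
  · simp
  · rw [← NNReal.coe_real_pi, ENNReal.ofReal_coe_nnreal]

theorem exists_resolvent_deriv_bound (g : 𝓢(R2, ℂ)) {l : R2 → ℝ} (hl : ContDiff ℝ ∞ l)
    (hl' : HasCompactSupport l) : ∃ A : ℝ≥0, A ≠ 0 ∧ ∀ r s : ℝ, 0 < r → 0 < s → ∀ (k : Fin 3)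
      (W : 𝓢'(R3, ℂ)), IsPeriodic W →
        distNorm ∞ Set.univ (mult (fun ξ => resolvent g l 0 r s ξ * derivSymbol k ξ) W) ≤
          A * ENNReal.ofReal (derivScale r s k)⁻¹ * distNorm ∞ strip W ∧
        (s ≤ 2 * Real.pi →
          distNorm ∞ Set.univ (mult (fun ξ => resolvent g l 0 r s ξ * derivSymbol k ξ) W) ≤
            A * ENNReal.ofReal (derivScale r s k)⁻¹ *
              (ENNReal.ofReal (r ^ 2 * s)⁻¹ ^ (1 / 2 : ℝ) * distNorm 2 strip W)) := by
  choose A hA0 hA using fun k =>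
    exists_resolvent_bound (derivAmplitude g k) hl hl' (derivExponent_le k)
  have hAk : ∀ k, A k ≤ ∑ j, A j := fun k =>
    Finset.single_le_sum (f := A) (fun _ _ => zero_le) (Finset.mem_univ k)
  refine ⟨2 * NNReal.pi * ∑ k, A k, mul_ne_zero (mul_ne_zero two_ne_zero NNReal.pi_ne_zero)
    (((pos_iff_ne_zero.2 (hA0 0)).trans_le (hAk 0)).ne'), fun r s hr hs k W hW => ?_⟩
  have hd := derivScale_pos hr hs k
  have hc : 2 * Real.pi * Complex.I * ((derivScale r s k : ℝ) : ℂ)⁻¹ ≠ 0 := by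
    have : ((derivScale r s k : ℝ) : ℂ) ≠ 0 := by exact_mod_cast hd.ne'
    simp [Real.pi_ne_zero, this]
  have h0 : distNorm ∞ Set.univ (mult (fun ξ => resolvent g l 0 r s ξ * derivSymbol k ξ) W) ≤
      (2 * NNReal.pi : ℝ≥0) * ENNReal.ofReal (derivScale r s k)⁻¹ * distNorm ∞ Set.univ
        (mult (resolvent (derivAmplitude g k) l (derivExponent k) r s) W) := by
    rw [← enorm_two_pi_I_mul_inv hd]
    simp_rw [resolvent_mul_derivSymbol g l hr hs k]
    exact distNorm_mult_const_mul_le (resolvent_hasTemperateGrowth _ hl hl' _ r s) hc _ _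
  obtain ⟨h1, h2⟩ := hA k r s hr hs W hW
  have hAk' : (A k : ℝ≥0∞) ≤ ((∑ j, A j : ℝ≥0) : ℝ≥0∞) := ENNReal.coe_le_coe.2 (hAk k)
  refine ⟨h0.trans ?_, fun hs' => h0.trans ?_⟩
  · rw [ENNReal.coe_mul (2 * NNReal.pi)]
    calc _ ≤ (2 * NNReal.pi : ℝ≥0) * ENNReal.ofReal (derivScale r s k)⁻¹ *
          (((∑ j, A j : ℝ≥0) : ℝ≥0∞) * distNorm ∞ strip W) := by
          gcongr
          exact h1.trans (mul_le_mul_left hAk' _)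
      _ = _ := by ring
  · rw [ENNReal.coe_mul (2 * NNReal.pi)]
    calc _ ≤ (2 * NNReal.pi : ℝ≥0) * ENNReal.ofReal (derivScale r s k)⁻¹ *
          (((∑ j, A j : ℝ≥0) : ℝ≥0∞) * ENNReal.ofReal (r ^ 2 * s)⁻¹ ^ (1 / 2 : ℝ) *
            distNorm 2 strip W) := by
          gcongr
          exact (h2 hs').trans (mul_le_mul_left (mul_le_mul_left hAk' _) _)
      _ = _ := by ring

/-! ### Elliptic estimates for the dyadic blocks in space -/

lemma dyadic_scale_pos (q : ℤ) : 0 < (2 : ℝ) ^ (-q) * (2 * Real.pi) := by positivity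

/-- Where `φ` does not vanish, `χ = 1` and `exp l = ‖η‖`, so the truncated resolvent is the exact
inverse of the Laplace symbol. -/
lemma symbol_inversion {φ χ : 𝓢(R2, ℂ)} (hφ : IsDyadicPartition φ) {l : R2 → ℝ}
    (hχ : ∀ η, ‖η‖ ≤ 8 / 3 → χ η = 1)
    (hl : ∀ η, 3 / 4 ≤ ‖η‖ → ‖η‖ ≤ 8 / 3 → Real.exp (l η) = ‖η‖) (η : R2) (t : ℝ) :
    φ η = φ η * (χ η * (((Real.exp (l η)) ^ 2 + t ^ 2 : ℝ) : ℂ)⁻¹) *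
      (((η 0 : ℝ) : ℂ) ^ 2 + ((η 1 : ℝ) : ℂ) ^ 2 + (t : ℂ) ^ 2) := by
  by_cases h : φ η = 0
  · simp [h]
  obtain ⟨h1, h2⟩ := hφ.1 η h
  have e : ‖η‖ ^ 2 = (η 0) ^ 2 + (η 1) ^ 2 := by
    rw [EuclideanSpace.norm_sq_eq, Fin.sum_univ_two]
    simp
  have h3 : (((η 0) ^ 2 + (η 1) ^ 2 + t ^ 2 : ℝ) : ℂ) ≠ 0 := by
    have : 0 < ‖η‖ ^ 2 := by positivity
    exact_mod_cast (by rw [← e]; positivity : (0 : ℝ) < (η 0) ^ 2 + (η 1) ^ 2 + t ^ 2).ne'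
  rw [hχ η h2, hl η h1 h2, e, one_mul, mul_assoc]
  push_cast at h3 ⊢
  rw [inv_mul_cancel₀ h3, mul_one]

/-- With `r = s` the operators from `Gₖ` to `∂_b w` have order `0`, and their kernels have `L¹`
norms independent of the scale. Only the `L¹` bound enters, hence no restriction on `j`. -/
theorem exists_block3_pd_bound {φ : 𝓢(R2, ℂ)} (hφ : IsDyadicPartition φ) :
    ∃ A : ℝ≥0, A ≠ 0 ∧ ∀ (j : ℤ) (w : 𝓢'(R3, ℂ)) (G : Fin 3 → 𝓢'(R3, ℂ)),
      (∀ k, IsPeriodic (G k)) → (-∑ k, pd k (pd k w) = ∑ k, pd k (G k)) → ∀ b : Fin 2,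
        distNorm ∞ Set.univ (block3 φ j (pd (hIdx b) w)) ≤
          A * ∑ k, distNorm ∞ strip (block3 φ j (G k)) := by
  obtain ⟨χ, hχ⟩ := exists_cutoff
  obtain ⟨l, hl, hl', hle⟩ := exists_log_cutoff
  choose A hA0 hA using fun b => exists_resolvent_deriv_bound (coordSchwartz b χ) hl hl'
  have hAk : ∀ k, A k ≤ ∑ j, A j := fun k =>
    Finset.single_le_sum (f := A) (fun _ _ => zero_le) (Finset.mem_univ k)
  refine ⟨∑ k, A k, (((pos_iff_ne_zero.2 (hA0 0)).trans_le (hAk 0)).ne'), fun j w G hG hw b => ?_⟩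
  set r : ℝ := (2 : ℝ) ^ (-j) * (2 * Real.pi) with hr_def
  have hr : 0 < r := dyadic_scale_pos j
  have hr' : (r : ℂ) ≠ 0 := by exact_mod_cast hr.ne'
  have hπ : (Real.pi : ℂ) ≠ 0 := by exact_mod_cast Real.pi_ne_zero
  -- In rescaled frequencies `∂_b` is `(2πi / r) η_b` and `-Δ` is `(2π / r)² (|η|² + τ²)`; `c` is
  -- the quotient of the two prefactors.
  set c : ℂ := Complex.I * (r / (2 * Real.pi) : ℝ) with hc_def
  have hc : c ≠ 0 := by
    simp [hc_def, Complex.I_ne_zero, hr.ne', Real.pi_ne_zero]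
  have hm := resolvent_hasTemperateGrowth (coordSchwartz b χ) hl hl' 0 r r
  simp only [pd_eq_mult] at hw
  have key := mult_elliptic (σ := derivSymbol) (Φ := fun ξ => φ (r • horiz ξ))
    (Q := fun ξ => c * resolvent (coordSchwartz b χ) l 0 r r ξ) (s := derivSymbol (hIdx b))
    derivSymbol_hasTemperateGrowth (symbol3_hasTemperateGrowth φ j)
    ((Function.HasTemperateGrowth.const c).mul hm) (derivSymbol_hasTemperateGrowth _) ?_ hw
  · rw [pd_eq_mult]
    change distNorm ∞ Set.univ (mult (fun ξ => φ (r • horiz ξ)) _) ≤ _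
    rw [key]
    refine (distNorm_sum_three_le _ le_top _).trans ?_
    rw [Finset.mul_sum]
    refine Finset.sum_le_sum fun k _ => ?_
    have hper : IsPeriodic (mult (fun ξ => φ (r • horiz ξ)) (G k)) :=
      (hG k).mult (symbol3_hasTemperateGrowth φ j)
    have h1 := (hA b r r hr hr k _ hper).1
    simp_rw [mul_assoc c]
    refine (distNorm_mult_const_mul_le (hm.mul (derivSymbol_hasTemperateGrowth k)) hc _ _).trans ?_
    refine (mul_le_mul_right h1 _).trans ?_
    rw [derivScale_self, ← mul_assoc, ← mul_assoc]
    refine mul_le_mul_left ?_ _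
    have e : ‖c‖ₑ * ENNReal.ofReal r⁻¹ ≤ 1 := by
      rw [← ofReal_norm, ← ENNReal.ofReal_mul (norm_nonneg _), ENNReal.ofReal_le_one, hc_def,
        norm_mul, Complex.norm_I, one_mul, Complex.norm_real, Real.norm_of_nonneg (by positivity)]
      rw [div_mul_eq_mul_div, mul_inv_cancel₀ hr.ne', div_le_one (by positivity)]
      linarith [Real.pi_gt_three]
    calc _ = A b * (‖c‖ₑ * ENNReal.ofReal r⁻¹) := by ring
      _ ≤ ((∑ k, A k : ℝ≥0) : ℝ≥0∞) * 1 := by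
        gcongr
        exact hAk b
      _ = _ := mul_one _
  · intro ξ
    have h := symbol_inversion hφ hχ hle (r • horiz ξ) (r * vert ξ)
    simp only [resolvent, coordSchwartz_apply, derivSymbol, Fin.sum_univ_three, pow_zero, mul_one]
    generalize (((Real.exp (l (r • horiz ξ))) ^ 2 + (r * vert ξ) ^ 2 : ℝ) : ℂ)⁻¹ = D at h ⊢
    have hb : ((horiz ξ b : ℝ) : ℂ) = ((ξ (hIdx b) : ℝ) : ℂ) := by fin_cases b <;> simp
    have hc2 : c * (2 * Real.pi * Complex.I) ^ 2 = -(2 * Real.pi * Complex.I) * r := by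
      rw [hc_def]
      push_cast
      field_simp
      linear_combination Complex.I_sq
    simp only [PiLp.smul_apply, smul_eq_mul, horiz_apply_zero, horiz_apply_one, vert_apply,
      Complex.ofReal_mul, hb] at h ⊢
    linear_combination (2 * Real.pi * Complex.I * ξ (hIdx b)) * h + r * ξ (hIdx b) *
      χ (r • horiz ξ) * D * φ (r • horiz ξ) * ((ξ 0 : ℂ) ^ 2 + (ξ 1 : ℂ) ^ 2 + (ξ 2 : ℂ) ^ 2) * hc2

/-- Order `-1` gains `2^{-j}` and Bernstein's inequality from `L²` to `L^∞` in three dimensions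
loses `2^{3j/2}`. The condition `0 ≤ j` yields `r ≤ 2π`, as the weighted `L²` bound on the kernels
requires. -/
theorem exists_block3_bound {φ : 𝓢(R2, ℂ)} (hφ : IsDyadicPartition φ) :
    ∃ A : ℝ≥0, A ≠ 0 ∧ ∀ (j : ℤ) (w : 𝓢'(R3, ℂ)) (G : Fin 3 → 𝓢'(R3, ℂ)), 0 ≤ j →
      (∀ k, IsPeriodic (G k)) → (-∑ k, pd k (pd k w) = ∑ k, pd k (G k)) →
        distNorm ∞ Set.univ (block3 φ j w) ≤
          A * (2 : ℝ≥0∞) ^ ((j : ℝ) / 2) * ∑ k, distNorm 2 strip (block3 φ j (G k)) := by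
  obtain ⟨χ, hχ⟩ := exists_cutoff
  obtain ⟨l, hl, hl', hle⟩ := exists_log_cutoff
  obtain ⟨A, hA0, hA⟩ := exists_resolvent_deriv_bound χ hl hl'
  refine ⟨A, hA0, fun j w G hj hG hw => ?_⟩
  set r : ℝ := (2 : ℝ) ^ (-j) * (2 * Real.pi) with hr_def
  have hr : 0 < r := dyadic_scale_pos j
  have hr2 : r ≤ 2 * Real.pi := by
    refine mul_le_of_le_one_left (by positivity) (zpow_le_one_of_nonpos₀ (by norm_num) (by omega))
  have hr' : (r : ℂ) ≠ 0 := by exact_mod_cast hr.ne'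
  have hπ : (Real.pi : ℂ) ≠ 0 := by exact_mod_cast Real.pi_ne_zero
  set c : ℂ := (((r / (2 * Real.pi)) ^ 2 : ℝ) : ℂ) with hc_def
  have hc : c ≠ 0 := by
    simp [hc_def, hr.ne', Real.pi_ne_zero]
  have hm := resolvent_hasTemperateGrowth χ hl hl' 0 r r
  simp only [pd_eq_mult] at hw
  have key := mult_elliptic (σ := derivSymbol) (Φ := fun ξ => φ (r • horiz ξ))
    (Q := fun ξ => c * resolvent χ l 0 r r ξ) (s := fun _ => 1)
    derivSymbol_hasTemperateGrowth (symbol3_hasTemperateGrowth φ j)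
    ((Function.HasTemperateGrowth.const c).mul hm) (.const 1) ?_ hw
  · change distNorm ∞ Set.univ (mult (fun ξ => φ (r • horiz ξ)) _) ≤ _
    rw [mult_one] at key
    rw [key]
    refine (distNorm_sum_three_le _ le_top _).trans ?_
    rw [Finset.mul_sum]
    refine Finset.sum_le_sum fun k _ => ?_
    have hper : IsPeriodic (mult (fun ξ => φ (r • horiz ξ)) (G k)) :=
      (hG k).mult (symbol3_hasTemperateGrowth φ j)
    have h1 := (hA r r hr hr k _ hper).2 hr2
    simp_rw [mul_assoc c]
    refine (distNorm_mult_const_mul_le (hm.mul (derivSymbol_hasTemperateGrowth k)) hc _ _).trans ?_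
    refine (mul_le_mul_right h1 _).trans ?_
    rw [derivScale_self, ← mul_assoc, ← mul_assoc]
    refine mul_le_mul_left ?_ _
    -- The product is `(r / 2π)² r⁻¹ r^{-3/2} = (2π)⁻² r^{-1/2}`, that is `(2π)^{-5/2} 2^{j/2}`.
    have e : ‖c‖ₑ * ENNReal.ofReal r⁻¹ * ENNReal.ofReal (r ^ 2 * r)⁻¹ ^ (1 / 2 : ℝ) ≤
        (2 : ℝ≥0∞) ^ ((j : ℝ) / 2) := by
      have e2 : (2 : ℝ≥0∞) = ENNReal.ofReal 2 := by simp
      rw [e2, ENNReal.ofReal_rpow_of_pos two_pos, ENNReal.ofReal_rpow_of_pos (by positivity),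
        ← ofReal_norm, ← ENNReal.ofReal_mul (norm_nonneg _), ← ENNReal.ofReal_mul (by positivity)]
      refine ENNReal.ofReal_le_ofReal ?_
      rw [hc_def, Complex.norm_real, Real.norm_of_nonneg (by positivity), ← Real.sqrt_eq_rpow]
      have e3 : ((2 : ℝ) ^ ((j : ℝ) / 2)) = Real.sqrt ((2 : ℝ) ^ j) := by
        rw [Real.sqrt_eq_rpow, ← Real.rpow_intCast, ← Real.rpow_mul (by norm_num)]
        congr 1; ring
      rw [e3]
      refine Real.le_sqrt_of_sq_le ?_
      rw [mul_pow, Real.sq_sqrt (by positivity)]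
      have e4 : ((r / (2 * Real.pi)) ^ 2 * r⁻¹) ^ 2 * (r ^ 2 * r)⁻¹ = r⁻¹ * (2 * Real.pi)⁻¹ ^ 4 := by
        field_simp
      have e5 : r⁻¹ = (2 : ℝ) ^ j * (2 * Real.pi)⁻¹ := by
        rw [hr_def, mul_inv, zpow_neg, inv_inv]
      rw [e4, e5, mul_assoc]
      refine mul_le_of_le_one_right (by positivity) ?_
      rw [← pow_succ']
      exact pow_le_one₀ (by positivity) (inv_le_one_of_one_le₀ (by linarith [Real.pi_gt_three]))
    calc _ = A * (‖c‖ₑ * ENNReal.ofReal r⁻¹ * ENNReal.ofReal (r ^ 2 * r)⁻¹ ^ (1 / 2 : ℝ)) := by ring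
      _ ≤ _ := by gcongr
  · intro ξ
    have h := symbol_inversion hφ hχ hle (r • horiz ξ) (r * vert ξ)
    simp only [resolvent, derivSymbol, Fin.sum_univ_three, pow_zero, mul_one]
    generalize (((Real.exp (l (r • horiz ξ))) ^ 2 + (r * vert ξ) ^ 2 : ℝ) : ℂ)⁻¹ = D at h ⊢
    have hc2 : c * (2 * Real.pi * Complex.I) ^ 2 = -(r : ℂ) ^ 2 := by
      rw [hc_def]
      push_cast
      field_simp
      linear_combination Complex.I_sq
    simp only [PiLp.smul_apply, smul_eq_mul, horiz_apply_zero, horiz_apply_one, vert_apply,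
      Complex.ofReal_mul] at h ⊢
    linear_combination h + χ (r • horiz ξ) * D * φ (r • horiz ξ) *
      ((ξ 0 : ℂ) ^ 2 + (ξ 1 : ℂ) ^ 2 + (ξ 2 : ℂ) ^ 2) * hc2

/-! ### Low frequencies -/

lemma tsum_Iic_two_zpow_le : ∑' q : Set.Iic (-1 : ℤ), ENNReal.ofReal ((2 : ℝ) ^ (q : ℤ)) ≤ 2 := by
  have hinj : Function.Injective fun q : Set.Iic (-1 : ℤ) => (-(q : ℤ)).toNat := by
    intro q q' h
    have h1 := q.2
    have h2 := q'.2
    simp only [Set.mem_Iic] at h1 h2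
    ext
    simp only at h
    omega
  have h := ENNReal.tsum_comp_le_tsum_of_injective hinj fun n : ℕ => (2⁻¹ : ℝ≥0∞) ^ n
  rw [ENNReal.tsum_geometric] at h
  have e : (1 - (2⁻¹ : ℝ≥0∞))⁻¹ = 2 := by rw [ENNReal.one_sub_inv_two, inv_inv]
  rw [e] at h
  refine le_trans (le_of_eq (tsum_congr fun q => ?_)) h
  have h1 := q.2
  simp only [Set.mem_Iic] at h1
  have e2 : ((2 : ℝ) ^ (q : ℤ)) = (2⁻¹ : ℝ) ^ (-(q : ℤ)).toNat := by
    rw [← zpow_natCast, Int.toNat_of_nonneg (by omega), inv_zpow', neg_neg]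
  rw [e2, ENNReal.ofReal_pow (by norm_num), ENNReal.ofReal_inv_of_pos two_pos,
    ENNReal.ofReal_ofNat]

/-! ### Absolutely convergent series in `L^∞` -/

section Sum

variable {E : Type*} [NormedAddCommGroup E] [InnerProductSpace ℝ E] [FiniteDimensional ℝ E]
  [MeasurableSpace E] [BorelSpace E]

lemma isRepresentedBy_Lp_top (F : Lp ℂ ∞ (volume : Measure E)) :
    IsRepresentedBy (Lp.toTemperedDistributionCLM ℂ (volume : Measure E) ∞ F) F := by
  refine ⟨Lp.aestronglyMeasurable F, fun ψ => ⟨?_, ?_⟩⟩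
  · exact ψ.integrable.mul_of_top_left (Lp.memLp F)
  · simp

/-- Transfers convergence questions to the Banach space `L^∞`. Uniqueness of the representing
function makes the norm of `F` a lower bound for every candidate in the infimum. -/
lemma exists_Lp_top_of_distNorm_lt_top {u : 𝓢'(E, ℂ)} (h : distNorm ∞ Set.univ u < ⊤) :
    ∃ F : Lp ℂ ∞ (volume : Measure E), u = Lp.toTemperedDistributionCLM ℂ volume ∞ F ∧
      ‖F‖ₑ ≤ distNorm ∞ Set.univ u := by
  obtain ⟨f, hf, hlt⟩ := by simpa [distNorm, iInf_lt_iff] using h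
  have hm : MemLp f ∞ (volume : Measure E) := ⟨hf.1, hlt⟩
  refine ⟨hm.toLp f, ?_, ?_⟩
  · ext ψ
    rw [(hf.2 ψ).2, ((isRepresentedBy_Lp_top (hm.toLp f)).2 ψ).2]
    refine integral_congr_ae ?_
    filter_upwards [hm.coeFn_toLp] with x hx
    rw [hx]
  · refine le_distNorm fun g hg => ?_
    rw [Lp.enorm_def, Measure.restrict_univ]
    exact (eLpNorm_congr_ae (hm.coeFn_toLp.trans (hf.ae_eq hg))).le

/-- A series of distributions with summable `L^∞` norms converges. -/
theorem exists_hasSum_distNorm_le {ι : Type*} {u : ι → 𝓢'(E, ℂ)}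
    (h : ∑' i, distNorm ∞ Set.univ (u i) ≠ ⊤) :
    ∃ w, HasSum u w ∧ distNorm ∞ Set.univ w ≤ ∑' i, distNorm ∞ Set.univ (u i) := by
  choose F hF hFn using fun i =>
    exists_Lp_top_of_distNorm_lt_top (lt_top_iff_ne_top.2 (ENNReal.ne_top_of_tsum_ne_top h i))
  have hle : ∑' i, ‖F i‖ₑ ≤ ∑' i, distNorm ∞ Set.univ (u i) := ENNReal.tsum_le_tsum hFn
  have hsum : Summable fun i => ‖F i‖ := by
    have h1 : ∑' i, ‖F i‖ₑ ≠ ⊤ := ne_top_of_le_ne_top h hle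
    simpa using ENNReal.summable_toReal h1
  have hs := hsum.of_norm.hasSum
  refine ⟨Lp.toTemperedDistributionCLM ℂ volume ∞ (∑' i, F i), ?_, ?_⟩
  · have := ContinuousLinearMap.hasSum (Lp.toTemperedDistributionCLM ℂ (volume : Measure E) ∞) hs
    simpa only [← hF] using this
  · refine (distNorm_le_of_isRepresentedBy (isRepresentedBy_Lp_top _) _ _).trans ?_
    rw [Measure.restrict_univ, ← Lp.enorm_def]
    exact (enorm_tsum_le_tsum_enorm).trans hle

end Sum

/-- If the right-hand side is finite, the series converges absolutely in `L^∞`, hence in the sense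
of distributions, so the convergence required by `lowFreqNorm` comes with the bound. -/
theorem lowFreqNorm_le (φ : 𝓢(R2, ℂ)) (u : 𝓢'(R3, ℂ)) :
    lowFreqNorm φ ∞ u ≤ ∑' q : Set.Iic (-1 : ℤ), distNorm ∞ Set.univ (block3 φ q u) := by
  by_cases h : ∑' q : Set.Iic (-1 : ℤ), distNorm ∞ Set.univ (block3 φ q u) = ⊤
  · rw [h]; exact le_top
  · obtain ⟨w, hw, hle⟩ := exists_hasSum_distNorm_le h
    exact (iInf₂_le w hw).trans ((distNorm_mono_set (Set.subset_univ _)).trans hle)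

/-- The block `Δ_q` as a combination of `1`, `∂_b²` and `-Δ`. -/
lemma block3_eq (φ : 𝓢(R2, ℂ)) (q : ℤ) {w : 𝓢'(R3, ℂ)} {G : Fin 3 → 𝓢'(R3, ℂ)}
    (hw : -∑ k, pd k (pd k w) = ∑ k, pd k (G k)) {R : R3 → ℂ} (hR : R.HasTemperateGrowth)
    (h : ∀ ξ, φ (((2 : ℝ) ^ (-q) * (2 * Real.pi)) • horiz ξ) =
      R ξ * (1 - derivSymbol 2 ξ * derivSymbol 2 ξ)) :
    block3 φ q w = mult R w + (mult (fun ξ => R ξ * derivSymbol 0 ξ * derivSymbol 0 ξ) w +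
      mult (fun ξ => R ξ * derivSymbol 1 ξ * derivSymbol 1 ξ) w) +
        ∑ k, mult (fun ξ => R ξ * derivSymbol k ξ) (G k) := by
  have hσ := derivSymbol_hasTemperateGrowth
  have hRσ : ∀ k, (fun ξ => R ξ * derivSymbol k ξ).HasTemperateGrowth := fun k => hR.mul (hσ k)
  have hσσ : ∀ k, (fun ξ => derivSymbol k ξ * derivSymbol k ξ).HasTemperateGrowth :=
    fun k => (hσ k).mul (hσ k)
  have hRσσ : ∀ k, (fun ξ => R ξ * derivSymbol k ξ * derivSymbol k ξ).HasTemperateGrowth :=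
    fun k => (hRσ k).mul (hσ k)
  have h1 : ∀ k, mult (fun ξ => R ξ * derivSymbol k ξ) (G k) = mult R (pd k (G k)) := fun k => by
    rw [pd_eq_mult, mult_mult hR (hσ k)]
  have h2 : ∀ k, mult R (pd k (pd k w)) =
      mult (fun ξ => R ξ * derivSymbol k ξ * derivSymbol k ξ) w := fun k => by
    rw [pd_eq_mult, pd_eq_mult, mult_mult (hσ k) (hσ k), mult_mult hR (hσσ k)]
    simp only [mul_assoc]
  -- `R` is the block divided by `1 - ∂₂²`. The equation for `w` then turns `-∂₂² w` into `∂₀² w +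
  -- ∂₁² w + ∑ₖ ∂ₖ Gₖ`.
  have h3 : block3 φ q w = mult R w - mult R (pd 2 (pd 2 w)) := by
    have e : mult R w = block3 φ q w + mult (fun ξ => R ξ * derivSymbol 2 ξ * derivSymbol 2 ξ) w := by
      have h0 := mult_sum (s := Finset.univ)
        (m := ![fun ξ => φ (((2 : ℝ) ^ (-q) * (2 * Real.pi)) • horiz ξ),
        fun ξ => R ξ * derivSymbol 2 ξ * derivSymbol 2 ξ]) (by
          intro i _
          fin_cases i
          · exact symbol3_hasTemperateGrowth φ q
          · exact hRσσ 2) w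
      simp only [Fin.sum_univ_two, Matrix.cons_val_zero, Matrix.cons_val_one] at h0
      refine Eq.trans ?_ h0
      congr 2
      ext ξ
      rw [h]
      ring
    rw [h2, e, add_sub_cancel_right]
  simp_rw [h1]
  rw [← map_sum, ← hw, map_neg, map_sum, Fin.sum_univ_three, h3, ← h2, ← h2]
  abel

/-- Inverting the full Laplacian would be singular as `q → -∞`; inverting `1 - ∂₂²` is not, and it
puts horizontal derivatives on `w` that are harmless at low frequency. Each block is bounded in
`L^∞` by `2^q` times `L²` norms. -/
theorem exists_lowFreqNorm_bound (φ : 𝓢(R2, ℂ)) :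
    ∃ A : ℝ≥0, ∀ (w : 𝓢'(R3, ℂ)) (G : Fin 3 → 𝓢'(R3, ℂ)), IsPeriodic w →
      (∀ k, IsPeriodic (G k)) → (-∑ k, pd k (pd k w) = ∑ k, pd k (G k)) →
        lowFreqNorm φ ∞ w ≤ A * (distNorm 2 strip w + ∑ k, distNorm 2 strip (G k)) := by
  -- With `l = 0`, hence `ρ = 1`, and `s = 2π`, `resolvent` is `φ / (1 + (2π ξ₂)²)`; moreover `2π`
  -- is the largest vertical scale that the `L²` bound admits.
  have hl : ContDiff ℝ ∞ (fun _ : R2 => (0 : ℝ)) := contDiff_const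
  have hl' : HasCompactSupport (fun _ : R2 => (0 : ℝ)) := HasCompactSupport.zero
  obtain ⟨A₀, hA₀0, hA₀⟩ := exists_resolvent_bound φ hl hl' zero_le_one
  obtain ⟨A₁, hA₁0, hA₁⟩ := exists_resolvent_deriv_bound φ hl hl'
  choose A₂ hA₂0 hA₂ using fun b => exists_resolvent_deriv_bound (coordSchwartz b φ) hl hl'
  refine ⟨2 * (A₀ + (A₂ 0 + A₂ 1) + A₁), fun w G hwp hG hw => ?_⟩
  set S := distNorm 2 strip w + ∑ k, distNorm 2 strip (G k) with hS
  have hq : ∀ q : Set.Iic (-1 : ℤ), distNorm ∞ Set.univ (block3 φ q w) ≤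
      ENNReal.ofReal ((2 : ℝ) ^ (q : ℤ)) * ((A₀ + (A₂ 0 + A₂ 1) + A₁ : ℝ≥0) * S) := by
    rintro ⟨q, hq⟩
    simp only [Set.mem_Iic] at hq
    simp only
    set r : ℝ := (2 : ℝ) ^ (-q) * (2 * Real.pi) with hr_def
    have hr : 0 < r := dyadic_scale_pos q
    have hπ : 1 ≤ 2 * Real.pi := by linarith [Real.pi_gt_three]
    have hs : 0 < 2 * Real.pi := by positivity
    have hr2π : 2 * Real.pi ≤ r :=
      le_mul_of_one_le_left (by positivity) (one_le_zpow₀ (by norm_num) (by omega))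
    have hr' : (r : ℂ) ≠ 0 := by exact_mod_cast hr.ne'
    have hπ' : (Real.pi : ℂ) ≠ 0 := by exact_mod_cast Real.pi_ne_zero
    have hR := resolvent_hasTemperateGrowth φ hl hl' 0 r (2 * Real.pi)
    have hRb := fun b => resolvent_hasTemperateGrowth (coordSchwartz b φ) hl hl' 0 r (2 * Real.pi)
    have hdec : ENNReal.ofReal (r ^ 2 * (2 * Real.pi))⁻¹ ^ (1 / 2 : ℝ) ≤
        ENNReal.ofReal ((2 : ℝ) ^ q) := by
      rw [ENNReal.ofReal_rpow_of_pos (by positivity), ← Real.sqrt_eq_rpow]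
      refine ENNReal.ofReal_le_ofReal (Real.sqrt_le_iff.2 ⟨by positivity, ?_⟩)
      rw [hr_def, zpow_neg]
      have : ((((2 : ℝ) ^ q)⁻¹ * (2 * Real.pi)) ^ 2 * (2 * Real.pi))⁻¹ =
          ((2 : ℝ) ^ q) ^ 2 * ((2 * Real.pi) ^ 3)⁻¹ := by
        field_simp
      rw [this]
      exact mul_le_of_le_one_right (by positivity) (inv_le_one_of_one_le₀ (one_le_pow₀ hπ))
    -- Since `q ≤ -1`, both scales are at least `2π`, so no derivative costs more than a constant.
    have hscale : ∀ k, ENNReal.ofReal (derivScale r (2 * Real.pi) k)⁻¹ ≤ 1 := by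
      intro k
      rw [ENNReal.ofReal_le_one]
      refine inv_le_one_of_one_le₀ ?_
      fin_cases k <;> simp [derivScale] <;> linarith
    have key := block3_eq φ q hw (R := resolvent φ (fun _ => 0) 0 r (2 * Real.pi)) hR (fun ξ => by
      have hD : (1 + (2 * Real.pi * ξ 2) ^ 2 : ℂ) ≠ 0 := by
        exact_mod_cast (by positivity : (0 : ℝ) < 1 + (2 * Real.pi * ξ 2) ^ 2).ne'
      simp only [resolvent, derivSymbol, pow_zero, mul_one, Real.exp_zero, one_pow, vert_apply]
      push_cast
      have e : (1 - 2 * Real.pi * Complex.I * ξ 2 * (2 * Real.pi * Complex.I * ξ 2) : ℂ) =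
          1 + (2 * Real.pi * ξ 2) ^ 2 := by
        linear_combination (-4 * Real.pi ^ 2 * (ξ 2 : ℂ) ^ 2) * Complex.I_sq
      rw [e, mul_assoc, inv_mul_cancel₀ hD, mul_one])
    set D := ENNReal.ofReal ((2 : ℝ) ^ q)
    have b0 : distNorm ∞ Set.univ (mult (resolvent φ (fun _ => 0) 0 r (2 * Real.pi)) w) ≤
        A₀ * (D * S) := by
      refine ((hA₀ r _ hr hs w hwp).2 le_rfl).trans ?_
      rw [mul_assoc]
      gcongr
      exact le_self_add
    have b1 : ∀ k, distNorm ∞ Set.univ (mult (fun ξ => resolvent φ (fun _ => 0) 0 r (2 * Real.pi) ξ *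
        derivSymbol k ξ) (G k)) ≤ A₁ * D * distNorm 2 strip (G k) := by
      intro k
      refine ((hA₁ r _ hr hs k (G k) (hG k)).2 le_rfl).trans ?_
      calc _ ≤ A₁ * 1 * (D * distNorm 2 strip (G k)) := by
            gcongr
            exact hscale k
        _ = _ := by ring
    have b2 : ∀ b : Fin 2, distNorm ∞ Set.univ (mult (fun ξ =>
        resolvent φ (fun _ => 0) 0 r (2 * Real.pi) ξ * derivSymbol (hIdx b) ξ *
          derivSymbol (hIdx b) ξ) w) ≤ A₂ b * (D * S) := by
      intro b
      set c : ℂ := 2 * Real.pi * Complex.I * (r : ℂ)⁻¹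
      have hc : c ≠ 0 := by simp [c, Real.pi_ne_zero, hr.ne']
      have hcle : ‖c‖ₑ ≤ 1 := by
        rw [← ofReal_norm, ENNReal.ofReal_le_one]
        simp only [c, norm_mul, Complex.norm_I, norm_inv, mul_one, Complex.norm_real,
          Complex.norm_ofNat, Real.norm_of_nonneg Real.pi_pos.le, Real.norm_of_nonneg hr.le]
        rwa [← div_eq_mul_inv, div_le_one hr]
      have e : (fun ξ => resolvent φ (fun _ => 0) 0 r (2 * Real.pi) ξ * derivSymbol (hIdx b) ξ *
          derivSymbol (hIdx b) ξ) = fun ξ => c *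
            (resolvent (coordSchwartz b φ) (fun _ => 0) 0 r (2 * Real.pi) ξ *
              derivSymbol (hIdx b) ξ) := by
        ext ξ
        rw [resolvent_mul_derivSymbol φ _ hr hs]
        fin_cases b <;> simp [derivScale, derivAmplitude, derivExponent, c] <;> ring
      rw [e]
      refine (distNorm_mult_const_mul_le ((hRb b).mul (derivSymbol_hasTemperateGrowth _)) hc _
        _).trans ?_
      refine (mul_le_mul' hcle ((hA₂ b r _ hr hs (hIdx b) w hwp).2 le_rfl)).trans ?_
      calc _ ≤ 1 * (A₂ b * 1 * (D * S)) := by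
            gcongr
            · exact hscale _
            · exact le_self_add
        _ = _ := by ring
    rw [key]
    refine (distNorm_add_le _ _ le_top _).trans ?_
    refine (add_le_add ((distNorm_add_le _ _ le_top _).trans (add_le_add b0
      ((distNorm_add_le _ _ le_top _).trans (add_le_add (b2 0) (b2 1)))))
      ((distNorm_sum_three_le _ le_top _).trans (Finset.sum_le_sum fun k _ => b1 k))).trans ?_
    rw [← Finset.mul_sum]
    have : ∑ k, distNorm 2 strip (G k) ≤ S := le_add_self
    calc _ ≤ A₀ * (D * S) + (A₂ 0 * (D * S) + A₂ 1 * (D * S)) + A₁ * D * S := by gcongr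
      _ = _ := by push_cast; ring
  refine (lowFreqNorm_le φ w).trans ((ENNReal.tsum_le_tsum hq).trans ?_)
  rw [ENNReal.tsum_mul_right]
  refine (mul_le_mul_left tsum_Iic_two_zpow_le _).trans (le_of_eq ?_)
  push_cast
  ring

/-! ### Fourier coefficients of derivatives -/

/-- A smooth step from `0` on `]-∞, -2π]` to `1` on `[0, ∞[`. -/
def step (z : ℝ) : ℝ := Real.smoothTransition (1 + z / (2 * Real.pi))

lemma step_contDiff : ContDiff ℝ ∞ step := Real.smoothTransition.contDiff.comp (by fun_prop)

/-- The partition of unity telescopes. Hence the derivative of `cutoff` is a compactly supported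
function minus its translate by one period, and a periodic distribution does not see such a
difference. -/
lemma cutoff_eq_sub (z : ℝ) : cutoff z = step z - step (z - 2 * Real.pi) := by
  have hπ : 0 < 2 * Real.pi := by positivity
  have e : 1 + (z - 2 * Real.pi) / (2 * Real.pi) = z / (2 * Real.pi) := by field_simp; ring
  unfold cutoff step
  rw [e]
  set t := z / (2 * Real.pi)
  rcases le_total t 0 with h | h
  · rw [Real.smoothTransition.one_of_one_le (x := 1 - t) (by linarith),
      Real.smoothTransition.zero_of_nonpos h]
    ring
  · rw [Real.smoothTransition.one_of_one_le (x := 1 + t) (by linarith)]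
    unfold Real.smoothTransition
    have hd := Real.smoothTransition.pos_denom t
    have e3 : 1 - (1 - t) = t := by ring
    rw [e3, add_comm (expNegInvGlue (1 - t))]
    field_simp
    ring

lemma deriv_step_eq_zero {z : ℝ} (hz : z ∉ Set.Icc (-(2 * Real.pi)) 0) : deriv step z = 0 := by
  have hπ : 0 < 2 * Real.pi := by positivity
  rw [Set.mem_Icc, not_and_or, not_le, not_le] at hz
  have hconst : ∃ c, step =ᶠ[nhds z] fun _ => c := by
    rcases hz with h | h
    · refine ⟨0, ?_⟩
      filter_upwards [Iio_mem_nhds h] with y hy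
      refine Real.smoothTransition.zero_of_nonpos ?_
      have : y / (2 * Real.pi) ≤ -1 := by
        rw [div_le_iff₀ hπ]; simp only [Set.mem_Iio] at hy; linarith
      linarith
    · refine ⟨1, ?_⟩
      filter_upwards [Ioi_mem_nhds h] with y hy
      refine Real.smoothTransition.one_of_one_le ?_
      have : 0 ≤ y / (2 * Real.pi) := div_nonneg (le_of_lt hy) hπ.le
      linarith
  obtain ⟨c, hc⟩ := hconst
  rw [hc.deriv_eq, deriv_const]

lemma stepMode_hasCompactSupport (n : ℤ) : HasCompactSupport
    (fun z : ℝ => ((deriv step z : ℝ) : ℂ) * Complex.exp (-(Complex.I * n * z))) :=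
  HasCompactSupport.intro (isCompact_Icc (a := -(2 * Real.pi)) (b := 0)) fun z hz => by
    simp [deriv_step_eq_zero hz]

lemma stepMode_contDiff (n : ℤ) : ContDiff ℝ ∞
    (fun z : ℝ => ((deriv step z : ℝ) : ℂ) * Complex.exp (-(Complex.I * n * z))) := by
  have h1 : ContDiff ℝ ∞ (fun z : ℝ => (z : ℂ)) := Complex.ofRealCLM.contDiff
  have h2 : ContDiff ℝ ∞ (deriv step) := (contDiff_infty_iff_deriv.1 step_contDiff).2
  exact (h1.comp h2).mul (Complex.contDiff_exp.comp (contDiff_const.mul h1).neg)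

/-- The test function `z ↦ step'(z) exp(-inz)`. -/
def stepMode (n : ℤ) : 𝓢(ℝ, ℂ) :=
  (stepMode_hasCompactSupport n).toSchwartzMap (stepMode_contDiff n)

lemma stepMode_apply (n : ℤ) (z : ℝ) :
    stepMode n z = ((deriv step z : ℝ) : ℂ) * Complex.exp (-(Complex.I * n * z)) := rfl

lemma deriv_mode (n : ℤ) (z : ℝ) : deriv (mode n) z =
    -(Complex.I * n) * mode n z + (stepMode n z - stepMode n (z - 2 * Real.pi)) := by
  have hs : ∀ y, HasDerivAt step (deriv step y) y := fun y =>
    ((step_contDiff.differentiable (by simp)) y).hasDerivAt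
  have hc : HasDerivAt cutoff (deriv step z - deriv step (z - 2 * Real.pi)) z := by
    have h1 := (hs z).sub ((hs (z - 2 * Real.pi)).comp_sub_const z (2 * Real.pi))
    exact h1.congr_of_eventuallyEq (Filter.Eventually.of_forall cutoff_eq_sub)
  have he : HasDerivAt (fun z : ℝ => Complex.exp (-(Complex.I * n * z)))
      (Complex.exp (-(Complex.I * n * z)) * -(Complex.I * n * 1)) z :=
    (((Complex.ofRealCLM.hasDerivAt (x := z)).const_mul (Complex.I * n)).neg).cexp
  have h : HasDerivAt (mode n) (((deriv step z - deriv step (z - 2 * Real.pi) : ℝ) : ℂ) *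
      Complex.exp (-(Complex.I * n * z)) +
        cutoff z * (Complex.exp (-(Complex.I * n * z)) * -(Complex.I * n * 1))) z :=
    hc.ofReal_comp.mul he
  have hper : Complex.exp (-(Complex.I * n * ((z - 2 * Real.pi : ℝ) : ℂ))) =
      Complex.exp (-(Complex.I * n * z)) := by
    rw [Complex.exp_eq_exp_iff_exists_int]
    exact ⟨n, by push_cast; ring⟩
  rw [h.deriv, stepMode_apply, stepMode_apply, hper, mode_apply]
  push_cast
  ring

lemma fderiv_tensor (η : 𝓢(ℝ, ℂ)) (ψ : 𝓢(R2, ℂ)) (p e : R3) :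
    fderiv ℝ (tensor η ψ) p e = ψ (horiz p) * (vert e * deriv η (vert p)) +
      η (vert p) * fderiv ℝ ψ (horiz p) (horiz e) := by
  have h1 : HasFDerivAt (fun p => ψ (horiz p)) (fderiv ℝ ψ (horiz p) ∘L horiz) p :=
    (ψ.hasFDerivAt (horiz p)).comp p horiz.hasFDerivAt
  have h2 : HasFDerivAt (fun p => η (vert p)) (fderiv ℝ η (vert p) ∘L vert) p :=
    (η.hasFDerivAt (vert p)).comp p vert.hasFDerivAt
  have h3 : HasFDerivAt (tensor η ψ) (ψ (horiz p) • (fderiv ℝ η (vert p) ∘L vert) +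
      η (vert p) • (fderiv ℝ ψ (horiz p) ∘L horiz)) p := h1.mul h2
  rw [h3.fderiv]
  have e1 : fderiv ℝ η (vert p) (vert e) = vert e * deriv η (vert p) := by
    rw [fderiv_eq_smul_deriv]; simp
  simp only [add_apply, smul_apply, ContinuousLinearMap.comp_apply, smul_eq_mul, e1]

lemma lineDeriv_tensor_horizontal (η : 𝓢(ℝ, ℂ)) (ψ : 𝓢(R2, ℂ)) (b : Fin 2) :
    ∂_{(EuclideanSpace.single (hIdx b) (1 : ℝ) : R3)} (tensor η ψ) =
      tensor η (∂_{(EuclideanSpace.single b (1 : ℝ) : R2)} ψ) := by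
  ext p
  have e1 : vert (EuclideanSpace.single (hIdx b) (1 : ℝ) : R3) = 0 := by
    fin_cases b <;> simp
  have e2 : horiz (EuclideanSpace.single (hIdx b) (1 : ℝ) : R3) = EuclideanSpace.single b 1 := by
    ext i
    fin_cases b <;> fin_cases i <;> simp
  rw [SchwartzMap.lineDerivOp_apply_eq_fderiv, fderiv_tensor, e1, e2, tensor_apply,
    SchwartzMap.lineDerivOp_apply_eq_fderiv]
  simp [mul_comm]

lemma lineDeriv_tensor_vertical (n : ℤ) (ψ : 𝓢(R2, ℂ)) :
    ∂_{(EuclideanSpace.single (2 : Fin 3) (1 : ℝ) : R3)} (tensor (mode n) ψ) =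
      (-(Complex.I * n)) • tensor (mode n) ψ + (tensor (stepMode n) ψ -
        (tensor (stepMode n) ψ).compSubConstCLM ℂ period) := by
  ext p
  have e1 : vert (EuclideanSpace.single (2 : Fin 3) (1 : ℝ) : R3) = 1 := by simp
  have e2 : horiz (EuclideanSpace.single (2 : Fin 3) (1 : ℝ) : R3) = 0 := by
    ext i
    fin_cases i <;> simp
  have e3 : horiz (p - period) = horiz p := by
    ext i
    fin_cases i <;> simp [period]
  have e4 : vert (p - period) = vert p - 2 * Real.pi := by simp [period]
  rw [SchwartzMap.lineDerivOp_apply_eq_fderiv, fderiv_tensor, e1, e2, deriv_mode, add_apply,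
    sub_apply, smul_apply, SchwartzMap.compSubConstCLM_apply, tensor_apply, tensor_apply,
    tensor_apply, e3, e4]
  simp only [map_zero, mul_zero, add_zero, Complex.ofReal_one, smul_eq_mul]
  ring

/-- The symbol of `∂ₖ` acting on the `n`-th Fourier coefficient. -/
def coeffSymbol (n : ℤ) : Fin 3 → R2 → ℂ :=
  ![fun ξ => 2 * Real.pi * Complex.I * ((ξ 0 : ℝ) : ℂ),
    fun ξ => 2 * Real.pi * Complex.I * ((ξ 1 : ℝ) : ℂ), fun _ => Complex.I * n]

lemma coeffSymbol_horizontal (n : ℤ) (b : Fin 2) :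
    coeffSymbol n (hIdx b) = fun ξ => 2 * Real.pi * Complex.I * ((ξ b : ℝ) : ℂ) := by
  fin_cases b <;> rfl

lemma coeffSymbol_hasTemperateGrowth (n : ℤ) (k : Fin 3) :
    (coeffSymbol n k).HasTemperateGrowth := by
  fin_cases k
  · exact (Function.HasTemperateGrowth.const _).mul (coord2_hasTemperateGrowth 0)
  · exact (Function.HasTemperateGrowth.const _).mul (coord2_hasTemperateGrowth 1)
  · exact .const _

lemma fourierCoeff_pd_horizontal (n : ℤ) (b : Fin 2) (u : 𝓢'(R3, ℂ)) :
    fourierCoeff n (pd (hIdx b) u) = mult (coeffSymbol n (hIdx b)) (fourierCoeff n u) := by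
  have h1 : fourierCoeff n (pd (hIdx b) u) =
      ∂_{(EuclideanSpace.single b (1 : ℝ) : R2)} (fourierCoeff n u) := by
    ext ψ
    rw [fourierCoeff_apply, pd, TemperedDistribution.lineDerivOp_apply_apply,
      TemperedDistribution.lineDerivOp_apply_apply, fourierCoeff_apply,
      lineDeriv_tensor_horizontal, map_neg, map_neg, map_neg]
  have e : (fun ξ : R2 => ((inner ℝ ξ (EuclideanSpace.single b (1 : ℝ)) : ℝ) : ℂ)) =
      fun ξ => ((ξ b : ℝ) : ℂ) := by
    ext ξ; simp [EuclideanSpace.inner_single_right]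
  have e' := mult_const_mul (coord2_hasTemperateGrowth b) (2 * Real.pi * Complex.I)
    (fourierCoeff n u)
  rw [h1, TemperedDistribution.lineDeriv_eq_fourierMultiplierCLM, coeffSymbol_horizontal, e', ← e]

/-- Integration by parts over a period: the derivative of `mode n` is `-in` times itself plus a
difference of translates, and periodicity of `u` annihilates that difference, which plays the role
of the boundary terms. -/
lemma fourierCoeff_pd_vertical {u : 𝓢'(R3, ℂ)} (hu : IsPeriodic u) (n : ℤ) :
    fourierCoeff n (pd 2 u) = mult (coeffSymbol n 2) (fourierCoeff n u) := by
  have e : mult (coeffSymbol n 2) (fourierCoeff n u) = (Complex.I * n) • fourierCoeff n u := by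
    have := mult_const_mul (E := R2) (.const 1) (Complex.I * n) (fourierCoeff n u)
    rw [mult_one] at this
    rw [← this]
    simp only [mul_one]
    rfl
  ext ψ
  have h2 : ((Complex.I * n) • fourierCoeff n u) ψ = (Complex.I * n) * fourierCoeff n u ψ := rfl
  have h3 : u ((tensor (stepMode n) ψ).compSubConstCLM ℂ period) = u (tensor (stepMode n) ψ) :=
    hu _
  rw [e, h2, fourierCoeff_apply, fourierCoeff_apply, pd,
    TemperedDistribution.lineDerivOp_apply_apply, lineDeriv_tensor_vertical, map_neg, map_add,
    map_smul, map_sub, h3, smul_eq_mul]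
  ring

lemma fourierCoeff_pd {u : 𝓢'(R3, ℂ)} (hu : IsPeriodic u) (n : ℤ) (k : Fin 3) :
    fourierCoeff n (pd k u) = mult (coeffSymbol n k) (fourierCoeff n u) := by
  fin_cases k
  · exact fourierCoeff_pd_horizontal n 0 u
  · exact fourierCoeff_pd_horizontal n 1 u
  · exact fourierCoeff_pd_vertical hu n

/-- `fourierCoeff` as an additive map. -/
def fourierCoeffHom (n : ℤ) : 𝓢'(R3, ℂ) →+ 𝓢'(R2, ℂ) where
  toFun := fourierCoeff n
  map_zero' := by ext ψ; exact mul_zero _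
  map_add' u v := by ext ψ; exact mul_add _ _ _

lemma fourierCoeff_laplace_eq {w : 𝓢'(R3, ℂ)} {G : Fin 3 → 𝓢'(R3, ℂ)} (hwp : IsPeriodic w)
    (hG : ∀ k, IsPeriodic (G k)) (hw : -∑ k, pd k (pd k w) = ∑ k, pd k (G k)) (n : ℤ) :
    -∑ k, mult (coeffSymbol n k) (mult (coeffSymbol n k) (fourierCoeff n w)) =
      ∑ k, mult (coeffSymbol n k) (fourierCoeff n (G k)) := by
  have h := congrArg (fourierCoeffHom n) hw
  rw [map_neg, map_sum, map_sum] at h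
  have e1 : ∀ k, fourierCoeffHom n (pd k (pd k w)) =
      mult (coeffSymbol n k) (mult (coeffSymbol n k) (fourierCoeff n w)) := fun k =>
    (fourierCoeff_pd (hwp.pd k) n k).trans (congrArg _ (fourierCoeff_pd hwp n k))
  have e2 : ∀ k, fourierCoeffHom n (pd k (G k)) = mult (coeffSymbol n k) (fourierCoeff n (G k)) :=
    fun k => fourierCoeff_pd (hG k) n k
  simpa only [e1, e2] using h

/-! ### Elliptic estimates for the Fourier coefficients -/

/-- The resolvent symbols of vertical order at most `2` are bounded on `L^∞(ℝ²)`. -/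
theorem exists_resolvent2_bound_of_le_two (g : 𝓢(R2, ℂ)) {l : R2 → ℝ} (hl : ContDiff ℝ ∞ l)
    (hl' : HasCompactSupport l) {ε : ℕ} (hε : ε ≤ 2) : ∃ A : ℝ≥0, A ≠ 0 ∧ ∀ r t : ℝ, 0 < r →
      ∀ W : 𝓢'(R2, ℂ),
        distNorm ∞ Set.univ (mult (resolvent2 g l ε r t) W) ≤ A * distNorm ∞ Set.univ W := by
  rcases Nat.lt_or_ge ε 2 with h | h
  · exact exists_resolvent2_bound g hl hl' (by omega)
  obtain rfl : ε = 2 := le_antisymm hε h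
  have hρ : (fun η : R2 => ((Real.exp (l η) ^ 2 : ℝ) : ℂ)).HasTemperateGrowth := by
    have h1 : (fun η : R2 => ((Real.exp (l η) : ℝ) : ℂ)).HasTemperateGrowth :=
      Complex.ofRealCLM.hasTemperateGrowth.comp (hasTemperateGrowth_exp hl hl')
    refine (congrArg Function.HasTemperateGrowth (funext fun η => ?_)).mp (h1.mul h1)
    simp [sq]
  -- From `t² / (ρ² + t²) = 1 - ρ² / (ρ² + t²)`: a dilated Schwartz symbol minus a resolvent with `ε
  -- = 0` and amplitude `g' = ρ² g`.
  set g' : 𝓢(R2, ℂ) := SchwartzMap.smulLeftCLM ℂ (fun η : R2 => ((Real.exp (l η) ^ 2 : ℝ) : ℂ)) g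
  obtain ⟨A, hA0, hA⟩ := exists_resolvent2_bound g' hl hl' zero_le_one
  obtain ⟨B, hB0, hB⟩ := exists_dilation_bound g
  refine ⟨B + A, by simp [hA0], fun r t hr W => ?_⟩
  have hm := resolvent2_hasTemperateGrowth g' hl hl' 0 r t
  have hd := dilation_hasTemperateGrowth g r
  have hm2 := resolvent2_hasTemperateGrowth g hl hl' 2 r t
  have e : mult (resolvent2 g l 2 r t) W =
      mult (fun ξ => g (r • ξ)) W - mult (resolvent2 g' l 0 r t) W := by
    have h0 := mult_sum (s := Finset.univ) (m := ![resolvent2 g l 2 r t, resolvent2 g' l 0 r t]) (by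
      intro i _
      fin_cases i
      · exact hm2
      · exact hm) W
    simp only [Fin.sum_univ_two, Matrix.cons_val_zero, Matrix.cons_val_one] at h0
    rw [eq_sub_iff_add_eq, ← h0]
    congr 2
    ext ξ
    have hD : (((Real.exp (l (r • ξ))) ^ 2 + t ^ 2 : ℝ) : ℂ) ≠ 0 := by
      exact_mod_cast (by positivity : (0 : ℝ) < (Real.exp (l (r • ξ))) ^ 2 + t ^ 2).ne'
    simp only [resolvent2, g', SchwartzMap.smulLeftCLM_apply_apply hρ, smul_eq_mul, pow_zero,
      mul_one]
    rw [← add_mul, ← div_eq_mul_inv, div_eq_iff hD]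
    push_cast
    ring
  rw [e]
  refine (distNorm_sub_le _ _ le_top _).trans ((add_le_add (hB r hr W) (hA r t hr W)).trans ?_)
  rw [ENNReal.coe_add, add_mul]

/-- With `t = r n / (2π)` the vertical symbol `i n` equals `(2πi / r) t`, so all three derivatives
cost the same factor. -/
lemma resolvent2_mul_coeffSymbol (g : 𝓢(R2, ℂ)) (l : R2 → ℝ) {r : ℝ} (hr : 0 < r) (n : ℤ)
    (k : Fin 3) (ξ : R2) : resolvent2 g l 0 r (r * n / (2 * Real.pi)) ξ * coeffSymbol n k ξ =
      (2 * Real.pi * Complex.I * (r : ℂ)⁻¹) *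
        resolvent2 (derivAmplitude g k) l (derivExponent k) r (r * n / (2 * Real.pi)) ξ := by
  have hr' : (r : ℂ) ≠ 0 := by exact_mod_cast hr.ne'
  have hπ : (Real.pi : ℂ) ≠ 0 := by exact_mod_cast Real.pi_ne_zero
  fin_cases k
  · simp [resolvent2, coeffSymbol, derivAmplitude, derivExponent, coordSchwartz_apply]
    field_simp
  · simp [resolvent2, coeffSymbol, derivAmplitude, derivExponent, coordSchwartz_apply]
    field_simp
  · simp [resolvent2, coeffSymbol, derivAmplitude, derivExponent]
    field_simp

/-- For `n ≠ 0` one more power of `t` in the numerator is bought with `t⁻¹ = 2π / (r n)`. This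
yields `r⁻²` instead of `r⁻¹`, which is better for large `r`, that is, at low horizontal frequency.
-/
lemma resolvent2_mul_coeffSymbol' (g : 𝓢(R2, ℂ)) (l : R2 → ℝ) {r : ℝ} (hr : 0 < r) {n : ℤ}
    (hn : n ≠ 0) (k : Fin 3) (ξ : R2) :
    resolvent2 g l 0 r (r * n / (2 * Real.pi)) ξ * coeffSymbol n k ξ =
      ((2 * Real.pi) ^ 2 * Complex.I * (n * (r : ℂ) ^ 2)⁻¹) *
        resolvent2 (derivAmplitude g k) l (derivExponent k + 1) r (r * n / (2 * Real.pi)) ξ := by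
  have hr' : (r : ℂ) ≠ 0 := by exact_mod_cast hr.ne'
  have hn' : (n : ℂ) ≠ 0 := by exact_mod_cast hn
  have hπ : (Real.pi : ℂ) ≠ 0 := by exact_mod_cast Real.pi_ne_zero
  rw [resolvent2_mul_coeffSymbol g l hr, resolvent2, resolvent2, pow_succ _ (derivExponent k)]
  generalize (((Real.exp (l (r • ξ))) ^ 2 + (r * n / (2 * Real.pi)) ^ 2 : ℝ) : ℂ)⁻¹ = D
  generalize ((r * n / (2 * Real.pi) : ℝ) : ℂ) ^ derivExponent k = T
  push_cast
  field_simp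

theorem exists_resolvent2_deriv_bound (g : 𝓢(R2, ℂ)) {l : R2 → ℝ} (hl : ContDiff ℝ ∞ l)
    (hl' : HasCompactSupport l) : ∃ A : ℝ≥0, A ≠ 0 ∧ ∀ (r : ℝ) (n : ℤ), 0 < r → ∀ (k : Fin 3)
      (W : 𝓢'(R2, ℂ)),
        distNorm ∞ Set.univ (mult (fun ξ => resolvent2 g l 0 r (r * n / (2 * Real.pi)) ξ *
          coeffSymbol n k ξ) W) ≤ A * ENNReal.ofReal r⁻¹ * distNorm ∞ Set.univ W ∧
        (n ≠ 0 → distNorm ∞ Set.univ (mult (fun ξ => resolvent2 g l 0 r (r * n / (2 * Real.pi)) ξ *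
          coeffSymbol n k ξ) W) ≤ A * ENNReal.ofReal (r ^ 2)⁻¹ * distNorm ∞ Set.univ W) := by
  choose A hA0 hA using fun k =>
    exists_resolvent2_bound (derivAmplitude g k) hl hl' (derivExponent_le k)
  choose B hB0 hB using fun k => exists_resolvent2_bound_of_le_two (derivAmplitude g k) hl hl'
    (Nat.succ_le_succ (derivExponent_le k))
  have hAk : ∀ k, A k ≤ ∑ j, A j := fun k =>
    Finset.single_le_sum (f := A) (fun _ _ => zero_le) (Finset.mem_univ k)
  have hBk : ∀ k, B k ≤ ∑ j, B j := fun k =>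
    Finset.single_le_sum (f := B) (fun _ _ => zero_le) (Finset.mem_univ k)
  have hπ0 : 2 * NNReal.pi ≠ 0 := mul_ne_zero two_ne_zero NNReal.pi_ne_zero
  refine ⟨2 * NNReal.pi * ∑ k, A k + (2 * NNReal.pi) ^ 2 * ∑ k, B k, ?_, fun r n hr k W => ⟨?_, ?_⟩⟩
  · have : 0 < ∑ k, A k := (pos_iff_ne_zero.2 (hA0 0)).trans_le (hAk 0)
    exact ne_of_gt (add_pos_of_pos_of_nonneg (mul_pos (pos_iff_ne_zero.2 hπ0) this) zero_le)
  · have hc : 2 * Real.pi * Complex.I * (r : ℂ)⁻¹ ≠ 0 := by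
      simp [Real.pi_ne_zero, hr.ne']
    simp_rw [resolvent2_mul_coeffSymbol g l hr n k]
    refine (distNorm_mult_const_mul_le (resolvent2_hasTemperateGrowth _ hl hl' _ r _) hc _ _).trans ?_
    rw [enorm_two_pi_I_mul_inv hr]
    refine (mul_le_mul_right (hA k r _ hr W) _).trans ?_
    have : ((2 * NNReal.pi : ℝ≥0) : ℝ≥0∞) * A k ≤
        ((2 * NNReal.pi * ∑ k, A k + (2 * NNReal.pi) ^ 2 * ∑ k, B k : ℝ≥0) : ℝ≥0∞) := by
      rw [← ENNReal.coe_mul, ENNReal.coe_le_coe]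
      exact (mul_le_mul_right (hAk k) _).trans le_self_add
    calc _ = ((2 * NNReal.pi : ℝ≥0) : ℝ≥0∞) * A k * ENNReal.ofReal r⁻¹ * distNorm ∞ Set.univ W := by
          ring
      _ ≤ _ := by gcongr
  · intro hn
    have hn' : (n : ℂ) ≠ 0 := by exact_mod_cast hn
    have hc : (2 * Real.pi) ^ 2 * Complex.I * (n * (r : ℂ) ^ 2)⁻¹ ≠ 0 := by
      simp [Real.pi_ne_zero, hr.ne', hn]
    have hcle : ‖(2 * Real.pi) ^ 2 * Complex.I * (n * (r : ℂ) ^ 2)⁻¹‖ₑ ≤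
        ((2 * NNReal.pi) ^ 2 : ℝ≥0) * ENNReal.ofReal (r ^ 2)⁻¹ := by
      have h1 : (((2 * NNReal.pi) ^ 2 : ℝ≥0) : ℝ≥0∞) = ENNReal.ofReal ((2 * Real.pi) ^ 2) := by
        rw [← NNReal.coe_real_pi, ← ENNReal.ofReal_coe_nnreal]
        push_cast
        rfl
      rw [h1, ← ENNReal.ofReal_mul (by positivity), ← ofReal_norm]
      refine ENNReal.ofReal_le_ofReal ?_
      simp only [norm_mul, norm_pow, Complex.norm_I, norm_inv, mul_one, Complex.norm_real,
        Complex.norm_ofNat, Real.norm_of_nonneg Real.pi_pos.le, Real.norm_of_nonneg hr.le]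
      refine mul_le_mul_of_nonneg_left (inv_anti₀ (by positivity) ?_) (by positivity)
      refine le_mul_of_one_le_left (by positivity) ?_
      rw [Complex.norm_intCast]
      exact_mod_cast Int.one_le_abs hn
    simp_rw [resolvent2_mul_coeffSymbol' g l hr hn k]
    refine (distNorm_mult_const_mul_le (resolvent2_hasTemperateGrowth _ hl hl' _ r _) hc _ _).trans ?_
    refine (mul_le_mul' hcle (hB k r _ hr W)).trans ?_
    have : (((2 * NNReal.pi) ^ 2 : ℝ≥0) : ℝ≥0∞) * B k ≤
        ((2 * NNReal.pi * ∑ k, A k + (2 * NNReal.pi) ^ 2 * ∑ k, B k : ℝ≥0) : ℝ≥0∞) := by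
      rw [← ENNReal.coe_mul, ENNReal.coe_le_coe]
      exact (mul_le_mul_right (hBk k) _).trans le_add_self
    calc _ = (((2 * NNReal.pi) ^ 2 : ℝ≥0) : ℝ≥0∞) * B k * ENNReal.ofReal (r ^ 2)⁻¹ *
          distNorm ∞ Set.univ W := by ring
      _ ≤ _ := by gcongr

/-- The Fourier coefficients solve the same equation with `∂₂` replaced by `i n`; the argument of
`exists_block3_pd_bound` applies on the plane, uniformly in `n`. -/
theorem exists_block2_pd_bound {φ : 𝓢(R2, ℂ)} (hφ : IsDyadicPartition φ) :
    ∃ A : ℝ≥0, ∀ (q n : ℤ) (w : 𝓢'(R2, ℂ)) (G : Fin 3 → 𝓢'(R2, ℂ)),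
      (-∑ k, mult (coeffSymbol n k) (mult (coeffSymbol n k) w) =
        ∑ k, mult (coeffSymbol n k) (G k)) → ∀ b : Fin 2,
      distNorm ∞ Set.univ (block2 φ q (mult (coeffSymbol n (hIdx b)) w)) ≤
        A * ∑ k, distNorm ∞ Set.univ (block2 φ q (G k)) := by
  obtain ⟨χ, hχ⟩ := exists_cutoff
  obtain ⟨l, hl, hl', hle⟩ := exists_log_cutoff
  choose A hA0 hA using fun b => exists_resolvent2_deriv_bound (coordSchwartz b χ) hl hl'
  have hAk : ∀ k, A k ≤ ∑ j, A j := fun k =>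
    Finset.single_le_sum (f := A) (fun _ _ => zero_le) (Finset.mem_univ k)
  refine ⟨∑ k, A k, fun q n w G hw b => ?_⟩
  set r : ℝ := (2 : ℝ) ^ (-q) * (2 * Real.pi) with hr_def
  have hr : 0 < r := dyadic_scale_pos q
  have hr' : (r : ℂ) ≠ 0 := by exact_mod_cast hr.ne'
  have hπ : (Real.pi : ℂ) ≠ 0 := by exact_mod_cast Real.pi_ne_zero
  set c : ℂ := Complex.I * (r / (2 * Real.pi) : ℝ) with hc_def
  have hc : c ≠ 0 := by
    simp [hc_def, Complex.I_ne_zero, hr.ne', Real.pi_ne_zero]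
  have hm := resolvent2_hasTemperateGrowth (coordSchwartz b χ) hl hl' 0 r (r * n / (2 * Real.pi))
  have key := mult_elliptic (σ := coeffSymbol n) (Φ := fun ξ => φ (r • ξ))
    (Q := fun ξ => c * resolvent2 (coordSchwartz b χ) l 0 r (r * n / (2 * Real.pi)) ξ)
    (s := coeffSymbol n (hIdx b))
    (coeffSymbol_hasTemperateGrowth n) (symbol2_hasTemperateGrowth φ q)
    ((Function.HasTemperateGrowth.const c).mul hm) (coeffSymbol_hasTemperateGrowth n _) ?_ hw
  · change distNorm ∞ Set.univ (mult (fun ξ => φ (r • ξ)) _) ≤ _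
    rw [key]
    refine (distNorm_sum_three_le _ le_top _).trans ?_
    rw [Finset.mul_sum]
    refine Finset.sum_le_sum fun k _ => ?_
    have h1 := (hA b r n hr k (mult (fun ξ => φ (r • ξ)) (G k))).1
    simp_rw [mul_assoc c]
    refine (distNorm_mult_const_mul_le (hm.mul (coeffSymbol_hasTemperateGrowth n k)) hc _ _).trans ?_
    refine (mul_le_mul_right h1 _).trans ?_
    rw [← mul_assoc, ← mul_assoc]
    refine mul_le_mul_left ?_ _
    have e : ‖c‖ₑ * ENNReal.ofReal r⁻¹ ≤ 1 := by
      rw [← ofReal_norm, ← ENNReal.ofReal_mul (norm_nonneg _), ENNReal.ofReal_le_one, hc_def,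
        norm_mul, Complex.norm_I, one_mul, Complex.norm_real, Real.norm_of_nonneg (by positivity)]
      rw [div_mul_eq_mul_div, mul_inv_cancel₀ hr.ne', div_le_one (by positivity)]
      linarith [Real.pi_gt_three]
    calc _ = A b * (‖c‖ₑ * ENNReal.ofReal r⁻¹) := by ring
      _ ≤ ((∑ k, A k : ℝ≥0) : ℝ≥0∞) * 1 := by
        gcongr
        exact hAk b
      _ = _ := mul_one _
  · intro ξ
    have h := symbol_inversion hφ hχ hle (r • ξ) (r * n / (2 * Real.pi))
    simp only [resolvent2, coordSchwartz_apply, coeffSymbol_horizontal, Fin.sum_univ_three,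
      pow_zero, mul_one]
    simp only [coeffSymbol, Matrix.cons_val_zero, Matrix.cons_val_one, Matrix.cons_val_two,
      Matrix.tail_cons, Matrix.head_cons]
    generalize (((Real.exp (l (r • ξ))) ^ 2 + (r * n / (2 * Real.pi)) ^ 2 : ℝ) : ℂ)⁻¹ = D at h ⊢
    have hc2 : c * (2 * Real.pi * Complex.I) ^ 2 = -(2 * Real.pi * Complex.I) * r := by
      rw [hc_def]
      push_cast
      field_simp
      linear_combination Complex.I_sq
    have ht : ((r * n / (2 * Real.pi) : ℝ) : ℂ) ^ 2 * (2 * Real.pi * Complex.I) ^ 2 =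
        (r : ℂ) ^ 2 * (Complex.I * n) ^ 2 := by
      push_cast
      field_simp
    have hc3 : c * (Complex.I * n) ^ 2 * r =
        -(2 * Real.pi * Complex.I) * ((r * n / (2 * Real.pi) : ℝ) : ℂ) ^ 2 := by
      have hr2 : (r : ℂ) ≠ 0 := hr'
      refine mul_left_cancel₀ hr2 ?_
      linear_combination -c * ht + ((r * n / (2 * Real.pi) : ℝ) : ℂ) ^ 2 * hc2
    generalize ((r * n / (2 * Real.pi) : ℝ) : ℂ) = t at h hc3
    simp only [PiLp.smul_apply, smul_eq_mul, Complex.ofReal_mul] at h ⊢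
    linear_combination (2 * Real.pi * Complex.I * ξ b) * h + r * ξ b *
      χ (r • ξ) * D * φ (r • ξ) * ((ξ 0 : ℂ) ^ 2 + (ξ 1 : ℂ) ^ 2) * hc2 +
      ξ b * χ (r • ξ) * D * φ (r • ξ) * hc3

/-- The inverse gains one derivative, which is a bounded gain as soon as the horizontal frequency is
bounded below (`0 ≤ q`) or the vertical frequency is nonzero. Only the low frequencies of the mean
over a period escape. -/
theorem exists_block2_bound {φ : 𝓢(R2, ℂ)} (hφ : IsDyadicPartition φ) :
    ∃ A : ℝ≥0, ∀ (q n : ℤ) (w : 𝓢'(R2, ℂ)) (G : Fin 3 → 𝓢'(R2, ℂ)), (0 ≤ q ∨ n ≠ 0) →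
      (-∑ k, mult (coeffSymbol n k) (mult (coeffSymbol n k) w) =
        ∑ k, mult (coeffSymbol n k) (G k)) →
      distNorm ∞ Set.univ (block2 φ q w) ≤ A * ∑ k, distNorm ∞ Set.univ (block2 φ q (G k)) := by
  obtain ⟨χ, hχ⟩ := exists_cutoff
  obtain ⟨l, hl, hl', hle⟩ := exists_log_cutoff
  obtain ⟨A, hA0, hA⟩ := exists_resolvent2_deriv_bound χ hl hl'
  refine ⟨A, fun q n w G hqn hw => ?_⟩
  set r : ℝ := (2 : ℝ) ^ (-q) * (2 * Real.pi) with hr_def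
  have hr : 0 < r := dyadic_scale_pos q
  have hr' : (r : ℂ) ≠ 0 := by exact_mod_cast hr.ne'
  have hπ : (Real.pi : ℂ) ≠ 0 := by exact_mod_cast Real.pi_ne_zero
  have hπ1 : 1 ≤ 2 * Real.pi := by linarith [Real.pi_gt_three]
  set c : ℂ := (((r / (2 * Real.pi)) ^ 2 : ℝ) : ℂ) with hc_def
  have hc : c ≠ 0 := by
    simp [hc_def, hr.ne', Real.pi_ne_zero]
  have hm := resolvent2_hasTemperateGrowth χ hl hl' 0 r (r * n / (2 * Real.pi))
  have key := mult_elliptic (σ := coeffSymbol n) (Φ := fun ξ => φ (r • ξ))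
    (Q := fun ξ => c * resolvent2 χ l 0 r (r * n / (2 * Real.pi)) ξ) (s := fun _ => 1)
    (coeffSymbol_hasTemperateGrowth n) (symbol2_hasTemperateGrowth φ q)
    ((Function.HasTemperateGrowth.const c).mul hm) (.const 1) ?_ hw
  · change distNorm ∞ Set.univ (mult (fun ξ => φ (r • ξ)) _) ≤ _
    rw [mult_one] at key
    rw [key]
    refine (distNorm_sum_three_le _ le_top _).trans ?_
    rw [Finset.mul_sum]
    refine Finset.sum_le_sum fun k _ => ?_
    set W := mult (fun ξ => φ (r • ξ)) (G k) with hW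
    have h1 : ‖c‖ₑ * distNorm ∞ Set.univ (mult (fun ξ =>
        resolvent2 χ l 0 r (r * n / (2 * Real.pi)) ξ * coeffSymbol n k ξ) W) ≤
        A * distNorm ∞ Set.univ W := by
      have hcn : ‖c‖ₑ = ENNReal.ofReal ((r / (2 * Real.pi)) ^ 2) := by
        rw [← ofReal_norm, hc_def, Complex.norm_real, Real.norm_of_nonneg (by positivity)]
      have aux : ∀ x : ℝ, (r / (2 * Real.pi)) ^ 2 * x ≤ 1 →
          ‖c‖ₑ * (A * ENNReal.ofReal x * distNorm ∞ Set.univ W) ≤ A * distNorm ∞ Set.univ W := by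
        intro x hx
        calc _ = ‖c‖ₑ * ENNReal.ofReal x * (A * distNorm ∞ Set.univ W) := by ring
          _ ≤ 1 * (A * distNorm ∞ Set.univ W) := by
            gcongr
            rw [hcn, ← ENNReal.ofReal_mul (by positivity)]
            exact ENNReal.ofReal_le_one.2 hx
          _ = _ := one_mul _
      rcases hqn with hq | hn
      -- Here `r ≤ 2π`, so the factor `c r⁻¹`, a multiple of `r`, is bounded.
      · refine (mul_le_mul_right (hA r n hr k W).1 _).trans (aux _ ?_)
        have hr2 : r ≤ 2 * Real.pi := mul_le_of_le_one_left (by positivity)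
          (zpow_le_one_of_nonpos₀ (by norm_num) (by omega))
        have : (r / (2 * Real.pi)) ^ 2 * r⁻¹ = r / (2 * Real.pi) * (2 * Real.pi)⁻¹ := by
          field_simp
        rw [this]
        exact mul_le_one₀ ((div_le_one (by positivity)).2 hr2) (by positivity)
          (inv_le_one_of_one_le₀ hπ1)
      -- Here `r` may be large; the bound with `r⁻²` cancels the `r²` in `c`.
      · refine (mul_le_mul_right ((hA r n hr k W).2 hn) _).trans (aux _ ?_)
        have : (r / (2 * Real.pi)) ^ 2 * (r ^ 2)⁻¹ = ((2 * Real.pi) ^ 2)⁻¹ := by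
          field_simp
        rw [this]
        exact inv_le_one_of_one_le₀ (one_le_pow₀ hπ1)
    simp_rw [mul_assoc c]
    exact (distNorm_mult_const_mul_le (hm.mul (coeffSymbol_hasTemperateGrowth n k)) hc _ _).trans h1
  · intro ξ
    have h := symbol_inversion hφ hχ hle (r • ξ) (r * n / (2 * Real.pi))
    simp only [resolvent2, Fin.sum_univ_three, pow_zero, mul_one]
    simp only [coeffSymbol, Matrix.cons_val_zero, Matrix.cons_val_one, Matrix.cons_val_two,
      Matrix.tail_cons, Matrix.head_cons]
    generalize (((Real.exp (l (r • ξ))) ^ 2 + (r * n / (2 * Real.pi)) ^ 2 : ℝ) : ℂ)⁻¹ = D at h ⊢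
    have hc2 : c * (2 * Real.pi * Complex.I) ^ 2 = -(r : ℂ) ^ 2 := by
      rw [hc_def]
      push_cast
      field_simp
      linear_combination Complex.I_sq
    have hc3 : c * (Complex.I * n) ^ 2 = -((r * n / (2 * Real.pi) : ℝ) : ℂ) ^ 2 := by
      rw [hc_def]
      push_cast
      linear_combination ((r : ℂ) / (2 * Real.pi)) ^ 2 * (n : ℂ) ^ 2 * Complex.I_sq
    generalize ((r * n / (2 * Real.pi) : ℝ) : ℂ) = t at h hc3
    simp only [PiLp.smul_apply, smul_eq_mul, Complex.ofReal_mul] at h ⊢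
    linear_combination h + χ (r • ξ) * D * φ (r • ξ) *
      ((ξ 0 : ℂ) ^ 2 + (ξ 1 : ℂ) ^ 2) * hc2 + χ (r • ξ) * D * φ (r • ξ) * hc3

/-! ### Besov estimates -/

theorem exists_besovNorm_pd_bound {φ : 𝓢(R2, ℂ)} (hφ : IsDyadicPartition φ) :
    ∃ A : ℝ≥0, ∀ (w : 𝓢'(R3, ℂ)) (G : Fin 3 → 𝓢'(R3, ℂ)), IsPeriodic w →
      (∀ k, IsPeriodic (G k)) → (-∑ k, pd k (pd k w) = ∑ k, pd k (G k)) → ∀ b : Fin 2,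
        besovNorm φ (pd (hIdx b) w) ≤ A * ∑ k, besovNorm φ (G k) := by
  obtain ⟨A, hA⟩ := exists_block2_pd_bound hφ
  refine ⟨A, fun w G hwp hG hw b => ?_⟩
  have h : ∀ n q, distNorm ∞ Set.univ (block2 φ q (fourierCoeff n (pd (hIdx b) w))) ≤
      A * ∑ k, distNorm ∞ Set.univ (block2 φ q (fourierCoeff n (G k))) := fun n q => by
    rw [fourierCoeff_pd_horizontal]
    exact hA q n _ _ (fourierCoeff_laplace_eq hwp hG hw n) b
  unfold besovNorm besovNorm2
  refine (ENNReal.tsum_le_tsum fun n => ENNReal.tsum_le_tsum fun q => h n q).trans (le_of_eq ?_)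
  simp only [ENNReal.tsum_mul_left, Fin.sum_univ_three, ENNReal.tsum_add]

/-- The equation controls every pair `(q, n)` except `q < 0`, `n = 0`. For these the `L²` norm of
`w` takes over through Bernstein's inequality. -/
theorem exists_besovNorm_bound {φ : 𝓢(R2, ℂ)} (hφ : IsDyadicPartition φ) :
    ∃ A : ℝ≥0, ∀ (w : 𝓢'(R3, ℂ)) (G : Fin 3 → 𝓢'(R3, ℂ)), IsPeriodic w →
      (∀ k, IsPeriodic (G k)) → (-∑ k, pd k (pd k w) = ∑ k, pd k (G k)) →
        besovNorm φ w ≤ A * (∑ k, besovNorm φ (G k) + distNorm 2 strip w) := by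
  obtain ⟨A, hA⟩ := exists_block2_bound hφ
  obtain ⟨B, -, hB⟩ := exists_dilation_fourierCoeff_bound φ 0
  refine ⟨A + B * 2, fun w G hwp hG hw => ?_⟩
  have h : ∀ n q, distNorm ∞ Set.univ (block2 φ q (fourierCoeff n w)) ≤
      A * ∑ k, distNorm ∞ Set.univ (block2 φ q (fourierCoeff n (G k))) +
        (if n = 0 then B * distNorm 2 strip w *
          (Set.Iic (-1 : ℤ)).indicator (fun q => ENNReal.ofReal ((2 : ℝ) ^ q)) q else 0) := by
    intro n q
    by_cases hqn : 0 ≤ q ∨ n ≠ 0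
    · exact (hA q n _ _ hqn (fourierCoeff_laplace_eq hwp hG hw n)).trans le_self_add
    -- Bernstein's factor is `r⁻¹ = 2^q / (2π) ≤ 2^q`, summable over `q ≤ -1`.
    · push Not at hqn
      obtain ⟨hq, rfl⟩ := hqn
      refine le_trans ?_ le_add_self
      rw [if_pos rfl, Set.indicator_of_mem (by simp only [Set.mem_Iic]; omega)]
      refine (hB _ (dyadic_scale_pos q) w hwp).trans ?_
      rw [mul_assoc, mul_assoc, mul_comm (distNorm _ _ _)]
      gcongr
      rw [mul_inv, zpow_neg, inv_inv]
      exact mul_le_of_le_one_right (by positivity)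
        (inv_le_one_of_one_le₀ (by linarith [Real.pi_gt_three]))
  have hlow : ∑' q : ℤ, (Set.Iic (-1 : ℤ)).indicator (fun q => ENNReal.ofReal ((2 : ℝ) ^ q)) q ≤ 2 := by
    rw [← tsum_subtype (Set.Iic (-1 : ℤ)) fun q => ENNReal.ofReal ((2 : ℝ) ^ q)]
    exact tsum_Iic_two_zpow_le
  have hite : ∀ n : ℤ, ∑' q : ℤ, (if n = 0 then B * distNorm 2 strip w *
        (Set.Iic (-1 : ℤ)).indicator (fun q => ENNReal.ofReal ((2 : ℝ) ^ q)) q else 0) ≤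
      if n = 0 then B * distNorm 2 strip w * 2 else 0 := by
    intro n
    split_ifs
    · rw [ENNReal.tsum_mul_left]
      gcongr
    · simp
  unfold besovNorm besovNorm2
  calc _ ≤ ∑' n : ℤ, (A * ∑ k, ∑' q, distNorm ∞ Set.univ (block2 φ q (fourierCoeff n (G k))) +
        if n = 0 then B * distNorm 2 strip w * 2 else 0) := by
        refine ENNReal.tsum_le_tsum fun n => (ENNReal.tsum_le_tsum (h n)).trans ?_
        rw [ENNReal.tsum_add]
        refine add_le_add (le_of_eq ?_) (hite n)
        simp only [ENNReal.tsum_mul_left, Fin.sum_univ_three, ENNReal.tsum_add]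
    _ = A * ∑ k, ∑' n, ∑' q, distNorm ∞ Set.univ (block2 φ q (fourierCoeff n (G k))) +
        B * distNorm 2 strip w * 2 := by
        rw [ENNReal.tsum_add, tsum_ite_eq]
        simp only [ENNReal.tsum_mul_left, Fin.sum_univ_three, ENNReal.tsum_add]
    _ ≤ _ := by
        push_cast
        rw [mul_add, add_mul, mul_right_comm (B : ℝ≥0∞)]
        exact add_le_add le_self_add (by rw [add_mul]; exact le_add_self)

/-! ### Subadditive gauges -/

lemma distNorm_zero {E : Type*} [NormedAddCommGroup E] [InnerProductSpace ℝ E]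
    [FiniteDimensional ℝ E] [MeasurableSpace E] [BorelSpace E] (p : ℝ≥0∞) (s : Set E) :
    distNorm p s (0 : 𝓢'(E, ℂ)) = 0 := by
  have h : IsRepresentedBy (0 : 𝓢'(E, ℂ)) (fun _ : E => (0 : ℂ)) := by
    refine ⟨aestronglyMeasurable_const, fun ψ => ⟨by simp, ?_⟩⟩
    simp only [mul_zero, integral_zero]
    rfl
  refine le_antisymm ((distNorm_le_of_isRepresentedBy h p s).trans ?_) zero_le
  simp

/-- An extended-real valued gauge that vanishes at `0` and is subadditive for subtraction. -/
structure IsGauge {M : Type*} [AddCommGroup M] (N : M → ℝ≥0∞) : Prop where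
  zero : N 0 = 0
  neg_le : ∀ u, N (-u) ≤ N u
  sub_le : ∀ u v, N (u - v) ≤ N u + N v

lemma isGauge_distNorm {E : Type*} [NormedAddCommGroup E] [InnerProductSpace ℝ E]
    [FiniteDimensional ℝ E] [MeasurableSpace E] [BorelSpace E] {p : ℝ≥0∞} (hp : 1 ≤ p)
    (s : Set E) : IsGauge fun u : 𝓢'(E, ℂ) => distNorm p s u where
  zero := distNorm_zero p s
  neg_le u := distNorm_neg_le u s
  sub_le u v := distNorm_sub_le u v hp s

lemma IsGauge.comp {M M' : Type*} [AddCommGroup M] [AddCommGroup M'] {N : M → ℝ≥0∞}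
    (h : IsGauge N) (f : M' →+ M) : IsGauge fun u => N (f u) where
  zero := by rw [map_zero, h.zero]
  neg_le u := by rw [map_neg]; exact h.neg_le _
  sub_le u v := by rw [map_sub]; exact h.sub_le _ _

lemma IsGauge.tsum {ι M : Type*} [AddCommGroup M] {N : ι → M → ℝ≥0∞}
    (h : ∀ i, IsGauge (N i)) : IsGauge fun u => ∑' i, N i u where
  zero := by simp [(h _).zero]
  neg_le u := ENNReal.tsum_le_tsum fun i => (h i).neg_le u
  sub_le u v := by
    rw [← ENNReal.tsum_add]
    exact ENNReal.tsum_le_tsum fun i => (h i).sub_le u v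

lemma isGauge_block3 (φ : 𝓢(R2, ℂ)) (j : ℤ) {p : ℝ≥0∞} (hp : 1 ≤ p) (s : Set R3) :
    IsGauge fun u : 𝓢'(R3, ℂ) => distNorm p s (block3 φ j u) :=
  (isGauge_distNorm hp s).comp (mult
    (fun ξ : R3 => φ (((2 : ℝ) ^ (-j) * (2 * Real.pi)) • horiz ξ))).toLinearMap.toAddMonoidHom

lemma isGauge_besovNorm (φ : 𝓢(R2, ℂ)) : IsGauge (besovNorm φ) :=
  IsGauge.tsum fun n => IsGauge.tsum fun q => (isGauge_distNorm le_top Set.univ).comp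
    ((mult (fun ξ : R2 => φ (((2 : ℝ) ^ (-q) * (2 * Real.pi)) • ξ))).toLinearMap.toAddMonoidHom.comp
      (fourierCoeffHom n))

lemma IsGauge.skew_le {M : Type*} [AddCommGroup M] {N : M → ℝ≥0∞} (h : IsGauge N) (Ω : Fin 3 → M)
    (i k : Fin 3) : N (skew Ω i k) ≤ ∑ j, N (Ω j) := by
  have h1 : ∀ j, N (Ω j) ≤ ∑ j, N (Ω j) := fun j =>
    Finset.single_le_sum (f := fun j => N (Ω j)) (fun _ _ => zero_le) (Finset.mem_univ j)
  have h2 : ∀ j, N (-Ω j) ≤ ∑ j, N (Ω j) := fun j => (h.neg_le _).trans (h1 j)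
  have h3 : N 0 ≤ ∑ j, N (Ω j) := h.zero.le.trans zero_le
  fin_cases i <;> fin_cases k <;> first | exact h3 | exact h1 _ | exact h2 _

lemma IsGauge.weightedPotential_le {N : 𝓢'(R3, ℂ) → ℝ≥0∞} (h : IsGauge N)
    (v : Fin 3 → 𝓢'(R3, ℂ)) (a i k : Fin 3) : N (weightedPotential v a i k) ≤
      ∑ j, N (coordMul a (curl v j)) + N (v i) + N (v a) := by
  refine (h.sub_le _ _).trans (add_le_add ((h.sub_le _ _).trans (add_le_add (h.skew_le _ i k) ?_)) ?_)
  all_goals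
    split_ifs
    · exact le_rfl
    · exact h.zero.le.trans zero_le

/-! ### Periodicity of the right-hand sides -/

lemma isPeriodic_zero : IsPeriodic 0 := fun _ => rfl

lemma isPeriodic_curl {v : Fin 3 → 𝓢'(R3, ℂ)} (hv : ∀ i, IsPeriodic (v i)) (i : Fin 3) :
    IsPeriodic (curl v i) := by
  fin_cases i
  · exact ((hv 2).pd 1).sub ((hv 1).pd 2)
  · exact ((hv 0).pd 2).sub ((hv 2).pd 0)
  · exact ((hv 1).pd 0).sub ((hv 0).pd 1)

lemma isPeriodic_skew {Ω : Fin 3 → 𝓢'(R3, ℂ)} (hΩ : ∀ i, IsPeriodic (Ω i)) (i k : Fin 3) :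
    IsPeriodic (skew Ω i k) := by
  have hneg : ∀ j, IsPeriodic (-Ω j) := fun j => by
    rw [← zero_sub]; exact isPeriodic_zero.sub (hΩ j)
  fin_cases i <;> fin_cases k <;>
    first | exact isPeriodic_zero | exact hΩ _ | exact hneg _

lemma isPeriodic_weightedPotential {v : Fin 3 → 𝓢'(R3, ℂ)} (hv : ∀ i, IsPeriodic (v i))
    (a : Fin 2) (i k : Fin 3) : IsPeriodic (weightedPotential v (hIdx a) i k) := by
  refine ((isPeriodic_skew (fun j => (isPeriodic_curl hv j).coordMul a) i k).sub ?_).sub ?_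
  all_goals
    split_ifs
    · exact hv _
    · exact isPeriodic_zero

lemma single_le_sum_univ {ι : Type*} [Fintype ι] (f : ι → ℝ≥0∞) (i : ι) : f i ≤ ∑ j, f j :=
  Finset.single_le_sum (f := f) (fun _ _ => zero_le) (Finset.mem_univ i)

/-! ### The three estimates -/

/-- The gradient bound for `x_a v` leaves `v` itself in the Besov norm, through the terms created by
the weight; `exists_besovNorm_bound` trades these for `Ω` and the `L²` norm. -/
theorem exists_besov_estimate {φ : 𝓢(R2, ℂ)} (hφ : IsDyadicPartition φ) :
    ∃ C : ℝ≥0, ∀ v : Fin 3 → 𝓢'(R3, ℂ), (∀ i, IsPeriodic (v i)) → divergence v = 0 →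
      ∑ a : Fin 2, ∑ b : Fin 2, ∑ i : Fin 3,
          besovNorm φ (pd (hIdx b) (coordMul (hIdx a) (v i)))
        ≤ C * (∑ i : Fin 3, distNorm 2 strip (v i)
          + ∑ a : Fin 2, ∑ i : Fin 3, besovNorm φ (coordMul (hIdx a) (curl v i))
          + ∑ i : Fin 3, besovNorm φ (curl v i)) := by
  obtain ⟨A, hA⟩ := exists_besovNorm_pd_bound hφ
  obtain ⟨B, hB⟩ := exists_besovNorm_bound hφ
  -- Twelve triples `(a, b, i)` times three potentials `k` give `36`; each potential contains two
  -- components of `v`, each costing `3B`.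
  refine ⟨36 * A * (1 + 6 * B), fun v hv hdiv => ?_⟩
  set Z := ∑ i : Fin 3, distNorm 2 strip (v i)
  set X := ∑ a : Fin 2, ∑ i : Fin 3, besovNorm φ (coordMul (hIdx a) (curl v i)) with hX
  set Y := ∑ i : Fin 3, besovNorm φ (curl v i)
  have hvi : ∀ i, besovNorm φ (v i) ≤ 3 * B * (Z + X + Y) := fun i => by
    refine (hB (v i) (skew (curl v) i) (hv i) (isPeriodic_skew (isPeriodic_curl hv) i)
      (neg_laplacian_eq hdiv i)).trans ?_
    have h1 : ∑ k, besovNorm φ (skew (curl v) i k) ≤ 3 * Y := by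
      refine (Finset.sum_le_sum fun k _ => (isGauge_besovNorm φ).skew_le (curl v) i k).trans ?_
      simp [Y]
    have h2 : distNorm 2 strip (v i) ≤ Z := single_le_sum_univ (fun i => distNorm 2 strip (v i)) i
    calc _ ≤ B * (3 * Y + Z) := by gcongr
      _ ≤ B * (3 * (Z + X + Y)) := by
        gcongr
        calc 3 * Y + Z ≤ 3 * Y + (3 * Z + 3 * X) := by
              gcongr
              exact (le_mul_of_one_le_left zero_le (by norm_num)).trans le_self_add
          _ = _ := by ring
      _ = _ := by ring
  have hterm : ∀ (a b : Fin 2) (i : Fin 3),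
      besovNorm φ (pd (hIdx b) (coordMul (hIdx a) (v i))) ≤
        3 * A * (1 + 6 * B) * (Z + X + Y) := fun a b i => by
    refine (hA (coordMul (hIdx a) (v i)) (weightedPotential v (hIdx a) i) ((hv i).coordMul a)
      (isPeriodic_weightedPotential hv a i) (neg_laplacian_coordMul_eq hdiv (hIdx a) i) b).trans ?_
    have h1 : ∀ k, besovNorm φ (weightedPotential v (hIdx a) i k) ≤
        (Z + X + Y) + 3 * B * (Z + X + Y) + 3 * B * (Z + X + Y) := fun k => by
      refine ((isGauge_besovNorm φ).weightedPotential_le v (hIdx a) i k).trans ?_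
      gcongr
      · refine (single_le_sum_univ
          (fun a => ∑ i : Fin 3, besovNorm φ (coordMul (hIdx a) (curl v i))) a).trans ?_
        exact le_add_self.trans le_self_add
      · exact hvi i
      · exact hvi _
    calc _ ≤ A * ∑ k : Fin 3, ((Z + X + Y) + 3 * B * (Z + X + Y) + 3 * B * (Z + X + Y)) := by
          gcongr with k
          exact h1 k
      _ = _ := by simp; ring
  calc _ ≤ ∑ a : Fin 2, ∑ b : Fin 2, ∑ i : Fin 3, 3 * A * (1 + 6 * B) * (Z + X + Y) := by
        gcongr with a _ b _ i
        exact hterm a b i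
    _ = _ := by simp; ring

theorem exists_block_estimate {φ : 𝓢(R2, ℂ)} (hφ : IsDyadicPartition φ) :
    ∃ C : ℝ≥0, ∀ v : Fin 3 → 𝓢'(R3, ℂ), (∀ i, IsPeriodic (v i)) → divergence v = 0 →
      ∀ j : ℤ, 0 ≤ j →
        ∑ a : Fin 2, ∑ b : Fin 2, ∑ i : Fin 3,
            distNorm ∞ strip (block3 φ j (pd (hIdx b) (coordMul (hIdx a) (v i))))
          ≤ C * (2 : ℝ≥0∞) ^ ((j : ℝ) / 2) *
            (∑ a : Fin 2, ∑ i : Fin 3,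
                distNorm ∞ strip (block3 φ j (coordMul (hIdx a) (curl v i)))
              + ∑ i : Fin 3, distNorm 2 strip (block3 φ j (curl v i))) := by
  obtain ⟨A, -, hA⟩ := exists_block3_pd_bound hφ
  obtain ⟨B, -, hB⟩ := exists_block3_bound hφ
  refine ⟨36 * A * (1 + 6 * B), fun v hv hdiv j hj => ?_⟩
  set X := ∑ a : Fin 2, ∑ i : Fin 3, distNorm ∞ strip (block3 φ j (coordMul (hIdx a) (curl v i)))
    with hX
  set Y := ∑ i : Fin 3, distNorm 2 strip (block3 φ j (curl v i))
  set D : ℝ≥0∞ := (2 : ℝ≥0∞) ^ ((j : ℝ) / 2) with hD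
  -- Only the terms in `v` produce the factor `D`; since `D ≥ 1`, it may be put in front of the
  -- terms in `x_a Ω` as well.
  have hD1 : 1 ≤ D := by
    rw [hD, ← ENNReal.rpow_zero (x := 2)]
    exact ENNReal.rpow_le_rpow_of_exponent_le (by norm_num) (by positivity)
  have hgauge := isGauge_block3 φ j (p := ∞) le_top strip
  have hvi : ∀ i, distNorm ∞ strip (block3 φ j (v i)) ≤ 3 * B * (D * (X + Y)) := fun i => by
    refine (distNorm_mono_set (Set.subset_univ _)).trans ((hB j (v i) (skew (curl v) i) hj
      (isPeriodic_skew (isPeriodic_curl hv) i) (neg_laplacian_eq hdiv i)).trans ?_)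
    have h1 : ∑ k, distNorm 2 strip (block3 φ j (skew (curl v) i k)) ≤ 3 * Y := by
      refine (Finset.sum_le_sum fun k _ =>
        (isGauge_block3 φ j one_le_two strip).skew_le (curl v) i k).trans ?_
      simp [Y]
    calc _ ≤ B * D * (3 * (X + Y)) := by
          gcongr
          exact h1.trans (by gcongr; exact le_add_self)
      _ = _ := by ring
  have hterm : ∀ (a b : Fin 2) (i : Fin 3),
      distNorm ∞ strip (block3 φ j (pd (hIdx b) (coordMul (hIdx a) (v i)))) ≤
        3 * A * (1 + 6 * B) * (D * (X + Y)) := fun a b i => by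
    refine (distNorm_mono_set (Set.subset_univ _)).trans ((hA j (coordMul (hIdx a) (v i))
      (weightedPotential v (hIdx a) i) (isPeriodic_weightedPotential hv a i)
      (neg_laplacian_coordMul_eq hdiv (hIdx a) i) b).trans ?_)
    have h1 : ∀ k, distNorm ∞ strip (block3 φ j (weightedPotential v (hIdx a) i k)) ≤
        D * (X + Y) + 3 * B * (D * (X + Y)) + 3 * B * (D * (X + Y)) := fun k => by
      refine (hgauge.weightedPotential_le v (hIdx a) i k).trans ?_
      gcongr
      · refine (single_le_sum_univ
          (fun a => ∑ i : Fin 3, distNorm ∞ strip (block3 φ j (coordMul (hIdx a) (curl v i))))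
          a).trans ?_
        exact le_self_add.trans (le_mul_of_one_le_left zero_le hD1)
      · exact hvi i
      · exact hvi _
    calc _ ≤ A * ∑ k : Fin 3, (D * (X + Y) + 3 * B * (D * (X + Y)) + 3 * B * (D * (X + Y))) := by
          gcongr with k
          exact h1 k
      _ = _ := by simp; ring
  calc _ ≤ ∑ a : Fin 2, ∑ b : Fin 2, ∑ i : Fin 3, 3 * A * (1 + 6 * B) * (D * (X + Y)) := by
        gcongr with a _ b _ i
        exact hterm a b i
    _ = _ := by simp; ring

theorem exists_lowFreq_estimate (φ : 𝓢(R2, ℂ)) :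
    ∃ C : ℝ≥0, ∀ v : Fin 3 → 𝓢'(R3, ℂ), (∀ i, IsPeriodic (v i)) → divergence v = 0 →
      ∑ a : Fin 2, ∑ i : Fin 3, lowFreqNorm φ ∞ (coordMul (hIdx a) (v i))
        ≤ C * (∑ a : Fin 2, ∑ i : Fin 3, distNorm 2 strip (coordMul (hIdx a) (v i))
          + ∑ i : Fin 3, distNorm 2 strip (v i)
          + ∑ a : Fin 2, ∑ i : Fin 3, distNorm 2 strip (coordMul (hIdx a) (curl v i))) := by
  obtain ⟨A, hA⟩ := exists_lowFreqNorm_bound φ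
  -- Six pairs `(a, i)`, each with one term for `x_a vᵢ` and three potentials of three terms: `6 *
  -- (1 + 9)`.
  refine ⟨60 * A, fun v hv hdiv => ?_⟩
  set W := ∑ a : Fin 2, ∑ i : Fin 3, distNorm 2 strip (coordMul (hIdx a) (v i))
  set Z := ∑ i : Fin 3, distNorm 2 strip (v i)
  set X := ∑ a : Fin 2, ∑ i : Fin 3, distNorm 2 strip (coordMul (hIdx a) (curl v i))
  have hZ : ∀ i, distNorm 2 strip (v i) ≤ W + Z + X := fun i =>
    (single_le_sum_univ (fun i => distNorm 2 strip (v i)) i).trans (le_add_self.trans le_self_add)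
  have hterm : ∀ (a : Fin 2) (i : Fin 3), lowFreqNorm φ ∞ (coordMul (hIdx a) (v i)) ≤
      A * (10 * (W + Z + X)) := fun a i => by
    refine (hA (coordMul (hIdx a) (v i)) (weightedPotential v (hIdx a) i) ((hv i).coordMul a)
      (isPeriodic_weightedPotential hv a i) (neg_laplacian_coordMul_eq hdiv (hIdx a) i)).trans ?_
    have h0 : distNorm 2 strip (coordMul (hIdx a) (v i)) ≤ W + Z + X :=
      (single_le_sum_univ (fun i => distNorm 2 strip (coordMul (hIdx a) (v i))) i).trans
        ((single_le_sum_univ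
          (fun a => ∑ i : Fin 3, distNorm 2 strip (coordMul (hIdx a) (v i))) a).trans
            (le_self_add.trans le_self_add))
    have h1 : ∀ k, distNorm 2 strip (weightedPotential v (hIdx a) i k) ≤
        (W + Z + X) + (W + Z + X) + (W + Z + X) := fun k => by
      refine ((isGauge_distNorm one_le_two strip).weightedPotential_le v (hIdx a) i k).trans ?_
      refine add_le_add (add_le_add ?_ (hZ i)) (hZ _)
      exact (single_le_sum_univ
        (fun a => ∑ i : Fin 3, distNorm 2 strip (coordMul (hIdx a) (curl v i))) a).trans le_add_self
    calc _ ≤ A * ((W + Z + X) + ∑ k : Fin 3, ((W + Z + X) + (W + Z + X) + (W + Z + X))) := by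
          gcongr with k
          exact h1 k
      _ = _ := by simp; ring
  calc _ ≤ ∑ a : Fin 2, ∑ i : Fin 3, A * (10 * (W + Z + X)) := by
        gcongr with a _ i
        exact hterm a i
    _ = _ := by simp; ring

end PeriodicBesov

end

open PeriodicBesov in
/-- Norms of finite families (vector fields, gradients, and the pair of weights `x`, `y`) are the
sums of the norms of the entries. The index `a` is the weight `x` or `y`, `b` is the direction of
the horizontal derivative, and `i` is the component of the vector field. -/
theorem lemma3p7 (φ : 𝓢(R2, ℂ)) (hφ : IsDyadicPartition φ) :
    ∃ C : ℝ≥0, ∀ v : Fin 3 → 𝓢'(R3, ℂ), (∀ i, IsPeriodic (v i)) → divergence v = 0 →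
      (∑ a : Fin 2, ∑ b : Fin 2, ∑ i : Fin 3,
          besovNorm φ (pd (hIdx b) (coordMul (hIdx a) (v i)))
        ≤ C * (∑ i : Fin 3, distNorm 2 strip (v i)
          + ∑ a : Fin 2, ∑ i : Fin 3, besovNorm φ (coordMul (hIdx a) (curl v i))
          + ∑ i : Fin 3, besovNorm φ (curl v i))) ∧
      (∀ j : ℤ, 0 ≤ j →
        ∑ a : Fin 2, ∑ b : Fin 2, ∑ i : Fin 3,
            distNorm ∞ strip (block3 φ j (pd (hIdx b) (coordMul (hIdx a) (v i))))
          ≤ C * (2 : ℝ≥0∞) ^ ((j : ℝ) / 2) *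
            (∑ a : Fin 2, ∑ i : Fin 3,
                distNorm ∞ strip (block3 φ j (coordMul (hIdx a) (curl v i)))
              + ∑ i : Fin 3, distNorm 2 strip (block3 φ j (curl v i)))) ∧
      (∑ a : Fin 2, ∑ i : Fin 3, lowFreqNorm φ ∞ (coordMul (hIdx a) (v i))
        ≤ C * (∑ a : Fin 2, ∑ i : Fin 3, distNorm 2 strip (coordMul (hIdx a) (v i))
          + ∑ i : Fin 3, distNorm 2 strip (v i)
          + ∑ a : Fin 2, ∑ i : Fin 3, distNorm 2 strip (coordMul (hIdx a) (curl v i)))) := by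
  obtain ⟨C₁, h₁⟩ := exists_besov_estimate hφ
  obtain ⟨C₂, h₂⟩ := exists_block_estimate hφ
  obtain ⟨C₃, h₃⟩ := exists_lowFreq_estimate φ
  have hC₁ : (C₁ : ℝ≥0∞) ≤ ((C₁ + C₂ + C₃ : ℝ≥0) : ℝ≥0∞) :=
    ENNReal.coe_le_coe.2 (le_self_add.trans le_self_add)
  have hC₂ : (C₂ : ℝ≥0∞) ≤ ((C₁ + C₂ + C₃ : ℝ≥0) : ℝ≥0∞) :=
    ENNReal.coe_le_coe.2 (le_add_self.trans le_self_add)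
  have hC₃ : (C₃ : ℝ≥0∞) ≤ ((C₁ + C₂ + C₃ : ℝ≥0) : ℝ≥0∞) := ENNReal.coe_le_coe.2 le_add_self
  refine ⟨C₁ + C₂ + C₃, fun v hv hdiv => ⟨(h₁ v hv hdiv).trans (mul_le_mul_left hC₁ _),
    fun j hj => (h₂ v hv hdiv j hj).trans ?_, (h₃ v hv hdiv).trans (mul_le_mul_left hC₃ _)⟩⟩
  exact mul_le_mul_left (mul_le_mul_left hC₂ _) _
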